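/- Let $n\ge 0$, $X=(x_1,\dots,x_n)$, $Y=(y_1,\dots,y_n)$. **Groups.** $W_n$ is the group of barred (signed) permutations of $\{1,\dots,n\}$, generated by $s_0$ (which bars the letter $1$) and the transpositions $s_i=(i\;\,i{+}1)$, $1\le i\le n-1$; $S_n\subset W_n$ is the symmetric group. Put $\varpi_0=(n,n-1,\dots,1)$ and $w_0=(\overline 1,\overline 2,\dots,\overline n)$. For a commutative ring $A$, $W_n$ acts on $A[X]$: $s_i$ ($i\ge1$) interchanges $x_i,x_{i+1}$, and $s_0$ replaces $x_1$ by $-x_1$. For a polynomial $f$ in $n$ variables, $f(\varpi_0Y)=f(y_n,\dots,y_1)$ and $f(-\varpi_0X)=f(-x_n,\dots,-x_1)$. **Divided differences.** Let $A=\mathbb Z$ or $\mathbb Z[Y]$. On $A[X]$ set $\partial_0f=(f-s_0f)/(2x_1)$ and $\partial_if=(f-s_if)/(x_i-x_{i+1})$ for $1\le i\le n-1$; also $\partial'_0=\partial_0$ and $\partial'_i=-\partial_i$ for $i\ge1$. For $w\in W_n$ with a reduced decomposition $w=s_{a_1}\cdots s_{a_r}$ set $\partial_w=\partial_{a_1}\circ\cdots\circ\partial_{a_r}$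 and $\partial'_w=\partial'_{a_1}\circ\cdots\circ\partial'_{a_r}$. **$\widetilde Q$-polynomials.** $\mathcal D_n$ is the set of partitions with distinct nonzero parts, all in $\{1,\dots,n\}$; for $\lambda\in\mathcal D_n$, $\ell(\lambda)$ is the number of its nonzero parts and $\lambda'\in\mathcal D_n$ is the partition whose parts are the elements of $\{1,\dots,n\}$ that are not parts of $\lambda$. Let $e_i$ be the elementary symmetric polynomials, $\widetilde Q_i(X)=e_i(X)$, $\widetilde Q_{i,j}=\widetilde Q_i\widetilde Q_j+2\sum_{k=1}^j(-1)^k\widetilde Q_{i+k}\widetilde Q_{j-k}$, and $\widetilde Q_\lambda(X)=\mathrm{Pfaffian}[\widetilde Q_{\lambda_i,\lambda_j}(X)]_{1\le i<j\le r}$, where $\lambda=(\lambda_1\ge\dots\ge\lambda_r\ge0)$ with $r$ even (adding a part $\lambda_r=0$ if necessary). Put $$\widetilde Q(X,Y)=\sum_{\lambda\in\mathcal D_n}\widetilde Q_\lambda(X)\widetilde Q_{\lambda'}(Y),\qquad \Delta(X,Y)=\prod_{i+j\le n}(x_i-y_j).$$ **Double Schubert polynomials of type $C$.** For $w\in W_n$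 let $$\mathfrak C_w(X,Y)=(-1)^{n(n-1)/2}\,\partial'_{w^{-1}w_0}\bigl(\Delta(X,Y)\widetilde Q(X,Y)\bigr)\in\mathbb Z[X,Y],\qquad \mathfrak C_w(X)=\mathfrak C_w(X,0).$$ For $\lambda\in\mathcal D_n$ with $\ell=\ell(\lambda)$, $k=n-\ell$, let $\mathfrak C_\lambda(X)=\mathfrak C_{w_\lambda}(X)$, where $w_\lambda=(\overline{\lambda_1},\dots,\overline{\lambda_\ell},\lambda'_k,\dots,\lambda'_1)$. For $\varpi\in S_n$ put $\mathfrak C_{\varpi,\lambda}(X)=\mathfrak C_\varpi(X)\mathfrak C_\lambda(X)$. **Corollary (Cauchy formula).** First, $$\mathfrak C_{w_0}(X,Y)=\sum_{\varpi\in S_n}\ \sum_{\lambda\in\mathcal D_n}\mathfrak C_{\varpi\varpi_0}(-\varpi_0X)\,\mathfrak C_{\lambda'}(X)\,\mathfrak C_{\varpi}(\varpi_0Y)\,\mathfrak C_\lambda(Y).$$ Second, the products $\mathfrak C_{\varpi,\lambda}(X)$, $(\varpi,\lambda)\in S_n\times\mathcal D_n$, form a basis of $\mathbb Z[X]$ over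 the ring of invariants $\mathbb Z[X]^{W_n}$; there is a unique basis $\{\mathfrak C^{\varpi,\lambda}(X)\}$ adjoint to it with respect to the scalar product $\langle f,g\rangle=\partial_{w_0}(fg)$, that is, with $\langle\mathfrak C_{u,\lambda},\mathfrak C^{v,\mu}\rangle=\delta_{u,v}\delta_{\lambda,\mu}$; and $$\mathfrak C_{w_0}(X,Y)=\sum_{\varpi\in S_n}\ \sum_{\lambda\in\mathcal D_n}\mathfrak C^{\varpi,\lambda}(X)\,\mathfrak C_{\varpi,\lambda}(\varpi_0Y).$$ -/

import Mathlib

noncomputable section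

namespace SympSchubert

open MvPolynomial

/-! ### The hyperoctahedral group

The variables and the letters `1, …, n` are indexed by `Fin n`, the index `i` standing for the letter
`i + 1`. -/

/-- The hyperoctahedral group `W_n`, as the semidirect product of `(ℤ/2)^n` and `S_n`.
The pair `(ε, σ)` is the barred permutation whose `i`-th entry is `σ i`, barred exactly when
`ε (σ i) = -1`. The product is the composition of barred permutations as maps on the left. -/
abbrev W (n : ℕ) : Type := (Fin n → ℤˣ) ⋊[mulAutArrow] (Equiv.Perm (Fin n))

/-- The position before `i` (for `i ≠ 0`). -/
def pre {n : ℕ} (i : Fin n) : Fin n := ⟨i.val - 1, lt_of_le_of_lt (Nat.sub_le _ _) i.isLt⟩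

/-- The generators `s_0, s_1, …, s_{n-1}`: `s_0` bars the letter `1`, and for `i ≥ 1`, `s_i`
interchanges the letters `i` and `i + 1`, i.e. the indices `i - 1` and `i` of `Fin n`. -/
def s {n : ℕ} (i : Fin n) : W n :=
  if i.val = 0 then SemidirectProduct.inl (Pi.mulSingle i (-1))
  else SemidirectProduct.inr (Equiv.swap (pre i) i)

/-- The embedding of `S_n` in `W_n` as the unbarred permutations. -/
def ofPerm {n : ℕ} (p : Equiv.Perm (Fin n)) : W n := SemidirectProduct.inr p

/-- The longest element `(n, n-1, …, 1)` of `S_n`. -/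
def revPerm (n : ℕ) : Equiv.Perm (Fin n) := Fin.revPerm

/-- The longest element of `W_n`, in which all of `1, …, n` are barred and in their places. -/
def w0 (n : ℕ) : W n := SemidirectProduct.inl (fun _ => -1)

/-- `l` is (the list of indices of) a reduced decomposition of `w`: an expression of `w` as a
product of generators, of minimal length. -/
def IsReducedWord {n : ℕ} (l : List (Fin n)) (w : W n) : Prop :=
  (l.map s).prod = w ∧ ∀ l' : List (Fin n), (l'.map s).prod = w → l.length ≤ l'.length

theorem inr_mem_closure {n : ℕ} (p : Equiv.Perm (Fin n)) :
    ofPerm p ∈ Submonoid.closure (Set.range (s (n := n))) := by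
  cases n with
  | zero =>
    have : ofPerm p = 1 := by
      have : p = 1 := Subsingleton.elim _ _
      subst this; exact map_one SemidirectProduct.inr
    rw [this]; exact one_mem _
  | succ m =>
    have hp : p ∈ Submonoid.closure
        (Set.range fun i : Fin m => Equiv.swap i.castSucc i.succ) := by
      rw [Equiv.Perm.mclosure_swap_castSucc_succ]; trivial
    induction hp using Submonoid.closure_induction with
    | mem x hx =>
      obtain ⟨i, rfl⟩ := hx
      refine Submonoid.subset_closure ⟨i.succ, ?_⟩
      have h1 : pre i.succ = i.castSucc := by ext; simp [pre]
      simp [s, h1, ofPerm]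
    | one =>
      have : ofPerm (1 : Equiv.Perm (Fin (m + 1))) = 1 := map_one SemidirectProduct.inr
      rw [this]; exact one_mem _
    | mul x y _ _ hx hy =>
      have : ofPerm (x * y) = ofPerm x * ofPerm y := map_mul SemidirectProduct.inr x y
      rw [this]; exact mul_mem hx hy

theorem single_mem_closure {n : ℕ} (j : Fin n) (u : ℤˣ) :
    (SemidirectProduct.inl (Pi.mulSingle j u) : W n) ∈
      Submonoid.closure (Set.range (s (n := n))) := by
  rcases Int.units_eq_one_or u with rfl | rfl
  · simp
  have hn : 0 < n := j.pos
  let z : Fin n := ⟨0, hn⟩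
  have hz : s z = SemidirectProduct.inl (Pi.mulSingle z (-1)) := by simp [s, z]
  have h : (SemidirectProduct.inl (Pi.mulSingle j (-1)) : W n) =
      ofPerm (Equiv.swap z j) * s z * ofPerm (Equiv.swap z j) := by
    rw [hz]
    refine SemidirectProduct.ext ?_ ?_
    · funext k
      simp only [ofPerm, SemidirectProduct.mul_left, SemidirectProduct.left_inl,
        SemidirectProduct.left_inr, SemidirectProduct.right_inr, map_one, mul_one, one_mul,
        SemidirectProduct.mul_right, SemidirectProduct.right_inl]
      simp only [mulAutArrow_apply_apply, Pi.mulSingle_apply]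
      have : (Equiv.swap z j)⁻¹ • k = z ↔ k = j := by
        rw [inv_smul_eq_iff, Equiv.Perm.smul_def, Equiv.swap_apply_left]
      change _ = (Pi.mulSingle z (-1) : Fin n → ℤˣ) ((Equiv.swap z j)⁻¹ • k)
      rw [Pi.mulSingle_apply]
      by_cases hk : k = j
      · rw [if_pos hk, if_pos (this.2 hk)]
      · rw [if_neg hk, if_neg fun h => hk (this.1 h)]
    · simp [ofPerm]
  rw [h]
  exact mul_mem (mul_mem (inr_mem_closure _) (Submonoid.subset_closure ⟨z, rfl⟩))
    (inr_mem_closure _)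

theorem mem_closure_s {n : ℕ} (w : W n) : w ∈ Submonoid.closure (Set.range (s (n := n))) := by
  rw [← SemidirectProduct.inl_left_mul_inr_right w]
  refine mul_mem ?_ (inr_mem_closure _)
  rw [← Finset.univ_prod_mulSingle w.left]
  refine Finset.prod_induction _
    (fun v => (SemidirectProduct.inl v : W n) ∈ Submonoid.closure (Set.range (s (n := n))))
    (fun a b ha hb => ?_) ?_ fun i _ => single_mem_closure i _
  · rw [map_mul]; exact mul_mem ha hb
  · rw [map_one]; exact one_mem _

theorem exists_isReducedWord {n : ℕ} (w : W n) : ∃ l : List (Fin n), IsReducedWord l w := by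
  classical
  have h : ∃ k, ∃ l : List (Fin n), (l.map s).prod = w ∧ l.length = k := by
    obtain ⟨l, hl, rfl⟩ := Submonoid.exists_list_of_mem_closure (mem_closure_s w)
    obtain ⟨l', rfl⟩ : l ∈ Set.range (List.map (s (n := n))) := by
      rw [Set.range_list_map]; exact hl
    exact ⟨_, l', rfl, rfl⟩
  obtain ⟨l, h1, h2⟩ := Nat.find_spec h
  exact ⟨l, h1, fun l' hl' => h2 ▸ Nat.find_min' h ⟨l', hl', rfl⟩⟩

/-- A reduced decomposition of `w`. -/
def reducedWord {n : ℕ} (w : W n) : List (Fin n) := Classical.choose (exists_isReducedWord w)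

/-! ### Action on polynomials and divided differences -/

section Action

variable {n : ℕ} {A : Type*} [CommRing A]

/-- The action of `w ∈ W_n` on `A[X]`: the variable `x_i` goes to `± x_j`, where `j` is the `i`-th
entry of `w` without its bar, and the sign is `-` when this entry is barred. -/
def act (w : W n) : MvPolynomial (Fin n) A →ₐ[A] MvPolynomial (Fin n) A :=
  aeval fun i => ((w.left (w.right i) : ℤ) : MvPolynomial (Fin n) A) * X (w.right i)

/-- The denominators of the divided differences: `2 x_1` for `i = 0`, and `x_i - x_{i+1}` for
`i ≥ 1`. -/
def root (A : Type*) [CommRing A] (i : Fin n) : MvPolynomial (Fin n) A :=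
  if i.val = 0 then 2 * X i else X (pre i) - X i

theorem root_dvd (i : Fin n) (f : MvPolynomial (Fin n) A) : root A i ∣ f - act (s i) f := by
  induction f using MvPolynomial.induction_on with
  | C a => simp [act]
  | add p q hp hq =>
    have : p + q - act (s i) (p + q) = (p - act (s i) p) + (q - act (s i) q) := by
      rw [map_add]; ring
    rw [this]; exact dvd_add hp hq
  | mul_X p j hp =>
    have h : p * X j - act (s i) (p * X j) =
        (p - act (s i) p) * X j + act (s i) p * (X j - act (s i) (X j)) := by
      rw [map_mul]; ring
    rw [h]
    refine dvd_add (hp.mul_right _) (Dvd.dvd.mul_left ?_ _)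
    by_cases hi : i.val = 0
    · by_cases hj : j = i
      · subst hj; simp [act, s, root, hi]; ring_nf; rfl
      · simp [act, s, hi, hj]
    · simp only [act, s, root, hi, if_false, aeval_X, SemidirectProduct.left_inr,
        SemidirectProduct.right_inr, Pi.one_apply, Units.val_one, Int.cast_one, one_mul]
      by_cases hj : j = i
      · subst hj; rw [Equiv.swap_apply_right]; exact ⟨-1, by ring⟩
      · by_cases hj' : j = pre i
        · subst hj'; rw [Equiv.swap_apply_left]
        · rw [Equiv.swap_apply_of_ne_of_ne hj' hj]; simp

/-- The divided difference operators on `A[X]`, `∂_i f = (f - s_i f) / (x_i - x_{i+1})` for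
`i ≥ 1` and `∂_0 f = (f - s_0 f) / (2 x_1)`. (The quotient is unique when `2` is not a zero divisor
in `A`, as for the rings `ℤ` and `ℤ[Y]` used here.) -/
def dd (i : Fin n) (f : MvPolynomial (Fin n) A) : MvPolynomial (Fin n) A :=
  Classical.choose (root_dvd i f)

theorem root_mul_dd (i : Fin n) (f : MvPolynomial (Fin n) A) :
    root A i * dd i f = f - act (s i) f := (Classical.choose_spec (root_dvd i f)).symm

/-- The signed operators `∂'_0 = ∂_0`, and `∂'_i = -∂_i` for `i ≥ 1`. -/
def dd' (i : Fin n) (f : MvPolynomial (Fin n) A) : MvPolynomial (Fin n) A :=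
  if i.val = 0 then dd i f else -dd i f

/-- `∂_w = ∂_{a_1} ∘ ⋯ ∘ ∂_{a_r}` for a reduced decomposition `w = s_{a_1} ⋯ s_{a_r}`. -/
def ddW (w : W n) (f : MvPolynomial (Fin n) A) : MvPolynomial (Fin n) A :=
  (reducedWord w).foldr dd f

/-- `∂'_w = ∂'_{a_1} ∘ ⋯ ∘ ∂'_{a_r}` for a reduced decomposition `w = s_{a_1} ⋯ s_{a_r}`. -/
def ddW' (w : W n) (f : MvPolynomial (Fin n) A) : MvPolynomial (Fin n) A :=
  (reducedWord w).foldr dd' f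

end Action

/-- The ring of invariants `ℤ[X]^{W_n}`. -/
def invariants (n : ℕ) : Subalgebra ℤ (MvPolynomial (Fin n) ℤ) where
  carrier := {f | ∀ w : W n, act w f = f}
  mul_mem' ha hb w := by rw [map_mul, ha w, hb w]
  add_mem' ha hb w := by rw [map_add, ha w, hb w]
  algebraMap_mem' r w := by simp

/-- The scalar product `⟨f, g⟩ = ∂_{w_0}(f g)` on `ℤ[X]`. -/
def scalarProduct {n : ℕ} (f g : MvPolynomial (Fin n) ℤ) : MvPolynomial (Fin n) ℤ :=
  ddW (w0 n) (f * g)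

/-! ### The polynomials `Q̃` -/

/-- The Pfaffian of the array `(a i j)_{i < j}`, by expansion along the first row (zero when the
size is odd). Only the entries above the diagonal are used. -/
def pfaffian {R : Type*} [CommRing R] : (r : ℕ) → (Fin r → Fin r → R) → R
  | 0, _ => 1
  | 1, _ => 0
  | r + 2, a => ∑ j : Fin (r + 1), (-1) ^ j.val * a 0 j.succ *
      pfaffian r (fun p q => a (j.succAbove p).succ (j.succAbove q).succ)

/-- The set `𝒟_n` of strict partitions contained in `ρ_n = (n, n-1, …, 1)`, that is, of partitions
with distinct parts taken from `{1, …, n}`. A strict partition is given by its set of nonzero parts,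
the element `i` of `Fin n` standing for the part `i + 1`. The dual partition `λ'` is the
complement `λᶜ`. -/
abbrev StrictPart (n : ℕ) : Type := Finset (Fin n)

/-- The `i`-th part of `λ` (counted from `i = 0`), in decreasing order; `0` for `i ≥ ℓ(λ)`. -/
def part {n : ℕ} (lam : StrictPart n) (i : ℕ) : ℕ :=
  ((lam.sort (· ≥ ·)).map fun j : Fin n => j.val + 1).getD i 0

/-- `Q̃_{i,j}(X) = Q̃_i Q̃_j + 2 ∑_{k=1}^{j} (-1)^k Q̃_{i+k} Q̃_{j-k}`, where `Q̃_i = e_i(X)`. -/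
def Qpair (n i j : ℕ) : MvPolynomial (Fin n) ℤ :=
  esymm (Fin n) ℤ i * esymm (Fin n) ℤ j +
    2 * ∑ k ∈ Finset.Icc 1 j, (-1) ^ k * esymm (Fin n) ℤ (i + k) * esymm (Fin n) ℤ (j - k)

/-- `Q̃_λ(X)`, the Pfaffian of `Q̃_{λ_i, λ_j}(X)` for `1 ≤ i < j ≤ r`, where `r` is `ℓ(λ)` or
`ℓ(λ) + 1`, whichever is even. -/
def Qtilde {n : ℕ} (lam : StrictPart n) : MvPolynomial (Fin n) ℤ :=
  pfaffian (lam.card + lam.card % 2) fun i j => Qpair n (part lam i) (part lam j)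

/-! ### Double Schubert polynomials of type `C` -/

/-- The ring `ℤ[X, Y]`, as polynomials in `X` over `ℤ[Y]`. -/
abbrev DoublePoly (n : ℕ) : Type := MvPolynomial (Fin n) (MvPolynomial (Fin n) ℤ)

/-- `f(X)` as an element of `ℤ[X, Y]`. -/
def inX {n : ℕ} (f : MvPolynomial (Fin n) ℤ) : DoublePoly n := MvPolynomial.map C f

/-- `f(Y)` as an element of `ℤ[X, Y]`. -/
def inY {n : ℕ} (f : MvPolynomial (Fin n) ℤ) : DoublePoly n := C f

/-- The substitution `Y = 0`. -/
def atYZero {n : ℕ} (F : DoublePoly n) : MvPolynomial (Fin n) ℤ :=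
  MvPolynomial.map constantCoeff F

/-- `Δ(X, Y) = ∏_{i + j ≤ n} (x_i - y_j)`. -/
def Delta (n : ℕ) : DoublePoly n :=
  ∏ p : Fin n × Fin n with (p.1.val + 1) + (p.2.val + 1) ≤ n, (inX (X p.1) - inY (X p.2))

/-- The kernel `Q̃(X, Y) = ∑_{λ ∈ 𝒟_n} Q̃_λ(X) Q̃_{λ'}(Y)`. -/
def QKernel (n : ℕ) : DoublePoly n :=
  ∑ lam : StrictPart n, inX (Qtilde lam) * inY (Qtilde lamᶜ)

/-- The type `C` double Schubert polynomial `ℭ_w(X, Y)`. -/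
def CC {n : ℕ} (w : W n) : DoublePoly n :=
  (-1) ^ (n * (n - 1) / 2) * ddW' (w⁻¹ * w0 n) (Delta n * QKernel n)

/-- The single polynomial `ℭ_w(X) = ℭ_w(X, 0)`. -/
def CS {n : ℕ} (w : W n) : MvPolynomial (Fin n) ℤ := atYZero (CC w)

/-- The unbarred one-line notation `(λ_1, …, λ_ℓ, λ'_k, …, λ'_1)`. -/
def grassWord {n : ℕ} (lam : StrictPart n) : List (Fin n) :=
  lam.sort (· ≥ ·) ++ lamᶜ.sort (· ≤ ·)

theorem grassWord_nodup {n : ℕ} (lam : StrictPart n) : (grassWord lam).Nodup := by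
  refine List.Nodup.append (Finset.sort_nodup _ _) (Finset.sort_nodup _ _) ?_
  intro x hx hy
  simp at hx hy
  exact hy hx

theorem mem_grassWord {n : ℕ} (lam : StrictPart n) (x : Fin n) : x ∈ grassWord lam := by
  simp [grassWord, em]

theorem length_grassWord {n : ℕ} (lam : StrictPart n) : n = (grassWord lam).length := by
  have := Fintype.card_congr
    ((grassWord_nodup lam).getEquivOfForallMemList _ (mem_grassWord lam))
  simpa using this.symm

/-- The permutation with one-line notation `grassWord lam`. -/
def grassPerm {n : ℕ} (lam : StrictPart n) : Equiv.Perm (Fin n) :=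
  (finCongr (length_grassWord lam)).trans
    ((grassWord_nodup lam).getEquivOfForallMemList _ (mem_grassWord lam))

/-- The maximal Grassmannian element `w_λ`, with one-line notation
`(λ_1, …, λ_ℓ, λ'_k, …, λ'_1)` in which exactly `λ_1, …, λ_ℓ` are barred. -/
def grass {n : ℕ} (lam : StrictPart n) : W n :=
  ⟨fun j => if j ∈ lam then -1 else 1, grassPerm lam⟩

/-- `ℭ_ϖ(X)` for a permutation `ϖ ∈ S_n`. -/
def CPerm {n : ℕ} (p : Equiv.Perm (Fin n)) : MvPolynomial (Fin n) ℤ := CS (ofPerm p)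

/-- `ℭ_λ(X) = ℭ_{w_λ}(X)` for a strict partition `λ ∈ 𝒟_n`. -/
def CPart {n : ℕ} (lam : StrictPart n) : MvPolynomial (Fin n) ℤ := CS (grass lam)

/-- The product `ℭ_{ϖ,λ}(X) = ℭ_ϖ(X) ℭ_λ(X)`. -/
def CProd {n : ℕ} (p : Equiv.Perm (Fin n) × StrictPart n) : MvPolynomial (Fin n) ℤ :=
  CPerm p.1 * CPart p.2

/-- `f(ϖ_0 X) = f(x_n, …, x_1)`. -/
def revVars {n : ℕ} (f : MvPolynomial (Fin n) ℤ) : MvPolynomial (Fin n) ℤ :=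
  aeval (fun i => X (revPerm n i)) f

/-- `f(-ϖ_0 X) = f(-x_n, …, -x_1)`. -/
def negRevVars {n : ℕ} (f : MvPolynomial (Fin n) ℤ) : MvPolynomial (Fin n) ℤ :=
  aeval (fun i => -X (revPerm n i)) f

/-- Two bases of `ℤ[X]` over `ℤ[X]^{W_n}` are adjoint relative to the scalar product. -/
def IsAdjoint {n : ℕ} {ι : Type*} [DecidableEq ι]
    (b c : Module.Basis ι (invariants n) (MvPolynomial (Fin n) ℤ)) : Prop :=
  ∀ i j, scalarProduct (b i) (c j) = if i = j then 1 else 0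

end SympSchubert

end

noncomputable section

namespace SympSchubert

open MvPolynomial

/-! ### Abstract divided differences -/

section Abstract

variable {R : Type*} [CommRing R] [IsDomain R]

/-! By definition `CC (w0 n)` is, up to sign, the product of `Delta n` and `QKernel n`, so the first
formula is a product of two expansions: one of Δ over permutations, one of the kernel over strict
partitions. What has to be proved is that the single polynomials appearing in these expansions are
the ones obtained from divided differences.

For strict partitions the claim is `CPart_eq_Qtilde`: ℭ_λ = Q̃_λ. At Y = 0 the top polynomial
becomes x^δ Q̃_ρ, with δ = (n-1, …, 0) and ρ = (n, …, 1). The element w_λ⁻¹ w_0 is written as a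
power of the cycle s_{n-1} ⋯ s_1 s_0 times a sorting word. The sorting word strips from x^δ the
exponents belonging to the parts of λ. Each cycle consumes one remaining exponent j and, by
`DL_cycW_QT`, deletes the part n - j from the Pfaffian, so exactly the parts outside λ disappear.

For permutations, ϖ⁻¹ w_0 = (w_0 ϖ_0)(ϖ_0 ϖ⁻¹). The operator of w_0 ϖ_0 intertwines ∂'_k with
∂'_{n-k}, as does the substitution X ↦ -ϖ_0 X, and it sends x^δ G to (x^δ)(-ϖ_0 X) times its value
at G when G is symmetric. Hence ℭ_ϖ is a reversed type A divided difference of x^δ (`CPerm_eq`). The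
expansion of Δ (`sum_CPerm`) then holds because both sides have exchanged divided differences in X
and Y, lie under the staircase in X, and agree at X = 0; `Balanced.eq` says that this determines a
polynomial.

For the bases, the first formula suggests the dual family `dualProd`. The kernel Σ w(dual_i) ℭ_i
vanishes for every w ≠ 1 (`sum_act_dualProd`): for an unbarred w a factor of Δ(wX, ϖ_0 X) is zero.
For a barred w, the Pieri rule for e_1 is self-dual under λ ↦ λ', so multiplying the Q̃ part of the
kernel by e_1(wX) or by e_1(X) gives the same result, and that part is zero. Expanding ∂_{w_0} over
the fraction field as a combination of group elements, only the identity contributes to Σ ∂_{w_0}(f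
dual_i) ℭ_i; this sum is therefore a constant multiple of f, and f = 1 shows that the multiple is
one (`sum_ddW'_w0_dualProd`). This gives generation. Independence follows from a nonzero determinant
(`eq_zero_of_sum_mul_CProd`), and adjointness by comparing coefficients.

All of this needs ∂'_w to be independent of the reduced word, which is derived from the braid
relations and inversion counting (`ddL_eq_of_wprod_eq`). Reducedness of the particular words is
mostly certified by exhibiting a nonzero value (`ddL_eq_ddW'_of_ne_zero`). -/

theorem divided_braid_three {σ τ : R →+* R} {r q : R} {D E : R → R}
    (hD : ∀ f, r * D f = f - σ f) (hE : ∀ f, q * E f = f - τ f)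
    (hσ : ∀ f, σ (σ f) = f) (hτ : ∀ f, τ (τ f) = f) (hστ : ∀ f, σ (τ (σ f)) = τ (σ (τ f)))
    (hσr : σ r = -r) (hτq : τ q = -q) (hσq : σ q = q + r) (hτr : τ r = q + r)
    (hr : r ≠ 0) (hq : q ≠ 0) (hqr : q + r ≠ 0) (f : R) : D (E (D f)) = E (D (E f)) := by
  -- Multiplied by the product of the three positive roots, either composite becomes the alternating
  -- sum over the dihedral group of order 6, in which σ and τ play symmetric roles.
  have key : q * r * (q + r) * D (E (D f)) =
      f - σ f - τ f + σ (τ f) + τ (σ f) - σ (τ (σ f)) := by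
    apply mul_left_cancel₀ hr
    have h1 := hD (E (D f))
    have h2 := hE (D f)
    have h3 := hD f
    have h4 := congrArg τ h3
    have h5 := congrArg σ h2
    have h6 := congrArg σ h3
    simp only [map_mul, map_sub, hτr, hσr, hσq, hσ] at h4 h5 h6
    have h7 := congrArg σ h4
    simp only [map_mul, map_sub, map_add, hσr, hσq] at h7
    linear_combination q * r * (q + r) * h1 + r * (q + r) * h2 + (q + r) * h3 - r * h4 -
      q * r * h5 + q * h6 + r * h7
  have key' : q * r * (q + r) * E (D (E f)) =
      f - σ f - τ f + σ (τ f) + τ (σ f) - τ (σ (τ f)) := by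
    apply mul_left_cancel₀ hq
    have h1 := hE (D (E f))
    have h2 := hD (E f)
    have h3 := hE f
    have h4 := congrArg σ h3
    have h5 := congrArg τ h2
    have h6 := congrArg τ h3
    simp only [map_mul, map_sub, hτr, hτq, hσq, hτ] at h4 h5 h6
    have h7 := congrArg τ h4
    simp only [map_mul, map_sub, map_add, hτr, hτq] at h7
    linear_combination q * r * (q + r) * h1 + q * (q + r) * h2 + (q + r) * h3 - q * h4 -
      q * r * h5 + r * h6 + q * h7
  apply mul_left_cancel₀ (mul_ne_zero (mul_ne_zero hq hr) hqr)
  rw [key, key', hστ]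

/-- The positive roots are now r, q, q + r and r + 2q, and each composite times their product is the
alternating sum over the dihedral group of order 8. The composites are expanded two operators at a
time, using that D f is fixed by σ and E f by τ to shorten the outer half. -/
theorem divided_braid_four {σ τ : R →+* R} {r q : R} {D E : R → R}
    (hD : ∀ f, r * D f = f - σ f) (hE : ∀ f, q * E f = f - τ f)
    (hσ : ∀ f, σ (σ f) = f) (hτ : ∀ f, τ (τ f) = f)
    (hστ : ∀ f, σ (τ (σ (τ f))) = τ (σ (τ (σ f))))
    (hσr : σ r = -r) (hτq : τ q = -q) (hσq : σ q = q + r) (hτr : τ r = r + 2 * q)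
    (hr : r ≠ 0) (hq : q ≠ 0) (hqr : q + r ≠ 0) (hr2q : r + 2 * q ≠ 0) (f : R) :
    D (E (D (E f))) = E (D (E (D f))) := by
  have hDE : ∀ f, r * q * (q + r) * D (E f) = (q + r) * (f - τ f) - q * (σ f - σ (τ f)) := by
    intro f
    have h1 := hD (E f)
    have h2 := hE f
    have h3 := congrArg σ h2
    simp only [map_mul, map_sub, hσq] at h3
    linear_combination q * (q + r) * h1 + (q + r) * h2 - q * h3
  have hED : ∀ f, r * q * (r + 2 * q) * E (D f) =
      (r + 2 * q) * (f - σ f) - r * (τ f - τ (σ f)) := by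
    intro f
    have h1 := hE (D f)
    have h2 := hD f
    have h3 := congrArg τ h2
    simp only [map_mul, map_sub, hτr] at h3
    linear_combination r * (r + 2 * q) * h1 + (r + 2 * q) * h2 - r * h3
  have hσD : ∀ f, σ (D f) = D f := by
    intro f
    apply mul_left_cancel₀ hr
    have h := congrArg σ (hD f)
    simp only [map_mul, map_sub, hσr, hσ] at h
    linear_combination -h - hD f
  have hτE : ∀ f, τ (E f) = E f := by
    intro f
    apply mul_left_cancel₀ hq
    have h := congrArg τ (hE f)
    simp only [map_mul, map_sub, hτq, hτ] at h
    linear_combination -h - hE f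
  have key : r * q * (q + r) * (r + 2 * q) * D (E (D (E f))) =
      f - σ f - τ f + σ (τ f) + τ (σ f) - σ (τ (σ f)) - τ (σ (τ f)) + σ (τ (σ (τ f))) := by
    apply mul_left_cancel₀ (mul_ne_zero hq hqr)
    have h1 := hDE (D (E f))
    rw [hσD] at h1
    have h2 := hDE f
    have h3 := congrArg τ h2
    simp only [map_mul, map_sub, map_add, hτr, hτq, hτ] at h3
    have h4 := congrArg σ h3
    simp only [map_mul, map_sub, map_add, map_neg, map_ofNat, hσr, hσq] at h4
    linear_combination q * (q + r) * (r + 2 * q) * h1 + (r + 2 * q) * h2 + (q + r) * h3 - q * h4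
  have key' : r * q * (q + r) * (r + 2 * q) * E (D (E (D f))) =
      f - σ f - τ f + σ (τ f) + τ (σ f) - σ (τ (σ f)) - τ (σ (τ f)) + τ (σ (τ (σ f))) := by
    apply mul_left_cancel₀ (mul_ne_zero hr hr2q)
    have h1 := hED (E (D f))
    rw [hτE] at h1
    have h2 := hED f
    have h3 := congrArg σ h2
    simp only [map_mul, map_sub, map_add, map_ofNat, hσr, hσq, hσ] at h3
    have h4 := congrArg τ h3
    simp only [map_mul, map_sub, map_add, map_neg, map_ofNat, hτr, hτq] at h4
    linear_combination r * (q + r) * (r + 2 * q) * h1 + 2 * (q + r) * h2 +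
      (r + 2 * q) * h3 - r * h4
  apply mul_left_cancel₀ (mul_ne_zero (mul_ne_zero (mul_ne_zero hr hq) hqr) hr2q)
  rw [key, key', hστ]

theorem divided_comm {σ τ : R →+* R} {r q : R} {D E : R → R}
    (hD : ∀ f, r * D f = f - σ f) (hE : ∀ f, q * E f = f - τ f)
    (hστ : ∀ f, σ (τ f) = τ (σ f)) (hσq : σ q = q) (hτr : τ r = r)
    (hr : r ≠ 0) (hq : q ≠ 0) (f : R) : D (E f) = E (D f) := by
  apply mul_left_cancel₀ (mul_ne_zero hr hq)
  have h1 := hD (E f)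
  have h2 := hE f
  have h3 := congrArg σ h2
  have h4 := hE (D f)
  have h5 := hD f
  have h6 := congrArg τ h5
  simp only [map_mul, map_sub, hσq, hτr] at h3 h6
  linear_combination q * h1 + h2 - h3 - r * h4 - h5 + h6 + hστ f

end Abstract

/-! ### The group action -/

section Action

variable {n : ℕ} {A : Type*} [CommRing A]

theorem act_X (w : W n) (i : Fin n) : act w (X i : MvPolynomial (Fin n) A) =
    ((w.left (w.right i) : ℤ) : MvPolynomial (Fin n) A) * X (w.right i) := by
  simp [act]

theorem act_one (f : MvPolynomial (Fin n) A) : act (1 : W n) f = f := by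
  have : act (A := A) (1 : W n) = AlgHom.id A _ := by
    ext i; simp [act_X]
  rw [this]; rfl

theorem left_mul_apply (u v : W n) (k : Fin n) :
    (u * v).left k = u.left k * v.left (u.right⁻¹ k) := by
  rw [SemidirectProduct.mul_left, Pi.mul_apply]; rfl

theorem act_mul (u v : W n) (f : MvPolynomial (Fin n) A) :
    act (u * v) f = act u (act v f) := by
  have : act (A := A) (u * v) = (act u).comp (act v) := by
    ext i : 1
    simp only [AlgHom.comp_apply, act_X, map_mul, map_intCast, left_mul_apply,
      SemidirectProduct.mul_right, Equiv.Perm.mul_apply]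
    rw [show (u.right)⁻¹ (u.right (v.right i)) = v.right i from u.right.symm_apply_apply _]
    push_cast; ring
  rw [this]; rfl

theorem s_mul_s (i : Fin n) : s i * s i = 1 := by
  unfold s
  split_ifs with h
  · rw [← map_mul, ← Pi.mulSingle_mul]; simp
  · rw [← map_mul, Equiv.swap_mul_self, map_one]

theorem act_s_act_s (i : Fin n) (f : MvPolynomial (Fin n) A) : act (s i) (act (s i) f) = f := by
  rw [← act_mul, s_mul_s, act_one]

theorem act_s_X_zero {i : Fin n} (hi : i.val = 0) (j : Fin n) :
    act (s i) (X j : MvPolynomial (Fin n) A) = if j = i then -X j else X j := by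
  rw [act_X]; simp only [s, hi, if_true, SemidirectProduct.right_inl, SemidirectProduct.left_inl,
    Equiv.Perm.one_apply, Pi.mulSingle_apply]
  split_ifs <;> simp

theorem act_s_X_pos {i : Fin n} (hi : i.val ≠ 0) (j : Fin n) :
    act (s i) (X j : MvPolynomial (Fin n) A) = X (Equiv.swap (pre i) i j) := by
  rw [act_X]; simp [s, hi]

/-- The simple roots adapted to the operators `∂'`. -/
def root' (A : Type*) [CommRing A] (i : Fin n) : MvPolynomial (Fin n) A :=
  if i.val = 0 then 2 * X i else X i - X (pre i)

theorem root'_mul_dd' (i : Fin n) (f : MvPolynomial (Fin n) A) :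
    root' A i * dd' i f = f - act (s i) f := by
  rw [← root_mul_dd]
  unfold root' dd' root
  split_ifs
  · rfl
  · ring

theorem pre_ne {i : Fin n} (hi : i.val ≠ 0) : pre i ≠ i := by
  intro h
  have := congrArg Fin.val h
  simp [pre] at this; omega

theorem act_s_root' (i : Fin n) : act (s i) (root' A i) = -root' A i := by
  unfold root'
  split_ifs with h
  · simp [act_s_X_zero h, map_ofNat]
  · simp [act_s_X_pos h]

variable [IsDomain A] [CharZero A]

theorem root'_ne_zero (i : Fin n) : root' A i ≠ 0 := by
  unfold root'
  split_ifs with h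
  · exact mul_ne_zero two_ne_zero (X_ne_zero i)
  · rw [sub_ne_zero]; exact fun h' => pre_ne h (X_injective h').symm

/-- The quotient is obtained by choice, so identities for the operators are established by checking
them after multiplication by the nonzero root. -/
theorem dd'_unique {i : Fin n} {f g : MvPolynomial (Fin n) A}
    (h : root' A i * g = f - act (s i) f) : dd' i f = g :=
  mul_left_cancel₀ (root'_ne_zero i) (by rw [root'_mul_dd', h])

end Action

/-! ### Operators indexed by natural numbers -/

section Nat

variable (n : ℕ) (A : Type*) [CommRing A]

/-- The variable with index `k`, zero out of range. -/
def xv (k : ℕ) : MvPolynomial (Fin n) A := if h : k < n then X ⟨k, h⟩ else 0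

/-- The action of the generator with index `k`, trivial out of range. -/
def sg (k : ℕ) : MvPolynomial (Fin n) A →ₐ[A] MvPolynomial (Fin n) A :=
  if h : k < n then act (s ⟨k, h⟩) else AlgHom.id A _

/-- The simple root with index `k`, one out of range. -/
def rt (k : ℕ) : MvPolynomial (Fin n) A := if h : k < n then root' A ⟨k, h⟩ else 1

/-- The operator `∂'_k`, zero out of range. -/
def DD (k : ℕ) (f : MvPolynomial (Fin n) A) : MvPolynomial (Fin n) A :=
  if h : k < n then dd' ⟨k, h⟩ f else 0

variable {n A}

theorem rt_mul_DD (k : ℕ) (f : MvPolynomial (Fin n) A) : rt n A k * DD n A k f = f - sg n A k f := by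
  unfold rt DD sg
  split_ifs
  · exact root'_mul_dd' _ _
  · simp

theorem DD_fin (i : Fin n) (f : MvPolynomial (Fin n) A) : DD n A i f = dd' i f := by simp [DD]

theorem sg_fin (i : Fin n) : sg n A i = act (s i) := by simp [sg]

theorem sg_sg (k : ℕ) (f : MvPolynomial (Fin n) A) : sg n A k (sg n A k f) = f := by
  unfold sg
  split_ifs
  · exact act_s_act_s _ _
  · rfl

theorem xv_of_lt {k : ℕ} (h : k < n) : xv n A k = X ⟨k, h⟩ := by simp [xv, h]

theorem rt_zero (h : 0 < n) : rt n A 0 = 2 * xv n A 0 := by simp [rt, xv, root', h]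

theorem rt_succ {k : ℕ} (h : k + 1 < n) : rt n A (k + 1) = xv n A (k + 1) - xv n A k := by
  have : k < n := by omega
  simp [rt, xv, root', h, this, pre]

theorem sg_zero_xv (h : 0 < n) : sg n A 0 (xv n A 0) = -xv n A 0 := by
  simp [sg, xv, h, act_s_X_zero]

theorem sg_zero_xv_of_ne {j : ℕ} (hj : j ≠ 0) : sg n A 0 (xv n A j) = xv n A j := by
  unfold sg xv
  split_ifs with h1 h2
  · rw [act_s_X_zero rfl, if_neg]; simpa [Fin.ext_iff] using hj
  · simp
  · simp
  · simp

theorem sg_succ_xv {k : ℕ} (h : k + 1 < n) : sg n A (k + 1) (xv n A k) = xv n A (k + 1) := by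
  have hk : k < n := by omega
  have : pre (⟨k + 1, h⟩ : Fin n) = ⟨k, hk⟩ := by simp [pre]
  simp only [sg, xv, h, hk, dif_pos]
  rw [act_s_X_pos (by simp), this, Equiv.swap_apply_left]

theorem sg_succ_xv' {k : ℕ} (h : k + 1 < n) : sg n A (k + 1) (xv n A (k + 1)) = xv n A k := by
  rw [← sg_succ_xv h, sg_sg]

theorem sg_succ_xv_of_ne {k j : ℕ} (hj : j ≠ k) (hj' : j ≠ k + 1) :
    sg n A (k + 1) (xv n A j) = xv n A j := by
  unfold sg xv
  split_ifs with h1 h2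
  · rw [act_s_X_pos (by simp), Equiv.swap_apply_of_ne_of_ne] <;> simp [Fin.ext_iff, pre, hj, hj']
  · simp
  · simp
  · simp

theorem sg_xv_of_ne {k j : ℕ} (hj : j + 1 ≠ k) (hj' : j ≠ k) :
    sg n A k (xv n A j) = xv n A j := by
  cases k with
  | zero => exact sg_zero_xv_of_ne hj'
  | succ k => exact sg_succ_xv_of_ne (by omega) hj'

theorem sg_rt (k : ℕ) (h : k < n) : sg n A k (rt n A k) = -rt n A k := by
  simp [sg, rt, h, act_s_root']

theorem sg_of_le {k : ℕ} (h : n ≤ k) (f : MvPolynomial (Fin n) A) : sg n A k f = f := by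
  simp [sg, not_lt.2 h]

theorem DD_of_le {k : ℕ} (h : n ≤ k) (f : MvPolynomial (Fin n) A) : DD n A k f = 0 := by
  simp [DD, not_lt.2 h]

theorem sg_rt_of_far {k j : ℕ} (h : k + 1 < j ∨ j + 1 < k) : sg n A k (rt n A j) = rt n A j := by
  rcases lt_or_ge k n with hk | hk
  swap
  · exact sg_of_le hk _
  rcases lt_or_ge j n with hj | hj
  swap
  · simp [rt, not_lt.2 hj]
  cases j with
  | zero => rw [rt_zero hj, map_mul, map_ofNat, sg_xv_of_ne (by omega) (by omega)]
  | succ j => rw [rt_succ hj, map_sub, sg_xv_of_ne (by omega) (by omega),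
      sg_xv_of_ne (by omega) (by omega)]

theorem algHom_ext_xv {φ ψ : MvPolynomial (Fin n) A →ₐ[A] MvPolynomial (Fin n) A}
    (h : ∀ j < n, φ (xv n A j) = ψ (xv n A j)) : φ = ψ := by
  ext i : 1
  have := h i i.2
  rwa [xv_of_lt i.2] at this

theorem sg_comm {k j : ℕ} (h : k + 1 < j) (f : MvPolynomial (Fin n) A) :
    sg n A k (sg n A j f) = sg n A j (sg n A k f) := by
  rcases lt_or_ge j n with hj | hj
  swap
  · rw [sg_of_le hj, sg_of_le hj]
  obtain ⟨j, rfl⟩ : ∃ i, j = i + 1 := ⟨j - 1, by omega⟩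
  change ((sg n A k).comp (sg n A (j + 1))) f = ((sg n A (j + 1)).comp (sg n A k)) f
  congr 1
  refine algHom_ext_xv fun i hi => ?_
  simp only [AlgHom.comp_apply]
  by_cases h1 : i = j
  · subst h1
    rw [sg_succ_xv hj, sg_xv_of_ne (by omega) (by omega), sg_xv_of_ne (by omega) (by omega),
      sg_succ_xv hj]
  by_cases h2 : i = j + 1
  · subst h2
    rw [sg_succ_xv' hj, sg_xv_of_ne (by omega) (by omega), sg_xv_of_ne (by omega) (by omega),
      sg_succ_xv' hj]
  rw [sg_succ_xv_of_ne h1 h2]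
  cases k with
  | zero =>
    by_cases h3 : i = 0
    · subst h3
      rw [sg_zero_xv hi, map_neg, sg_succ_xv_of_ne h1 h2]
    · rw [sg_zero_xv_of_ne h3, sg_succ_xv_of_ne h1 h2]
  | succ k =>
    by_cases h3 : i = k
    · subst h3
      rw [sg_succ_xv (by omega), sg_succ_xv_of_ne (by omega) (by omega)]
    by_cases h4 : i = k + 1
    · subst h4
      rw [sg_succ_xv' (by omega), sg_succ_xv_of_ne (by omega) (by omega)]
    rw [sg_succ_xv_of_ne h3 h4, sg_succ_xv_of_ne h1 h2]

theorem sg_braid_three {k : ℕ} (h : k + 2 < n) (f : MvPolynomial (Fin n) A) :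
    sg n A (k + 1) (sg n A (k + 2) (sg n A (k + 1) f)) =
      sg n A (k + 2) (sg n A (k + 1) (sg n A (k + 2) f)) := by
  change ((sg n A (k + 1)).comp ((sg n A (k + 2)).comp (sg n A (k + 1)))) f =
    ((sg n A (k + 2)).comp ((sg n A (k + 1)).comp (sg n A (k + 2)))) f
  congr 1
  refine algHom_ext_xv fun i hi => ?_
  simp only [AlgHom.comp_apply]
  have e1 := sg_succ_xv (A := A) (n := n) (k := k) (by omega)
  have e2 := sg_succ_xv' (A := A) (n := n) (k := k) (by omega)
  have e3 := sg_succ_xv (A := A) (n := n) (k := k + 1) (by omega)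
  have e4 := sg_succ_xv' (A := A) (n := n) (k := k + 1) (by omega)
  have e5 := sg_succ_xv_of_ne (A := A) (n := n) (k := k) (j := k + 2) (by omega) (by omega)
  have e6 := sg_succ_xv_of_ne (A := A) (n := n) (k := k + 1) (j := k) (by omega) (by omega)
  simp only [show k + 1 + 1 = k + 2 from rfl] at *
  by_cases h1 : i = k
  · subst h1; rw [e1, e3, e6, e5, e1, e3]
  by_cases h2 : i = k + 1
  · subst h2; rw [e2, e6, e1, e3, e5, e4]
  by_cases h3 : i = k + 2
  · subst h3; rw [e5, e4, e2, e6]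
  rw [sg_succ_xv_of_ne h1 h2, sg_succ_xv_of_ne (k := k + 1) h2 h3, sg_succ_xv_of_ne h1 h2,
    sg_succ_xv_of_ne (k := k + 1) h2 h3]

theorem sg_braid_four (h : 1 < n) (f : MvPolynomial (Fin n) A) :
    sg n A 0 (sg n A 1 (sg n A 0 (sg n A 1 f))) = sg n A 1 (sg n A 0 (sg n A 1 (sg n A 0 f))) := by
  change ((sg n A 0).comp ((sg n A 1).comp ((sg n A 0).comp (sg n A 1)))) f =
    ((sg n A 1).comp ((sg n A 0).comp ((sg n A 1).comp (sg n A 0)))) f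
  congr 1
  refine algHom_ext_xv fun i hi => ?_
  simp only [AlgHom.comp_apply]
  have e1 := sg_succ_xv (A := A) (n := n) (k := 0) (by omega)
  have e2 := sg_succ_xv' (A := A) (n := n) (k := 0) (by omega)
  have e3 := sg_zero_xv (A := A) (n := n) (by omega)
  have e4 := sg_zero_xv_of_ne (A := A) (n := n) (j := 1) (by omega)
  simp only [zero_add] at *
  by_cases h1 : i = 0
  · subst h1; simp only [e1, e2, e3, e4, map_neg]
  by_cases h2 : i = 1
  · subst h2; simp only [e1, e2, e3, e4, map_neg]
  simp only [sg_zero_xv_of_ne h1, sg_succ_xv_of_ne (k := 0) h1 h2]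

variable [IsDomain A] [CharZero A]

theorem rt_ne_zero (k : ℕ) : rt n A k ≠ 0 := by
  unfold rt
  split_ifs
  · exact root'_ne_zero _
  · exact one_ne_zero

theorem DD_unique {k : ℕ} {f g : MvPolynomial (Fin n) A}
    (h : rt n A k * g = f - sg n A k f) : DD n A k f = g :=
  mul_left_cancel₀ (rt_ne_zero k) (by rw [rt_mul_DD, h])

theorem DD_add (k : ℕ) (f g : MvPolynomial (Fin n) A) :
    DD n A k (f + g) = DD n A k f + DD n A k g :=
  DD_unique (by rw [mul_add, rt_mul_DD, rt_mul_DD, map_add]; ring)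

theorem DD_mul (k : ℕ) (f g : MvPolynomial (Fin n) A) :
    DD n A k (f * g) = DD n A k f * g + sg n A k f * DD n A k g :=
  DD_unique (by
    rw [map_mul]; linear_combination g * rt_mul_DD k f + sg n A k f * rt_mul_DD k g)

theorem DD_eq_zero_iff (k : ℕ) (f : MvPolynomial (Fin n) A) :
    DD n A k f = 0 ↔ sg n A k f = f := by
  constructor
  · intro h
    have := rt_mul_DD k f
    rw [h, mul_zero] at this
    exact (sub_eq_zero.1 this.symm).symm
  · intro h
    exact DD_unique (by rw [h]; ring)

theorem DD_of_inv {k : ℕ} {f : MvPolynomial (Fin n) A} (h : sg n A k f = f) : DD n A k f = 0 :=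
  (DD_eq_zero_iff k f).2 h

theorem DD_zero (k : ℕ) : DD n A k 0 = 0 := DD_of_inv (map_zero _)

theorem DD_mul_of_inv {k : ℕ} {f : MvPolynomial (Fin n) A} (h : sg n A k f = f)
    (g : MvPolynomial (Fin n) A) : DD n A k (f * g) = f * DD n A k g := by
  rw [DD_mul, DD_of_inv h, h]; ring

theorem DD_mul_of_inv' {k : ℕ} {g : MvPolynomial (Fin n) A} (h : sg n A k g = g)
    (f : MvPolynomial (Fin n) A) : DD n A k (f * g) = DD n A k f * g := by
  rw [DD_mul, DD_of_inv h]; ring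

variable (n A) in
/-- `∂'_k` as a linear map. -/
def DDl (k : ℕ) : MvPolynomial (Fin n) A →ₗ[A] MvPolynomial (Fin n) A where
  toFun := DD n A k
  map_add' := DD_add k
  map_smul' a f := by
    rw [smul_eq_C_mul, DD_mul_of_inv (by rw [← algebraMap_eq, AlgHom.commutes]),
      ← smul_eq_C_mul]; rfl

theorem DD_sum {ι : Type*} (k : ℕ) (t : Finset ι) (f : ι → MvPolynomial (Fin n) A) :
    DD n A k (∑ i ∈ t, f i) = ∑ i ∈ t, DD n A k (f i) := map_sum (DDl n A k) f t

theorem DD_neg (k : ℕ) (f : MvPolynomial (Fin n) A) : DD n A k (-f) = -DD n A k f :=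
  map_neg (DDl n A k) f

theorem DD_sub (k : ℕ) (f g : MvPolynomial (Fin n) A) :
    DD n A k (f - g) = DD n A k f - DD n A k g := map_sub (DDl n A k) f g

theorem sg_DD (k : ℕ) (f : MvPolynomial (Fin n) A) : sg n A k (DD n A k f) = DD n A k f := by
  rcases lt_or_ge k n with h | h
  swap
  · exact sg_of_le h _
  apply mul_left_cancel₀ (rt_ne_zero k)
  have h1 := rt_mul_DD k f
  have h2 := congrArg (sg n A k) h1
  rw [map_mul, map_sub, sg_rt k h, sg_sg] at h2
  linear_combination -h2 - h1

theorem DD_DD (k : ℕ) (f : MvPolynomial (Fin n) A) : DD n A k (DD n A k f) = 0 :=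
  DD_of_inv (sg_DD k f)

theorem DD_sg (k : ℕ) (f : MvPolynomial (Fin n) A) : DD n A k (sg n A k f) = -DD n A k f :=
  DD_unique (by rw [sg_sg]; linear_combination -rt_mul_DD k f)

theorem sg_eq (k : ℕ) (f : MvPolynomial (Fin n) A) :
    sg n A k f = f - rt n A k * DD n A k f := by rw [rt_mul_DD]; ring

theorem DD_xv {k : ℕ} (h : k < n) : DD n A k (xv n A k) = 1 := by
  apply DD_unique
  cases k with
  | zero => rw [sg_zero_xv h, rt_zero h]; ring
  | succ k => rw [sg_succ_xv' h, rt_succ h]; ring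

theorem DD_succ_xv {k : ℕ} (h : k + 1 < n) : DD n A (k + 1) (xv n A k) = -1 := by
  apply DD_unique
  rw [sg_succ_xv h, rt_succ h]; ring

theorem DD_comm {k j : ℕ} (h : k + 1 < j) (f : MvPolynomial (Fin n) A) :
    DD n A k (DD n A j f) = DD n A j (DD n A k f) :=
  divided_comm (σ := (sg n A k).toRingHom) (τ := (sg n A j).toRingHom)
    (rt_mul_DD k) (rt_mul_DD j) (sg_comm h) (sg_rt_of_far (Or.inl h)) (sg_rt_of_far (Or.inr h))
    (rt_ne_zero k) (rt_ne_zero j) f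

theorem xv_ne {j k : ℕ} (hj : j < n) (hk : k < n) (h : j ≠ k) : xv n A j ≠ xv n A k := by
  rw [xv_of_lt hj, xv_of_lt hk]
  intro h'
  exact h (by simpa using X_injective h')

theorem xv_ne_zero {j : ℕ} (hj : j < n) : xv n A j ≠ 0 := by
  rw [xv_of_lt hj]; exact X_ne_zero _

theorem xv_add_ne_zero {j k : ℕ} (hj : j < n) (hk : k < n) (h : j ≠ k) :
    xv n A j + xv n A k ≠ 0 := by
  rw [xv_of_lt hj, xv_of_lt hk]
  intro h'
  have := congrArg (MvPolynomial.eval (fun i : Fin n => if i.val = j then (1 : A) else 0)) h'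
  simp [h.symm] at this

theorem DD_braid_three (k : ℕ) (f : MvPolynomial (Fin n) A) :
    DD n A (k + 1) (DD n A (k + 2) (DD n A (k + 1) f)) =
      DD n A (k + 2) (DD n A (k + 1) (DD n A (k + 2) f)) := by
  rcases lt_or_ge (k + 2) n with h | h
  swap
  · rw [DD_of_le h, DD_of_le h, DD_zero]
  have r1 : rt n A (k + 1) = xv n A (k + 1) - xv n A k := rt_succ (by omega)
  have r2 : rt n A (k + 2) = xv n A (k + 2) - xv n A (k + 1) := rt_succ (by omega)
  have e1 := sg_succ_xv (A := A) (n := n) (k := k) (by omega)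
  have e2 := sg_succ_xv' (A := A) (n := n) (k := k) (by omega)
  have e3 := sg_succ_xv (A := A) (n := n) (k := k + 1) (by omega)
  have e4 := sg_succ_xv' (A := A) (n := n) (k := k + 1) (by omega)
  have e5 := sg_succ_xv_of_ne (A := A) (n := n) (k := k) (j := k + 2) (by omega) (by omega)
  have e6 := sg_succ_xv_of_ne (A := A) (n := n) (k := k + 1) (j := k) (by omega) (by omega)
  refine divided_braid_three (σ := (sg n A (k + 1)).toRingHom) (τ := (sg n A (k + 2)).toRingHom)
    (rt_mul_DD _) (rt_mul_DD _) (sg_sg _) (sg_sg _) (sg_braid_three h) (sg_rt _ (by omega))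
    (sg_rt _ h) ?_ ?_ (rt_ne_zero _) (rt_ne_zero _) ?_ f
  · change sg n A (k + 1) _ = _
    rw [r1, r2, map_sub, e5, e2]; ring
  · change sg n A (k + 2) _ = _
    rw [r1, r2, map_sub, e6, e3]; ring
  · rw [r1, r2]; ring_nf
    rw [sub_ne_zero]; exact xv_ne (by omega) (by omega) (by omega)

theorem DD_braid_four (f : MvPolynomial (Fin n) A) :
    DD n A 0 (DD n A 1 (DD n A 0 (DD n A 1 f))) =
      DD n A 1 (DD n A 0 (DD n A 1 (DD n A 0 f))) := by
  rcases lt_or_ge 1 n with h | h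
  swap
  · simp only [DD_of_le h, DD_zero]
  have r1 : rt n A 0 = 2 * xv n A 0 := rt_zero (by omega)
  have r2 : rt n A 1 = xv n A 1 - xv n A 0 := rt_succ (by omega)
  have e1 := sg_succ_xv (A := A) (n := n) (k := 0) (by omega)
  have e3 := sg_zero_xv (A := A) (n := n) (by omega)
  have e4 := sg_zero_xv_of_ne (A := A) (n := n) (j := 1) (by omega)
  simp only [zero_add] at e1
  refine divided_braid_four (σ := (sg n A 0).toRingHom) (τ := (sg n A 1).toRingHom)
    (rt_mul_DD _) (rt_mul_DD _) (sg_sg _) (sg_sg _) (sg_braid_four h) (sg_rt _ (by omega))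
    (sg_rt _ h) ?_ ?_ (rt_ne_zero _) (rt_ne_zero _) ?_ ?_ f
  · change sg n A 0 _ = _
    rw [r1, r2, map_sub, e4, e3]; ring
  · change sg n A 1 _ = _
    rw [r1, r2, map_mul, map_ofNat, e1]; ring
  · rw [r1, r2]; ring_nf
    exact xv_add_ne_zero (by omega) (by omega) (by omega)
  · rw [r1, r2]; ring_nf
    exact mul_ne_zero (xv_ne_zero (by omega)) two_ne_zero

end Nat

end SympSchubert

end

noncomputable section

namespace SympSchubert

open MvPolynomial

/-! ### One-line notation and length -/

section Group

variable {n : ℕ}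

/-- The one-line notation of a barred permutation, with bars as signs; zero out of range. -/
def oneLine (w : W n) (k : ℕ) : ℤ :=
  if h : k < n then (w.left (w.right ⟨k, h⟩) : ℤ) * ((w.right ⟨k, h⟩ : ℕ) + 1) else 0

theorem oneLine_fin (w : W n) (i : Fin n) :
    oneLine w i = (w.left (w.right i) : ℤ) * ((w.right i : ℕ) + 1) := by simp [oneLine]

theorem natAbs_oneLine (w : W n) (i : Fin n) : (oneLine w i).natAbs = w.right i + 1 := by
  rw [oneLine_fin, Int.natAbs_mul, Int.units_natAbs, one_mul]; omega

theorem oneLine_ne_zero (w : W n) {k : ℕ} (h : k < n) : oneLine w k ≠ 0 := by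
  have := natAbs_oneLine w ⟨k, h⟩
  intro h'
  simp only [h'] at this
  simp at this

theorem oneLine_natAbs_inj (w : W n) {k j : ℕ} (hk : k < n) (hj : j < n)
    (h : (oneLine w k).natAbs = (oneLine w j).natAbs) : k = j := by
  have h1 := natAbs_oneLine w ⟨k, hk⟩
  have h2 := natAbs_oneLine w ⟨j, hj⟩
  simp only at h1 h2
  have h3 : w.right ⟨k, hk⟩ = w.right ⟨j, hj⟩ := by ext; omega
  simpa using w.right.injective h3

theorem oneLine_mul_zero (w : W n) (h : 0 < n) (j : ℕ) :
    oneLine (w * s ⟨0, h⟩) j = if j = 0 then -oneLine w 0 else oneLine w j := by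
  unfold oneLine
  have hr : (w * s ⟨0, h⟩).right = w.right := by simp [s]
  have hl : ∀ j : Fin n, (w * s ⟨0, h⟩).left (w.right j) =
      w.left (w.right j) * (if j = ⟨0, h⟩ then -1 else 1) := by
    intro j
    rw [left_mul_apply, show (w.right)⁻¹ (w.right j) = j from w.right.symm_apply_apply _]
    simp [s, Pi.mulSingle_apply]
  rw [hr]
  split_ifs with h1 h2
  · subst h2; rw [hl]; simp
  · rw [hl]; simp [Fin.ext_iff, h2]
  · omega
  · rfl

theorem oneLine_mul_succ (w : W n) {k : ℕ} (h : k + 1 < n) (j : ℕ) :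
    oneLine (w * s ⟨k + 1, h⟩) j =
      if j = k then oneLine w (k + 1) else if j = k + 1 then oneLine w k else oneLine w j := by
  have hk : k < n := by omega
  have hp : pre (⟨k + 1, h⟩ : Fin n) = ⟨k, hk⟩ := by simp [pre]
  have hs : (s ⟨k + 1, h⟩ : W n) =
      SemidirectProduct.inr (Equiv.swap ⟨k, hk⟩ ⟨k + 1, h⟩) := by simp [s, hp]
  have hr : (w * s ⟨k + 1, h⟩).right = w.right * Equiv.swap ⟨k, hk⟩ ⟨k + 1, h⟩ := by simp [hs]
  have hl : (w * s ⟨k + 1, h⟩).left = w.left := by simp [hs]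
  unfold oneLine
  rw [hr, hl]
  simp only [Equiv.Perm.mul_apply, h, hk, dif_pos]
  split_ifs with h1 h2 h3 h4
  · subst h2; rw [Equiv.swap_apply_left]
  · subst h3; rw [Equiv.swap_apply_right]
  · rw [Equiv.swap_apply_of_ne_of_ne] <;> simp [Fin.ext_iff, h2, h3]
  · omega
  · omega
  · rfl

/-- The position `k` is a right descent. -/
def Desc (w : W n) (k : ℕ) : Prop :=
  if k = 0 then oneLine w 0 < 0 else oneLine w k < oneLine w (k - 1)

theorem desc_zero {w : W n} : Desc w 0 ↔ oneLine w 0 < 0 := by simp [Desc]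

theorem desc_succ {w : W n} {k : ℕ} : Desc w (k + 1) ↔ oneLine w (k + 1) < oneLine w k := by
  simp [Desc]

/-- The contribution of a pair of entries to the length. -/
def pairInv (x y : ℤ) : ℕ := (if y < x then 1 else 0) + (if x + y < 0 then 1 else 0)

/-- The pairs of positions. -/
def posPairs (n : ℕ) : Finset (ℕ × ℕ) := {p ∈ Finset.range n ×ˢ Finset.range n | p.1 < p.2}

theorem mem_posPairs {p : ℕ × ℕ} : p ∈ posPairs n ↔ p.1 < p.2 ∧ p.2 < n := by
  simp [posPairs]; omega

/-- The number of inversions of a word of integers. -/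
def invCount (n : ℕ) (u : ℕ → ℤ) : ℕ :=
  ∑ a ∈ Finset.range n, (if u a < 0 then 1 else 0) + ∑ p ∈ posPairs n, pairInv (u p.1) (u p.2)

/-- The length of a barred permutation. -/
def len (w : W n) : ℕ := invCount n (oneLine w)

/-- For a pair containing the first position, the conditions `y < x` and `x + y < 0` of `pairInv`
exchange roles when x changes sign. Only the count of negative entries changes. -/
theorem invCount_neg_zero (h : 0 < n) (u : ℕ → ℤ) (h0 : 0 < u 0) :
    invCount n (fun j => if j = 0 then -u 0 else u j) = invCount n u + 1 := by
  unfold invCount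
  obtain ⟨m, rfl⟩ : ∃ m, n = m + 1 := ⟨n - 1, by omega⟩
  rw [Finset.sum_range_succ', Finset.sum_range_succ']
  have : ∑ p ∈ posPairs (m + 1), pairInv (if p.1 = 0 then -u 0 else u p.1)
      (if p.2 = 0 then -u 0 else u p.2) = ∑ p ∈ posPairs (m + 1), pairInv (u p.1) (u p.2) := by
    refine Finset.sum_congr rfl fun p hp => ?_
    rw [mem_posPairs] at hp
    rw [if_neg (show p.2 ≠ 0 by omega)]
    split_ifs with h1
    · rw [h1, pairInv, pairInv, add_comm]
      congr 2 <;> rw [eq_iff_iff] <;> constructor <;> intro <;> linarith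
    · rfl
  rw [this]
  simp only [Nat.add_eq_zero_iff, one_ne_zero, and_false, if_false, if_true]
  rw [if_pos (by linarith), if_neg (by linarith)]
  ring

/-- The adjacent transposition permutes the pairs of positions other than (k, k + 1), so only that
pair changes its contribution; the condition on the sum is symmetric and stays. -/
theorem invCount_swap {k : ℕ} (h : k + 1 < n) (u : ℕ → ℤ) (h0 : u k < u (k + 1)) :
    invCount n (fun j => if j = k then u (k + 1) else if j = k + 1 then u k else u j) =
      invCount n u + 1 := by
  set τ : Equiv.Perm ℕ := Equiv.swap k (k + 1) with hτ
  have hv : (fun j => if j = k then u (k + 1) else if j = k + 1 then u k else u j) = u ∘ τ := by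
    funext j
    simp only [Function.comp, hτ, Equiv.swap_apply_def]
    split_ifs <;> rfl
  rw [hv]
  have hτn : ∀ j, τ j < n ↔ j < n := by
    intro j
    rw [hτ, Equiv.swap_apply_def]
    split_ifs <;> omega
  have e1 : ∑ a ∈ Finset.range n, (if (u ∘ τ) a < 0 then 1 else 0) =
      ∑ a ∈ Finset.range n, (if u a < 0 then 1 else 0) := by
    refine Finset.sum_equiv τ (fun i => ?_) (fun i _ => rfl)
    simp [hτn]
  have hmem : (k, k + 1) ∈ posPairs n := mem_posPairs.2 ⟨by simp, h⟩
  unfold invCount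
  rw [e1, ← Finset.add_sum_erase _ _ hmem, ← Finset.add_sum_erase _ _ hmem]
  have e2 : ∑ p ∈ (posPairs n).erase (k, k + 1), pairInv ((u ∘ τ) p.1) ((u ∘ τ) p.2) =
      ∑ p ∈ (posPairs n).erase (k, k + 1), pairInv (u p.1) (u p.2) := by
    refine Finset.sum_equiv (Equiv.prodCongr τ τ) (fun p => ?_) (fun p _ => rfl)
    obtain ⟨a, b⟩ := p
    simp only [Finset.mem_erase, mem_posPairs, Equiv.prodCongr_apply, Prod.map, hτn, ne_eq,
      Prod.mk.injEq]
    rw [hτ, Equiv.swap_apply_def, Equiv.swap_apply_def]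
    split_ifs <;> omega
  rw [e2]
  have e3 : pairInv ((u ∘ τ) k) ((u ∘ τ) (k + 1)) = pairInv (u k) (u (k + 1)) + 1 := by
    simp only [Function.comp, hτ, Equiv.swap_apply_left, Equiv.swap_apply_right, pairInv,
      if_pos h0, if_neg (not_lt.2 h0.le), add_comm (u (k + 1))]
    ring
  rw [e3]; ring

theorem len_mul_s_of_not_desc {w : W n} {i : Fin n} (h : ¬Desc w i) :
    len (w * s i) = len w + 1 := by
  obtain ⟨k, hk⟩ := i
  cases k with
  | zero =>
    have h0 := oneLine_ne_zero w hk
    simp only [desc_zero, not_lt] at h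
    have := invCount_neg_zero hk (oneLine w) (lt_of_le_of_ne h h0.symm)
    unfold len
    rw [← this]
    congr 1
    funext j
    exact oneLine_mul_zero w hk j
  | succ k =>
    simp only [desc_succ, not_lt] at h
    have h0 : oneLine w k ≠ oneLine w (k + 1) := fun h' => by
      have := oneLine_natAbs_inj w (by omega) hk (congrArg Int.natAbs h')
      omega
    have := invCount_swap hk (oneLine w) (lt_of_le_of_ne h h0)
    unfold len
    rw [← this]
    congr 1
    funext j
    exact oneLine_mul_succ w hk j

theorem desc_mul_s {w : W n} {i : Fin n} : Desc (w * s i) i ↔ ¬Desc w i := by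
  obtain ⟨k, hk⟩ := i
  cases k with
  | zero =>
    have h0 := oneLine_ne_zero w hk
    simp only [desc_zero]
    rw [oneLine_mul_zero w hk, if_pos rfl]
    omega
  | succ k =>
    have h0 : oneLine w k ≠ oneLine w (k + 1) := fun h' => by
      have := oneLine_natAbs_inj w (by omega) hk (congrArg Int.natAbs h')
      omega
    simp only [desc_succ]
    rw [oneLine_mul_succ w hk, oneLine_mul_succ w hk, if_pos rfl, if_neg (by omega), if_pos rfl]
    omega

theorem mul_s_mul_s (w : W n) (i : Fin n) : w * s i * s i = w := by
  rw [mul_assoc, s_mul_s, mul_one]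

theorem len_mul_s_of_desc {w : W n} {i : Fin n} (h : Desc w i) : len (w * s i) + 1 = len w := by
  have h1 : ¬Desc (w * s i) i := fun h' => desc_mul_s.1 h' h
  have := len_mul_s_of_not_desc h1
  rw [mul_s_mul_s] at this
  exact this.symm

theorem len_one : len (1 : W n) = 0 := by
  have h : ∀ k < n, oneLine (1 : W n) k = k + 1 := by
    intro k hk
    simp [oneLine, hk]
  unfold len invCount
  rw [Finset.sum_eq_zero (s := posPairs n), Finset.sum_eq_zero, add_zero]
  · intro k hk
    rw [h k (by simpa using hk), if_neg (by omega)]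
  · intro p hp
    rw [mem_posPairs] at hp
    rw [h _ (by omega), h _ hp.2, pairInv, if_neg (by omega), if_neg (by omega), add_zero]

/-- Without descents the one-line word is positive and increasing, and `Fin n` has no order
automorphism but the identity. -/
theorem eq_one_of_no_desc {w : W n} (h : ∀ i : Fin n, ¬Desc w i) : w = 1 := by
  have hpos : ∀ k, k < n → 0 < oneLine w k ∧ ∀ j < k, oneLine w j < oneLine w k := by
    intro k
    induction k with
    | zero =>
      intro hk
      have := h ⟨0, hk⟩
      simp only [desc_zero] at this
      have h0 := oneLine_ne_zero w hk
      exact ⟨by omega, by simp⟩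
    | succ k ih =>
      intro hk
      obtain ⟨h1, h2⟩ := ih (by omega)
      have := h ⟨k + 1, hk⟩
      simp only [desc_succ] at this
      have h0 : oneLine w k ≠ oneLine w (k + 1) := fun h' => by
        have := oneLine_natAbs_inj w (by omega) hk (congrArg Int.natAbs h')
        omega
      refine ⟨by omega, fun j hj => ?_⟩
      rcases Nat.lt_succ_iff_lt_or_eq.1 hj with hj | rfl
      · have := h2 j hj; omega
      · omega
  have hl : w.left = 1 := by
    funext i
    have h1 := (hpos (w.right⁻¹ i) (Fin.is_lt _)).1
    rw [oneLine_fin, show w.right (w.right⁻¹ i) = i from w.right.apply_symm_apply i] at h1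
    rcases Int.units_eq_one_or (w.left i) with h2 | h2
    · simpa using h2
    · rw [h2] at h1; push_cast at h1; omega
  have hr : w.right = 1 := by
    have hm : StrictMono w.right := by
      intro i j hij
      have h1 := (hpos j j.2).2 i hij
      rw [oneLine_fin, oneLine_fin, hl] at h1
      simp at h1
      exact h1
    have : StrictMono.orderIsoOfSurjective w.right hm w.right.surjective = OrderIso.refl _ :=
      Subsingleton.elim _ _
    ext i : 1
    exact congrArg (fun e : Fin n ≃o Fin n => e i) this
  exact SemidirectProduct.ext hl hr

/-- The product of the generators with the given indices. -/
def wprod (l : List (Fin n)) : W n := (l.map s).prod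

theorem wprod_nil : wprod ([] : List (Fin n)) = 1 := rfl

theorem wprod_append (l m : List (Fin n)) : wprod (l ++ m) = wprod l * wprod m := by
  simp [wprod]

theorem wprod_singleton (i : Fin n) : wprod [i] = s i := by simp [wprod]

theorem wprod_concat (l : List (Fin n)) (i : Fin n) : wprod (l ++ [i]) = wprod l * s i := by
  rw [wprod_append, wprod_singleton]

theorem len_mul_s_le (w : W n) (i : Fin n) : len (w * s i) ≤ len w + 1 := by
  by_cases h : Desc w i
  · have := len_mul_s_of_desc h; omega
  · exact (len_mul_s_of_not_desc h).le

theorem len_wprod_le (l : List (Fin n)) : len (wprod l) ≤ l.length := by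
  induction l using List.reverseRecOn with
  | nil => simp [wprod_nil, len_one]
  | append_singleton l i ih =>
    rw [wprod_concat, List.length_append, List.length_singleton]
    exact (len_mul_s_le _ _).trans (by omega)

theorem exists_word (k : ℕ) (w : W n) (h : len w = k) :
    ∃ l : List (Fin n), wprod l = w ∧ l.length = k := by
  induction k generalizing w with
  | zero =>
    refine ⟨[], ?_, rfl⟩
    rw [wprod_nil]
    refine (eq_one_of_no_desc fun i hi => ?_).symm
    have := len_mul_s_of_desc hi
    omega
  | succ k ih =>
    have : ∃ i : Fin n, Desc w i := by
      by_contra! h'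
      rw [eq_one_of_no_desc h', len_one] at h
      omega
    obtain ⟨i, hi⟩ := this
    have := len_mul_s_of_desc hi
    obtain ⟨l, hl, hk⟩ := ih (w * s i) (by omega)
    exact ⟨l ++ [i], by rw [wprod_concat, hl, mul_s_mul_s], by simp [hk]⟩

/-- Stripping descents produces a word of length `len w`, and no shorter word exists because a
generator raises `len` by at most one. Minimality of a word thus becomes an inversion count. -/
theorem isReducedWord_iff {l : List (Fin n)} {w : W n} :
    IsReducedWord l w ↔ wprod l = w ∧ l.length = len w := by
  constructor
  · rintro ⟨h1, h2⟩
    refine ⟨h1, le_antisymm ?_ ?_⟩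
    · obtain ⟨m, hm, hk⟩ := exists_word _ w rfl
      rw [← hk]; exact h2 m hm
    · rw [← show wprod l = w from h1]; exact len_wprod_le l
  · rintro ⟨h1, h2⟩
    refine ⟨h1, fun m hm => ?_⟩
    rw [h2, ← show wprod m = w from hm]; exact len_wprod_le m

theorem wprod_reducedWord (w : W n) : wprod (reducedWord w) = w :=
  (isReducedWord_iff.1 (Classical.choose_spec (exists_isReducedWord w))).1

theorem length_reducedWord (w : W n) : (reducedWord w).length = len w :=
  (isReducedWord_iff.1 (Classical.choose_spec (exists_isReducedWord w))).2

/-- The action on polynomials is faithful, so the relations between generators can be read off from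
the substitutions already computed. -/
theorem act_injective {u v : W n}
    (h : ∀ f : MvPolynomial (Fin n) ℤ, act u f = act v f) : u = v := by
  have key : ∀ i, u.right i = v.right i ∧ u.left (u.right i) = v.left (v.right i) := by
    intro i
    have h1 := h (X i)
    rw [act_X, act_X] at h1
    have h2 := congrArg (coeff (Finsupp.single (u.right i) 1)) h1
    simp only [← map_intCast (C : ℤ →+* MvPolynomial (Fin n) ℤ), coeff_C_mul,
      coeff_X, Finsupp.single_left_inj (one_ne_zero (α := ℕ)), if_true, mul_one] at h2
    by_cases h3 : v.right i = u.right i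
    · rw [if_pos h3] at h2
      refine ⟨h3.symm, ?_⟩
      exact Units.ext (by simpa using h2)
    · rw [if_neg h3] at h2
      simp at h2
  have hr : u.right = v.right := Equiv.ext fun i => (key i).1
  refine SemidirectProduct.ext ?_ hr
  funext i
  have := (key (u.right⁻¹ i)).2
  rw [← hr, show u.right (u.right⁻¹ i) = i from u.right.apply_symm_apply i] at this
  exact this

theorem s_comm {i j : Fin n} (h : i.val + 1 < j.val) : s i * s j = s j * s i := by
  apply act_injective
  intro f
  have := sg_comm (A := ℤ) h f
  rw [sg_fin, sg_fin] at this
  rw [act_mul, act_mul, this]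

theorem s_braid_three {k : ℕ} (h : k + 2 < n) :
    (s ⟨k + 1, by omega⟩ * s ⟨k + 2, h⟩ * s ⟨k + 1, by omega⟩ : W n) =
      s ⟨k + 2, h⟩ * s ⟨k + 1, by omega⟩ * s ⟨k + 2, h⟩ := by
  apply act_injective
  intro f
  have := sg_braid_three (A := ℤ) h f
  have e1 := sg_fin (A := ℤ) (⟨k + 1, by omega⟩ : Fin n)
  have e2 := sg_fin (A := ℤ) (⟨k + 2, by omega⟩ : Fin n)
  simp only at e1 e2
  rw [e1, e2] at this
  simp only [act_mul]
  exact this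

theorem s_braid_four (h : 1 < n) :
    (s ⟨0, by omega⟩ * s ⟨1, h⟩ * s ⟨0, by omega⟩ * s ⟨1, h⟩ : W n) =
      s ⟨1, h⟩ * s ⟨0, by omega⟩ * s ⟨1, h⟩ * s ⟨0, by omega⟩ := by
  apply act_injective
  intro f
  have := sg_braid_four (A := ℤ) h f
  have e1 := sg_fin (A := ℤ) (⟨0, by omega⟩ : Fin n)
  have e2 := sg_fin (A := ℤ) (⟨1, by omega⟩ : Fin n)
  simp only at e1 e2
  rw [e1, e2] at this
  simp only [act_mul]
  exact this

end Group

/-! ### Independence of the reduced word -/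

section Matsumoto

variable {n : ℕ} {A : Type*} [CommRing A] [IsDomain A] [CharZero A]

/-- The composite `∂'_{a_1} ∘ ⋯ ∘ ∂'_{a_r}`. -/
def ddL (l : List (Fin n)) (f : MvPolynomial (Fin n) A) : MvPolynomial (Fin n) A := l.foldr dd' f

omit [IsDomain A] [CharZero A] in
theorem ddL_append (l m : List (Fin n)) (f : MvPolynomial (Fin n) A) :
    ddL (l ++ m) f = ddL l (ddL m f) := by simp [ddL]

omit [IsDomain A] [CharZero A] in
theorem ddL_cons (i : Fin n) (m : List (Fin n)) (f : MvPolynomial (Fin n) A) :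
    ddL (i :: m) f = dd' i (ddL m f) := rfl

omit [IsDomain A] [CharZero A] in
theorem ddL_nil (f : MvPolynomial (Fin n) A) : ddL [] f = f := rfl

variable (A) in
-- If i and j are both descents, w factors, with lengths adding, as some u times the longest element
-- of the dihedral group generated by s_i and s_j. The two words are a reduced word of u followed by
-- the two alternating words of that longest element without their last letters; the operators agree
-- by the braid relation.
theorem exists_dihedral {w : W n} {i j : Fin n} (hij : i < j) (hi : Desc w i) (hj : Desc w j) :
    ∃ l m : List (Fin n), wprod l = w * s i ∧ wprod m = w * s j ∧ l.length + 1 = len w ∧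
      m.length + 1 = len w ∧
      ∀ f : MvPolynomial (Fin n) A, ddL l (dd' i f) = ddL m (dd' j f) := by
  have hi' := len_mul_s_of_desc hi
  obtain ⟨a, ha⟩ := i
  obtain ⟨b, hb⟩ := j
  rw [Fin.mk_lt_mk] at hij
  rcases Nat.lt_or_eq_of_le (Nat.succ_le_of_lt hij) with h | h
  · -- commuting generators
    have hd : Desc (w * s ⟨a, ha⟩) b := by
      obtain ⟨b, rfl⟩ : ∃ c, b = c + 1 := ⟨b - 1, by omega⟩
      rw [desc_succ] at hj ⊢
      cases a with
      | zero =>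
        rw [oneLine_mul_zero w ha, oneLine_mul_zero w ha, if_neg (by omega), if_neg (by omega)]
        exact hj
      | succ a =>
        rw [oneLine_mul_succ w ha, oneLine_mul_succ w ha, if_neg (by omega), if_neg (by omega),
          if_neg (by omega), if_neg (by omega)]
        exact hj
    have h2 := len_mul_s_of_desc (i := ⟨b, hb⟩) hd
    obtain ⟨r, hr, hk⟩ := exists_word _ (w * s ⟨a, ha⟩ * s ⟨b, hb⟩) rfl
    refine ⟨r ++ [⟨b, hb⟩], r ++ [⟨a, ha⟩], ?_, ?_, ?_, ?_, fun f => ?_⟩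
    · rw [wprod_concat, hr, mul_s_mul_s]
    · rw [wprod_concat, hr, mul_assoc w, s_comm (by exact h), ← mul_assoc, mul_s_mul_s]
    · simp; omega
    · simp; omega
    · rw [ddL_append, ddL_append]
      have := DD_comm (A := A) (n := n) (k := a) (j := b) h f
      simp only [DD, ha, hb, dif_pos] at this
      simp only [ddL_cons, ddL_nil, this]
  subst h
  cases a with
  | zero =>
    rw [desc_zero] at hi
    simp only [Nat.succ_eq_add_one, zero_add] at hb hj ⊢
    rw [show (1 : ℕ) = 0 + 1 from rfl, desc_succ] at hj
    simp only [zero_add] at hj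
    have o0 : ∀ (v : W n) j, oneLine (v * s ⟨0, ha⟩) j = if j = 0 then -oneLine v 0
      else oneLine v j := fun v => oneLine_mul_zero v ha
    have o1 : ∀ (v : W n) j, oneLine (v * s ⟨1, hb⟩) j = if j = 0 then oneLine v 1
      else if j = 1 then oneLine v 0 else oneLine v j := fun v => oneLine_mul_succ v hb
    have d1 : Desc (w * s ⟨0, ha⟩) 1 := by
      refine (desc_succ (k := 0)).2 ?_
      rw [zero_add, o0, o0, if_pos rfl, if_neg (by omega)]; omega
    have d2 : Desc (w * s ⟨0, ha⟩ * s ⟨1, hb⟩) 0 := by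
      rw [desc_zero]; simp [o0, o1]; omega
    have d3 : Desc (w * s ⟨0, ha⟩ * s ⟨1, hb⟩ * s ⟨0, ha⟩) 1 := by
      refine (desc_succ (k := 0)).2 ?_
      rw [zero_add]; simp [o0, o1]; omega
    have e1 := len_mul_s_of_desc (i := ⟨1, hb⟩) d1
    have e2 := len_mul_s_of_desc (i := ⟨0, ha⟩) d2
    have e3 := len_mul_s_of_desc (i := ⟨1, hb⟩) d3
    obtain ⟨r, hr, hk⟩ :=
      exists_word _ (w * s ⟨0, ha⟩ * s ⟨1, hb⟩ * s ⟨0, ha⟩ * s ⟨1, hb⟩) rfl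
    refine ⟨r ++ [⟨1, hb⟩] ++ [⟨0, ha⟩] ++ [⟨1, hb⟩], r ++ [⟨0, ha⟩] ++ [⟨1, hb⟩] ++ [⟨0, ha⟩],
      ?_, ?_, ?_, ?_, fun f => ?_⟩
    · simp only [wprod_concat, hr, mul_s_mul_s]
    · have hb4 : w * s ⟨0, ha⟩ * s ⟨1, hb⟩ * s ⟨0, ha⟩ * s ⟨1, hb⟩ =
          w * s ⟨1, hb⟩ * s ⟨0, ha⟩ * s ⟨1, hb⟩ * s ⟨0, ha⟩ := by
        have := s_braid_four hb
        simp only [mul_assoc] at this ⊢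
        rw [this]
      simp only [wprod_concat, hr, hb4, mul_s_mul_s]
    · simp; omega
    · simp; omega
    · simp only [ddL_append]
      have := DD_braid_four (A := A) (n := n) f
      simp only [DD, ha, hb, dif_pos] at this
      simp only [ddL_cons, ddL_nil, this]
  | succ a =>
    simp only [Nat.succ_eq_add_one, add_assoc, Nat.reduceAdd] at hb hj ⊢
    rw [desc_succ] at hi
    replace hj : oneLine w (a + 2) < oneLine w (a + 1) := (desc_succ (k := a + 1)).1 hj
    have o0 : ∀ (v : W n) j, oneLine (v * s ⟨a + 1, ha⟩) j = if j = a then oneLine v (a + 1)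
      else if j = a + 1 then oneLine v a else oneLine v j := fun v => oneLine_mul_succ v ha
    have o1 : ∀ (v : W n) j, oneLine (v * s ⟨a + 2, hb⟩) j = if j = a + 1 then oneLine v (a + 2)
      else if j = a + 2 then oneLine v (a + 1) else oneLine v j := fun v => oneLine_mul_succ v hb
    have d1 : Desc (w * s ⟨a + 1, ha⟩) (a + 2) := by
      refine (desc_succ (k := a + 1)).2 ?_
      rw [o0, o0, if_pos rfl, if_neg (by omega), if_neg (by omega), if_neg (by omega)]
      exact hj.trans hi
    have d2 : Desc (w * s ⟨a + 1, ha⟩ * s ⟨a + 2, hb⟩) (a + 1) := by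
      rw [desc_succ]; simp [o0, o1]; omega
    have e1 := len_mul_s_of_desc (i := ⟨a + 2, hb⟩) d1
    have e2 := len_mul_s_of_desc (i := ⟨a + 1, ha⟩) d2
    obtain ⟨r, hr, hk⟩ :=
      exists_word _ (w * s ⟨a + 1, ha⟩ * s ⟨a + 2, hb⟩ * s ⟨a + 1, ha⟩) rfl
    refine ⟨r ++ [⟨a + 1, ha⟩] ++ [⟨a + 2, hb⟩], r ++ [⟨a + 2, hb⟩] ++ [⟨a + 1, ha⟩],
      ?_, ?_, ?_, ?_, fun f => ?_⟩
    · simp only [wprod_concat, hr, mul_s_mul_s]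
    · have hb4 : w * s ⟨a + 1, ha⟩ * s ⟨a + 2, hb⟩ * s ⟨a + 1, ha⟩ =
          w * s ⟨a + 2, hb⟩ * s ⟨a + 1, ha⟩ * s ⟨a + 2, hb⟩ := by
        have := s_braid_three hb
        simp only [mul_assoc] at this ⊢
        rw [this]
      simp only [wprod_concat, hr, hb4, mul_s_mul_s]
    · simp; omega
    · simp; omega
    · simp only [ddL_append]
      have := DD_braid_three (A := A) (n := n) a f
      simp only [DD, ha, hb, dif_pos] at this
      simp only [ddL_cons, ddL_nil, this]

/-- Matsumoto's argument, by induction on length. If the last letters differ, both are descents, and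
the induction hypothesis replaces what precedes them by the words of `exists_dihedral`, for which
the composites coincide. -/
theorem ddL_eq_of_wprod_eq (k : ℕ) {l m : List (Fin n)} (hl : l.length = k) (hm : m.length = k)
    (h : wprod l = wprod m) (hlen : len (wprod l) = k) (f : MvPolynomial (Fin n) A) :
    ddL l f = ddL m f := by
  induction k generalizing l m f with
  | zero =>
    rw [List.length_eq_zero_iff] at hl hm
    rw [hl, hm]
  | succ k ih =>
    obtain ⟨l, i, rfl⟩ : ∃ l' i, l = l' ++ [i] :=
      ⟨_, _, (List.dropLast_append_getLast (by rintro rfl; simp at hl)).symm⟩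
    obtain ⟨m, j, rfl⟩ : ∃ l' i, m = l' ++ [i] :=
      ⟨_, _, (List.dropLast_append_getLast (by rintro rfl; simp at hm)).symm⟩
    simp only [List.length_append, List.length_singleton, Nat.add_right_cancel_iff] at hl hm
    set w := wprod (l ++ [i]) with hw
    have hli : wprod l = w * s i := by rw [hw, wprod_concat, mul_s_mul_s]
    have hmj : wprod m = w * s j := by rw [h, wprod_concat, mul_s_mul_s]
    have hdesc : ∀ (l : List (Fin n)) i, l.length = k → wprod l = w * s i → Desc w i := by
      intro l i hl hli
      by_contra hd
      have h1 := len_mul_s_of_not_desc hd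
      have h2 := len_wprod_le l
      rw [hli] at h2
      omega
    have hi := hdesc l i hl hli
    have hj := hdesc m j hm hmj
    have key : ∀ (i j : Fin n) (l m : List (Fin n)), i < j → l.length = k → m.length = k →
        wprod l = w * s i → wprod m = w * s j → Desc w i → Desc w j →
        ddL l (dd' i f) = ddL m (dd' j f) := by
      intro i j l m hij hl hm hli hmj hi hj
      obtain ⟨l', m', hl1, hm1, hl2, hm2, hf⟩ := exists_dihedral A hij hi hj
      have e1 := len_mul_s_of_desc hi
      have e2 := len_mul_s_of_desc hj
      rw [ih hl (m := l') (by omega) (hli.trans hl1.symm) (by rw [hli]; omega),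
        ih hm (m := m') (by omega) (hmj.trans hm1.symm) (by rw [hmj]; omega), hf]
    rw [ddL_append, ddL_append, ddL_cons, ddL_nil, ddL_cons, ddL_nil]
    have e1 := len_mul_s_of_desc hi
    rcases lt_trichotomy i j with hij | hij | hij
    · exact key i j l m hij hl hm hli hmj hi hj
    · subst hij
      exact ih hl hm (hli.trans hmj.symm) (by rw [hli]; omega) _
    · exact (key j i m l hij hm hl hmj hli hj hi).symm

theorem ddL_eq_ddW' {l : List (Fin n)} (h : l.length = len (wprod l))
    (f : MvPolynomial (Fin n) A) : ddL l f = ddW' (wprod l) f :=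
  ddL_eq_of_wprod_eq _ h (length_reducedWord _) (wprod_reducedWord _).symm rfl f

theorem ddW'_one (f : MvPolynomial (Fin n) A) : ddW' (1 : W n) f = f :=
  (ddL_eq_ddW' (l := []) (by simp [wprod_nil, len_one]) f).symm

theorem ddW'_dd'_of_not_desc {w : W n} {i : Fin n} (h : ¬Desc w i)
    (f : MvPolynomial (Fin n) A) : ddW' w (dd' i f) = ddW' (w * s i) f := by
  have h1 := len_mul_s_of_not_desc h
  have hw : wprod (reducedWord w ++ [i]) = w * s i := by rw [wprod_concat, wprod_reducedWord]
  have := ddL_eq_ddW' (A := A) (l := reducedWord w ++ [i])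
    (by rw [hw, h1, List.length_append, length_reducedWord]; rfl) f
  rw [hw, ddL_append] at this
  exact this

theorem dd'_dd' (i : Fin n) (f : MvPolynomial (Fin n) A) : dd' i (dd' i f) = 0 := by
  rw [← DD_fin, ← DD_fin, DD_DD]

theorem dd'_zero (i : Fin n) : dd' i (0 : MvPolynomial (Fin n) A) = 0 := by
  rw [← DD_fin, DD_zero]

theorem ddL_zero (l : List (Fin n)) : ddL l (0 : MvPolynomial (Fin n) A) = 0 := by
  induction l with
  | nil => rfl
  | cons i l ih => rw [ddL_cons, ih, dd'_zero]

theorem ddW'_dd'_of_desc {w : W n} {i : Fin n} (h : Desc w i)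
    (f : MvPolynomial (Fin n) A) : ddW' w (dd' i f) = 0 := by
  have h1 : ¬Desc (w * s i) i := fun h' => desc_mul_s.1 h' h
  have h2 := ddW'_dd'_of_not_desc h1 (dd' i f)
  rw [mul_s_mul_s, dd'_dd'] at h2
  rw [← h2]
  exact ddL_zero _

/-- The nil-Coxeter dichotomy: appending an ascent lengthens the element, and appending a descent
annihilates the composite. -/
theorem ddL_eq_or (l : List (Fin n)) :
    (∀ f : MvPolynomial (Fin n) A, ddL l f = ddW' (wprod l) f) ∨
      ∀ f : MvPolynomial (Fin n) A, ddL l f = 0 := by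
  induction l using List.reverseRecOn with
  | nil => left; intro f; rw [wprod_nil, ddW'_one, ddL_nil]
  | append_singleton l i ih =>
    rcases ih with ih | ih
    · by_cases h : Desc (wprod l) i
      · right; intro f
        rw [ddL_append, ih, ddL_cons, ddL_nil, ddW'_dd'_of_desc h]
      · left; intro f
        rw [ddL_append, ih, ddL_cons, ddL_nil, ddW'_dd'_of_not_desc h, wprod_concat]
    · right; intro f
      rw [ddL_append, ih]

/-- One nonzero value certifies that a composite is the operator of its product, which avoids
computing the length of that product. -/
theorem ddL_eq_ddW'_of_ne_zero {l : List (Fin n)} {g : MvPolynomial (Fin n) A} (h : ddL l g ≠ 0)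
    (f : MvPolynomial (Fin n) A) : ddL l f = ddW' (wprod l) f := by
  rcases ddL_eq_or (A := A) l with h1 | h1
  · exact h1 f
  · exact absurd (h1 g) h

omit [IsDomain A] [CharZero A] in
theorem wprod_reverse (l : List (Fin n)) : wprod l.reverse = (wprod l)⁻¹ := by
  induction l with
  | nil => simp [wprod]
  | cons i l ih =>
    rw [List.reverse_cons, wprod_concat, ih, show i :: l = [i] ++ l from rfl, wprod_append,
      wprod_singleton, mul_inv_rev, inv_eq_of_mul_eq_one_left (s_mul_s i)]

theorem len_inv_le (w : W n) : len w⁻¹ ≤ len w := by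
  have := len_wprod_le (reducedWord w).reverse
  rwa [wprod_reverse, wprod_reducedWord, List.length_reverse, length_reducedWord] at this

theorem len_inv (w : W n) : len w⁻¹ = len w :=
  le_antisymm (len_inv_le w) (by simpa using len_inv_le w⁻¹)

theorem s_inv (i : Fin n) : (s i)⁻¹ = s i := inv_eq_of_mul_eq_one_left (s_mul_s i)

theorem dd'_ddW'_of_not_desc {w : W n} {i : Fin n} (h : ¬Desc w⁻¹ i)
    (f : MvPolynomial (Fin n) A) : dd' i (ddW' w f) = ddW' (s i * w) f := by
  have h1 := len_mul_s_of_not_desc h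
  have h2 : w⁻¹ * s i = (s i * w)⁻¹ := by rw [mul_inv_rev, s_inv]
  rw [h2, len_inv, len_inv] at h1
  have hw : wprod (i :: reducedWord w) = s i * w := by
    rw [show i :: reducedWord w = [i] ++ reducedWord w from rfl, wprod_append, wprod_singleton,
      wprod_reducedWord]
  have := ddL_eq_ddW' (A := A) (l := i :: reducedWord w)
    (by rw [hw, h1, List.length_cons, length_reducedWord]) f
  rw [hw] at this
  exact this

theorem dd'_ddW'_of_desc {w : W n} {i : Fin n} (h : Desc w⁻¹ i)
    (f : MvPolynomial (Fin n) A) : dd' i (ddW' w f) = 0 := by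
  have h1 : ¬Desc (s i * w)⁻¹ i := by
    rw [mul_inv_rev, s_inv]
    exact fun h' => desc_mul_s.1 h' h
  have h2 := dd'_ddW'_of_not_desc h1 f
  rw [← mul_assoc, s_mul_s, one_mul] at h2
  rw [← h2, dd'_dd']

end Matsumoto

end SympSchubert

end

noncomputable section

namespace SympSchubert

open MvPolynomial

/-! ### Composites along words in natural numbers. -/

section Words

variable {n : ℕ} {A : Type*} [CommRing A]

variable (n A) in
/-- The composite `∂'_{a_1} ∘ ⋯ ∘ ∂'_{a_r}` for a word in natural numbers. -/
def DL (l : List ℕ) (f : MvPolynomial (Fin n) A) : MvPolynomial (Fin n) A := l.foldr (DD n A) f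

theorem DL_nil (f : MvPolynomial (Fin n) A) : DL n A [] f = f := rfl

theorem DL_cons (k : ℕ) (l : List ℕ) (f : MvPolynomial (Fin n) A) :
    DL n A (k :: l) f = DD n A k (DL n A l f) := rfl

theorem DL_append (l m : List ℕ) (f : MvPolynomial (Fin n) A) :
    DL n A (l ++ m) f = DL n A l (DL n A m f) := by simp [DL]

variable (n) in
/-- The generator with index `k`, trivial out of range. -/
def sN (k : ℕ) : W n := if h : k < n then s ⟨k, h⟩ else 1

variable (n) in
/-- The product of the generators with the given indices. -/
def nprod (l : List ℕ) : W n := (l.map (sN n)).prod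

theorem nprod_append (l m : List ℕ) : nprod n (l ++ m) = nprod n l * nprod n m := by simp [nprod]

theorem nprod_nil : nprod n [] = 1 := rfl

theorem nprod_singleton (k : ℕ) : nprod n [k] = sN n k := by simp [nprod]

variable [IsDomain A] [CharZero A]

theorem DL_zero (l : List ℕ) : DL n A l 0 = 0 := by
  induction l with
  | nil => rfl
  | cons k l ih => rw [DL_cons, ih, DD_zero]

theorem DL_add (l : List ℕ) (f g : MvPolynomial (Fin n) A) :
    DL n A l (f + g) = DL n A l f + DL n A l g := by
  induction l with
  | nil => rfl
  | cons k l ih => simp only [DL_cons, ih, DD_add]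

theorem DL_neg (l : List ℕ) (f : MvPolynomial (Fin n) A) : DL n A l (-f) = -DL n A l f := by
  induction l with
  | nil => rfl
  | cons k l ih => simp only [DL_cons, ih, DD_neg]

theorem DL_sub (l : List ℕ) (f g : MvPolynomial (Fin n) A) :
    DL n A l (f - g) = DL n A l f - DL n A l g := by
  rw [sub_eq_add_neg, DL_add, DL_neg, ← sub_eq_add_neg]

theorem DL_sum {ι : Type*} (l : List ℕ) (t : Finset ι) (f : ι → MvPolynomial (Fin n) A) :
    DL n A l (∑ i ∈ t, f i) = ∑ i ∈ t, DL n A l (f i) := by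
  induction l with
  | nil => rfl
  | cons k l ih => simp only [DL_cons, ih, DD_sum]

theorem DL_mul_of_inv {l : List ℕ} {f : MvPolynomial (Fin n) A} (h : ∀ k ∈ l, sg n A k f = f)
    (g : MvPolynomial (Fin n) A) : DL n A l (f * g) = f * DL n A l g := by
  induction l with
  | nil => rfl
  | cons k l ih =>
    rw [DL_cons, ih fun j hj => h j (List.mem_cons_of_mem _ hj),
      DD_mul_of_inv (h k List.mem_cons_self), DL_cons]

theorem DL_mul_of_inv' {l : List ℕ} {g : MvPolynomial (Fin n) A} (h : ∀ k ∈ l, sg n A k g = g)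
    (f : MvPolynomial (Fin n) A) : DL n A l (f * g) = DL n A l f * g := by
  rw [mul_comm, DL_mul_of_inv h, mul_comm]

theorem DL_neg_one_pow_mul (l : List ℕ) (k : ℕ) (f : MvPolynomial (Fin n) A) :
    DL n A l ((-1) ^ k * f) = (-1) ^ k * DL n A l f :=
  DL_mul_of_inv (fun j _ => by simp) f

/-- A letter that is at least n makes the operator zero, so a nonzero value also shows that all
letters lie in range. -/
theorem DL_eq_ddW'_of_ne_zero {l : List ℕ} {g : MvPolynomial (Fin n) A} (h : DL n A l g ≠ 0)
    (f : MvPolynomial (Fin n) A) : DL n A l f = ddW' (nprod n l) f := by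
  have key : (∃ m : List (Fin n), m.map Fin.val = l) ∨ ∀ f, DL n A l f = 0 := by
    clear h
    induction l with
    | nil => left; exact ⟨[], rfl⟩
    | cons k l ih =>
      rcases lt_or_ge k n with hk | hk
      · rcases ih with ⟨m, rfl⟩ | ih
        · left; exact ⟨⟨k, hk⟩ :: m, rfl⟩
        · right; intro f; rw [DL_cons, ih, DD_zero]
      · right; intro f; rw [DL_cons, DD_of_le hk]
  rcases key with ⟨m, rfl⟩ | h1
  · have e1 : ∀ f, DL n A (m.map Fin.val) f = ddL m f := by
      intro f
      clear h
      induction m with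
      | nil => rfl
      | cons i m ih => rw [List.map_cons, DL_cons, ih, DD_fin]; rfl
    have e2 : nprod n (m.map Fin.val) = wprod m := by
      rw [nprod, wprod, List.map_map]
      congr 2
      funext i
      simp [sN]
    rw [e1] at h
    rw [e1, e2, ddL_eq_ddW'_of_ne_zero h]
  · exact absurd (h1 g) h

theorem ddW'_eq_DL (w : W n) (f : MvPolynomial (Fin n) A) :
    ddW' w f = DL n A ((reducedWord w).map Fin.val) f := by
  change (reducedWord w).foldr dd' f = _
  generalize reducedWord w = l
  induction l with
  | nil => rfl
  | cons i l ih => rw [List.map_cons, DL_cons, ← ih, DD_fin]; rfl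

/-- The composite of two operators `∂'_u`, `∂'_v` is `∂'_{uv}` unless it vanishes. -/
theorem ddW'_ddW'_of_ne_zero {u v : W n} {g : MvPolynomial (Fin n) A} (h : ddW' u (ddW' v g) ≠ 0)
    (f : MvPolynomial (Fin n) A) : ddW' u (ddW' v f) = ddW' (u * v) f := by
  have e : ∀ f : MvPolynomial (Fin n) A,
      ddW' u (ddW' v f) = ddL (reducedWord u ++ reducedWord v) f := fun f => by
    rw [ddL_append]; rfl
  rw [e] at h
  rw [e, ddL_eq_ddW'_of_ne_zero h, wprod_append, wprod_reducedWord, wprod_reducedWord]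

/-! ### Descending sweeps -/

/-- The word `k + t, …, k + 1`. -/
def sweepW : ℕ → ℕ → List ℕ
  | _, 0 => []
  | k, t + 1 => sweepW (k + 1) t ++ [k + 1]

omit [IsDomain A] [CharZero A] in
theorem DL_sweepW_succ (k t : ℕ) (f : MvPolynomial (Fin n) A) :
    DL n A (sweepW k (t + 1)) f = DL n A (sweepW (k + 1) t) (DD n A (k + 1) f) := by
  rw [sweepW, DL_append, DL_cons, DL_nil]

theorem sweepW_succ' (k t : ℕ) : sweepW k (t + 1) = (k + t + 1) :: sweepW k t := by
  induction t generalizing k with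
  | zero => rfl
  | succ t ih =>
    rw [sweepW, ih, sweepW]
    simp [add_assoc, add_comm 1 t]

theorem mem_sweepW {k t j : ℕ} : j ∈ sweepW k t ↔ k < j ∧ j ≤ k + t := by
  induction t generalizing k with
  | zero => simp [sweepW]
  | succ t ih => rw [sweepW]; simp [ih]; omega

theorem DL_comm {k : ℕ} {l : List ℕ} (h : ∀ j ∈ l, k + 1 < j ∨ j + 1 < k)
    (f : MvPolynomial (Fin n) A) : DD n A k (DL n A l f) = DL n A l (DD n A k f) := by
  induction l with
  | nil => rfl
  | cons j l ih =>
    rw [DL_cons, DL_cons, ← ih fun i hi => h i (List.mem_cons_of_mem _ hi)]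
    rcases h j List.mem_cons_self with h | h
    · exact DD_comm h _
    · exact (DD_comm h _).symm

theorem sg_DD_of_far {j k : ℕ} (h : k + 1 < j ∨ j + 1 < k) {f : MvPolynomial (Fin n) A}
    (hf : sg n A j f = f) : sg n A j (DD n A k f) = DD n A k f := by
  rw [← DD_eq_zero_iff] at hf ⊢
  rcases h with h | h
  · rw [← DD_comm h, hf, DD_zero]
  · rw [DD_comm h, hf, DD_zero]

/-- `∂'_{k+t} ⋯ ∂'_{k+1} x_k^b` is zero for `b < t`, and a sign for `b = t`. -/
theorem DD_succ_xv_pow {k : ℕ} (h : k + 1 < n) (b : ℕ) :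
    DD n A (k + 1) (xv n A k ^ b) =
      -∑ j ∈ Finset.range b, xv n A k ^ (b - 1 - j) * xv n A (k + 1) ^ j := by
  apply DD_unique
  have := (Commute.all (xv n A (k + 1)) (xv n A k)).geom_sum₂_mul b
  rw [map_pow, sg_succ_xv h, rt_succ h]
  rw [Finset.sum_congr rfl fun j _ => mul_comm (xv n A k ^ (b - 1 - j)) (xv n A (k + 1) ^ j)]
  linear_combination -this

theorem DD_succ_xv_pow' {k : ℕ} (h : k + 1 < n) (b : ℕ) :
    DD n A (k + 1) (xv n A (k + 1) ^ b) =
      ∑ j ∈ Finset.range b, xv n A k ^ (b - 1 - j) * xv n A (k + 1) ^ j := by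
  have e : xv n A (k + 1) ^ b = sg n A (k + 1) (xv n A k ^ b) := by rw [map_pow, sg_succ_xv h]
  rw [e, DD_sg, DD_succ_xv_pow h, neg_neg]

/-- The first operator turns x_k^b into minus the complete homogeneous polynomial of degree b - 1 in
x_k and x_{k+1}. The remaining sweep keeps only the term in which x_{k+1} has exponent t, which
requires b = t + 1. -/
theorem DL_sweepW_pow {k t b : ℕ} (hb : b ≤ t) (h : k + t < n) :
    DL n A (sweepW k t) (xv n A k ^ b) = if b = t then (-1) ^ t else 0 := by
  induction t generalizing k b with
  | zero => obtain rfl : b = 0 := by omega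
            simp [sweepW, DL_nil]
  | succ t ih =>
    have e : ∀ j ∈ Finset.range b, DL n A (sweepW (k + 1) t)
        (xv n A k ^ (b - 1 - j) * xv n A (k + 1) ^ j) =
          xv n A k ^ (b - 1 - j) * if j = t then (-1) ^ t else 0 := by
      intro j hj
      rw [Finset.mem_range] at hj
      rw [DL_mul_of_inv, ih (by omega) (by omega)]
      intro i hi
      rw [mem_sweepW] at hi
      rw [map_pow, sg_xv_of_ne (by omega) (by omega)]
    rw [DL_sweepW_succ, DD_succ_xv_pow (by omega), DL_neg, DL_sum, Finset.sum_congr rfl e]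
    split_ifs with h1
    · subst h1
      rw [Finset.sum_eq_single t]
      · simp [pow_succ]
      · intro j _ hj; rw [if_neg hj, mul_zero]
      · simp
    · rw [Finset.sum_eq_zero, neg_zero]
      intro j hj
      rw [Finset.mem_range] at hj
      rw [if_neg (by omega), mul_zero]

/-! ### Monomials under the staircase -/

variable (n A) in
/-- The monomial `x_k^{a_1} x_{k+1}^{a_2} ⋯`. -/
def mono : ℕ → List ℕ → MvPolynomial (Fin n) A
  | _, [] => 1
  | k, a :: l => xv n A k ^ a * mono (k + 1) l

/-- The exponents lie under the staircase `(t - 1, t - 2, …, 0)`. -/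
def Stair : ℕ → List ℕ → Prop
  | _, [] => True
  | t, a :: l => a < t ∧ Stair (t - 1) l

theorem Stair.of_le {t u : ℕ} {l : List ℕ} (h : Stair t l) (htu : t ≤ u) : Stair u l := by
  induction l generalizing t u with
  | nil => trivial
  | cons a l ih => exact ⟨h.1.trans_le htu, ih h.2 (by omega)⟩

omit [IsDomain A] [CharZero A] in
theorem sg_mono {j k : ℕ} (h : j < k) (l : List ℕ) : sg n A j (mono n A k l) = mono n A k l := by
  induction l generalizing k with
  | nil => simp [mono]
  | cons a l ih =>
    rw [mono, map_mul, map_pow, ih (by omega), sg_xv_of_ne (by omega) (by omega)]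

/-- The sweep moves a monomial under the staircase one variable down. In the Leibniz rule the
unwanted terms carry a power of the next variable smaller than the length of the remaining sweep,
and vanish by `DL_sweepW_pow`. -/
theorem DL_sweepW_mono {k t : ℕ} (hn : k + t < n) {l : List ℕ} (hl : Stair t l)
    {h : MvPolynomial (Fin n) A} (hh : ∀ j, k + 2 ≤ j → j ≤ k + t → sg n A j h = h) :
    DL n A (sweepW k t) (mono n A (k + 1) l * h) = mono n A k l * DL n A (sweepW k t) h := by
  induction t generalizing k l h with
  | zero =>
    cases l with
    | nil => simp [mono]
    | cons a l => exact absurd hl.1 (by omega)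
  | succ t ih =>
    cases l with
    | nil => simp [mono]
    | cons a l =>
      obtain ⟨ha, hl⟩ := hl
      rw [Nat.add_sub_cancel] at hl
      have h1 : DD n A (k + 1) (mono n A (k + 1) (a :: l) * h) =
          (∑ j ∈ Finset.range a, xv n A k ^ (a - 1 - j) *
            (mono n A (k + 2) l * (xv n A (k + 1) ^ j * h))) +
          xv n A k ^ a * (mono n A (k + 2) l * DD n A (k + 1) h) := by
        rw [mono, show xv n A (k + 1) ^ a * mono n A (k + 1 + 1) l * h =
          mono n A (k + 2) l * (xv n A (k + 1) ^ a * h) by ring,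
          DD_mul_of_inv (sg_mono (by omega) l), DD_mul, map_pow, sg_succ_xv' (by omega),
          DD_succ_xv_pow' (by omega), mul_add, Finset.sum_mul, Finset.mul_sum]
        congr 1
        · exact Finset.sum_congr rfl fun _ _ => by ring
        · ring
      have hx : ∀ b, ∀ j ∈ sweepW (k + 1) t, sg n A j (xv n A k ^ b) = xv n A k ^ b := by
        intro b j hj
        rw [mem_sweepW] at hj
        rw [map_pow, sg_xv_of_ne (by omega) (by omega)]
      rw [DL_sweepW_succ, h1, DL_add, DL_sum, Finset.sum_eq_zero, zero_add, DL_mul_of_inv (hx a),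
        ih (by omega) hl, DL_sweepW_succ, mono]
      · ring
      · intro j h2 h3
        exact sg_DD_of_far (Or.inl (by omega)) (hh j (by omega) (by omega))
      · intro j hj
        rw [Finset.mem_range] at hj
        rw [DL_mul_of_inv (hx _), ih (by omega) hl, DL_mul_of_inv', DL_sweepW_pow (by omega)
          (by omega), if_neg (by omega)]
        · ring
        · intro i hi
          rw [mem_sweepW] at hi
          exact hh i (by omega) (by omega)
        · intro i h2 h3
          rw [map_mul, map_pow, sg_xv_of_ne (by omega) (by omega), hh i (by omega) (by omega)]

/-- Invariance is tested by applying one more operator. For the lowest index, the braid relation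
turns ∂'_{k+1} ∂'_{k+2} ∂'_{k+1} into a composite that first applies ∂'_{k+2}, which kills g. -/
theorem sg_DL_sweepW {k t : ℕ} {g : MvPolynomial (Fin n) A}
    (hg : ∀ j, k + 2 ≤ j → j ≤ k + t → sg n A j g = g) {j : ℕ} (h1 : k + 1 ≤ j) (h2 : j ≤ k + t) :
    sg n A j (DL n A (sweepW k t) g) = DL n A (sweepW k t) g := by
  induction t generalizing k g with
  | zero => omega
  | succ t ih =>
    rcases Nat.eq_or_lt_of_le h1 with rfl | h1
    · cases t with
      | zero => rw [DL_sweepW_succ]; exact sg_DD _ _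
      | succ t =>
        rw [← DD_eq_zero_iff, DL_sweepW_succ, DL_sweepW_succ, DL_comm, DD_braid_three,
          DD_of_inv (hg (k + 2) (by omega) (by omega)), DD_zero, DD_zero, DL_zero]
        intro j hj
        rw [mem_sweepW] at hj
        omega
    · rw [DL_sweepW_succ]
      exact ih (fun i h3 h4 => sg_DD_of_far (Or.inl (by omega)) (hg i (by omega) (by omega)))
        (by omega) (by omega)

/-! ### The operators `∂'_m ⋯ ∂'_1 ∂'_0` -/

/-- The word `m, …, 1, 0`. -/
def cycW (m : ℕ) : List ℕ := sweepW 0 m ++ [0]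

omit [IsDomain A] [CharZero A] in
theorem DL_cycW (m : ℕ) (f : MvPolynomial (Fin n) A) :
    DL n A (cycW m) f = DL n A (sweepW 0 m) (DD n A 0 f) := by
  rw [cycW, DL_append, DL_cons, DL_nil]

theorem cycW_succ (m : ℕ) : cycW (m + 1) = (m + 1) :: cycW m := by
  rw [cycW, sweepW_succ', cycW]; simp

/-- Invariance under `s_1, …, s_m`. -/
def SymTo (m : ℕ) (f : MvPolynomial (Fin n) A) : Prop := ∀ j, 1 ≤ j → j ≤ m → sg n A j f = f

theorem SymTo.DL_cycW {m a : ℕ} {f : MvPolynomial (Fin n) A} (hf : SymTo m f) :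
    SymTo m (DL n A (cycW m) (xv n A 0 ^ a * f)) := by
  intro j h1 h2
  rw [SympSchubert.DL_cycW]
  refine sg_DL_sweepW (fun i h3 h4 => sg_DD_of_far (Or.inl (by omega)) ?_) (by omega) (by omega)
  rw [map_mul, map_pow, sg_xv_of_ne (by omega) (by omega), hf i (by omega) (by omega)]

theorem DL_cycW_mono {m a : ℕ} (hn : m < n) {l : List ℕ} (hl : Stair m l)
    {f : MvPolynomial (Fin n) A} (hf : SymTo m f) :
    DL n A (cycW m) (mono n A 0 (a :: l) * f) =
      mono n A 0 l * DL n A (cycW m) (xv n A 0 ^ a * f) := by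
  rw [DL_cycW, mono, show xv n A 0 ^ a * mono n A (0 + 1) l * f =
    mono n A (0 + 1) l * (xv n A 0 ^ a * f) by ring, DD_mul_of_inv (sg_mono (by omega) l),
    DL_sweepW_mono (by omega) hl, ← DL_cycW]
  intro j h1 h2
  refine sg_DD_of_far (Or.inl (by omega)) ?_
  rw [map_mul, map_pow, sg_xv_of_ne (by omega) (by omega), hf j (by omega) (by omega)]

variable (n A) in
/-- The composite of the operators `f ↦ ∂'_m ⋯ ∂'_0 (x_0^a f)` for the exponents `a` in a list, the
first one being applied first. -/
def cycIter (m : ℕ) : List ℕ → MvPolynomial (Fin n) A → MvPolynomial (Fin n) A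
  | [], f => f
  | a :: l, f => cycIter m l (DL n A (cycW m) (xv n A 0 ^ a * f))

/-- The word `(m, …, 1, 0)^k`. -/
def cycWPow (m : ℕ) : ℕ → List ℕ
  | 0 => []
  | k + 1 => cycWPow m k ++ cycW m

/-- Each pass through the word m, …, 0 consumes the leading exponent and shifts the rest of the
monomial back to start at x_0, while the other factor stays symmetric. -/
theorem DL_cycWPow {m : ℕ} (hn : m < n) {l : List ℕ} (hl : Stair (m + 1) l)
    {f : MvPolynomial (Fin n) A} (hf : SymTo m f) :
    DL n A (cycWPow m l.length) (mono n A 0 l * f) = cycIter n A m l f := by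
  induction l generalizing f with
  | nil => simp [cycWPow, DL_nil, cycIter, mono]
  | cons a l ih =>
    rw [List.length_cons, cycWPow, DL_append, DL_cycW_mono hn hl.2 hf, cycIter,
      ih (hl.2.of_le (by omega)) hf.DL_cycW]

/-- The word of `Ψ_m = Θ_0 ∘ ⋯ ∘ Θ_{m-1}`, where `Θ_i = ∂'_i ⋯ ∂'_0`. -/
def psiW : ℕ → List ℕ
  | 0 => []
  | m + 1 => psiW m ++ cycW m

theorem mem_psiW {m j : ℕ} (h : j ∈ psiW m) : j < m := by
  induction m with
  | zero => simp [psiW] at h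
  | succ m ih =>
    rw [psiW, List.mem_append, cycW, List.mem_append, mem_sweepW] at h
    rcases h with h | h | h
    · have := ih h; omega
    · omega
    · simp at h; omega

theorem DL_cycW_DD {m j : ℕ} (h : 2 ≤ j) (hj : j ≤ m) (f : MvPolynomial (Fin n) A) :
    DL n A (cycW m) (DD n A j f) = DD n A (j - 1) (DL n A (cycW m) f) := by
  induction m with
  | zero => omega
  | succ m ih =>
    rw [cycW_succ, DL_cons, DL_cons]
    rcases Nat.eq_or_lt_of_le hj with rfl | hj
    · obtain ⟨m, rfl⟩ : ∃ k, m = k + 1 := ⟨m - 1, by omega⟩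
      rw [Nat.add_sub_cancel, cycW_succ, DL_cons, DL_cons, ← DL_comm, DD_braid_three]
      intro i hi
      rw [cycW, List.mem_append, mem_sweepW] at hi
      rcases hi with hi | hi
      · omega
      · simp at hi; omega
    · rw [ih (by omega)]
      exact (DD_comm (by omega) _).symm

theorem DL_cycW_DL_sweepW {m t : ℕ} (h : t + 1 ≤ m) (f : MvPolynomial (Fin n) A) :
    DL n A (cycW m) (DL n A (sweepW 1 t) f) = DL n A (sweepW 0 t) (DL n A (cycW m) f) := by
  induction t with
  | zero => rfl
  | succ t ih =>
    rw [sweepW_succ', sweepW_succ', DL_cons, DL_cons, DL_cycW_DD (by omega) (by omega),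
      ih (by omega)]
    congr 1
    omega

/-- The braid relation of length four, together with commutation past the sweeps, shows that the
square of Θ_{m+1} factors through Θ_m on the left. -/
theorem DL_cycW_cycW (m : ℕ) : ∃ l, ∀ f : MvPolynomial (Fin n) A,
    DL n A (cycW (m + 1)) (DL n A (cycW (m + 1)) f) = DL n A (cycW m) (DL n A l f) := by
  refine ⟨sweepW 1 m ++ [1, 0, 1], fun f => ?_⟩
  have e1 : ∀ g : MvPolynomial (Fin n) A, DL n A (cycW (m + 1)) g =
      DL n A (sweepW 1 m) (DD n A 1 (DD n A 0 g)) := fun g => by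
    rw [DL_cycW, DL_sweepW_succ]
  rw [e1 f, DL_cycW_DL_sweepW le_rfl, e1, DL_append, DL_cycW m, DL_comm (k := 0)]
  · simp only [DL_cons, DL_nil]
    rw [DD_braid_four]
  · intro j hj
    rw [mem_sweepW] at hj
    omega

/-- Since Ψ_{m+1} ends in Θ_m, applying it after Θ_m creates a square of Θ_m, which factors through
Θ_{m-1}; induction descends to ∂'_0 ∂'_0 = 0. -/
theorem DL_psiW_cycW (m : ℕ) (f : MvPolynomial (Fin n) A) :
    DL n A (psiW (m + 1)) (DL n A (cycW m) f) = 0 := by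
  induction m generalizing f with
  | zero => exact DD_DD _ _
  | succ m ih =>
    obtain ⟨l, hl⟩ := DL_cycW_cycW (n := n) (A := A) m
    rw [psiW, DL_append, hl, ih]

theorem DD_zero_mul_xv (h : 0 < n) (f : MvPolynomial (Fin n) A) :
    DD n A 0 (xv n A 0 * f) = f - xv n A 0 * DD n A 0 f := by
  rw [DD_mul, DD_xv h, sg_zero_xv h]; ring

theorem DL_sweepW_xv_mul {m : ℕ} (h : m + 1 < n) {g : MvPolynomial (Fin n) A}
    (hg : ∀ j, 2 ≤ j → j ≤ m + 1 → DD n A j g = 0) :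
    DL n A (sweepW 0 (m + 1)) (xv n A 0 * g) =
      xv n A (m + 1) * DL n A (sweepW 0 (m + 1)) g - DL n A (sweepW 0 m) g := by
  induction m with
  | zero =>
    simp only [sweepW, List.nil_append, DL_cons, DL_nil, zero_add]
    rw [DD_mul, DD_succ_xv (k := 0) (by omega), sg_succ_xv (k := 0) (by omega)]
    ring
  | succ m ih =>
    rw [sweepW_succ', DL_cons, ih (by omega) fun j h1 h2 => hg j h1 (by omega), DD_sub, zero_add,
      DL_comm (l := sweepW 0 m), hg (m + 1 + 1) (by omega) le_rfl, DL_zero, sub_zero, DD_mul,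
      DD_succ_xv (by omega), sg_succ_xv (by omega), DL_cons]
    · ring
    · intro j hj
      rw [mem_sweepW] at hj
      omega

/-- Commuting x_0 past ∂'_0 gives F - x_0 ∂'_0 F with F = x_0^b G. The sweep kills F because b is
too small. It turns the factor x_0 of the other term into x_{m-1}, up to a correction in the image
of Θ_{m-2}, which `DL_psiW_cycW` annihilates. -/
theorem DL_psiW_xv_mul {m b : ℕ} (hm : m ≤ n) (hb : b + 1 < m) {G : MvPolynomial (Fin n) A}
    (hG : SymTo (m - 1) G) :
    DL n A (psiW m) (xv n A 0 ^ (b + 1) * G) =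
      -xv n A (m - 1) * DL n A (psiW m) (xv n A 0 ^ b * G) := by
  obtain ⟨m, rfl⟩ : ∃ k, m = k + 2 := ⟨m - 2, by omega⟩
  rw [show m + 2 - 1 = m + 1 by omega] at *
  have hinv : ∀ j, 2 ≤ j → j ≤ m + 1 → sg n A j (xv n A 0 ^ b * G) = xv n A 0 ^ b * G := by
    intro j h1 h2
    rw [map_mul, map_pow, sg_xv_of_ne (by omega) (by omega), hG j (by omega) h2]
  have h0 : DL n A (sweepW 0 (m + 1)) (xv n A 0 ^ b * G) = 0 := by
    rw [DL_mul_of_inv', DL_sweepW_pow (by omega) (by omega), if_neg (by omega), zero_mul]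
    intro j hj
    rw [mem_sweepW] at hj
    exact hG j (by omega) (by omega)
  rw [psiW, DL_append, DL_append, pow_succ', mul_assoc, DL_cycW, DD_zero_mul_xv (by omega), DL_sub,
    h0, DL_sweepW_xv_mul (by omega), ← DL_cycW, ← DL_cycW, DL_sub, DL_sub, DL_psiW_cycW,
    DL_mul_of_inv, DL_zero]
  · ring
  · intro j hj
    have := mem_psiW hj
    exact sg_xv_of_ne (by omega) (by omega)
  · intro j h1 h2
    exact DD_of_inv (sg_DD_of_far (Or.inl (by omega)) (hinv j h1 h2))

theorem DL_psiW_pow_mul {m b : ℕ} (hm : m ≤ n) (hb : b < m) {G : MvPolynomial (Fin n) A}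
    (hG : SymTo (m - 1) G) :
    DL n A (psiW m) (xv n A 0 ^ b * G) = (-xv n A (m - 1)) ^ b * DL n A (psiW m) G := by
  induction b with
  | zero => simp
  | succ b ih => rw [DL_psiW_xv_mul hm hb hG, ih (by omega)]; ring

variable (n A) in
/-- The monomial obtained from `x_0^{a_1} x_1^{a_2} ⋯` under `x_i ↦ -x_{m-1-i}`, where `m` is the
length of the list of exponents. -/
def revMono : List ℕ → MvPolynomial (Fin n) A
  | [] => 1
  | a :: l => (-xv n A l.length) ^ a * revMono l

theorem DL_psiW_mono {l : List ℕ} (hl : Stair l.length l) (hn : l.length ≤ n)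
    {G : MvPolynomial (Fin n) A} (hG : SymTo (l.length - 1) G) :
    DL n A (psiW l.length) (mono n A 0 l * G) = revMono n A l * DL n A (psiW l.length) G := by
  induction l generalizing G with
  | nil => simp [mono, revMono]
  | cons a l ih =>
    simp only [List.length_cons, Nat.add_sub_cancel] at hl hn hG ⊢
    obtain ⟨ha, hl⟩ := hl
    rw [Nat.add_sub_cancel] at hl
    have hs : SymTo (l.length - 1) (DL n A (cycW l.length) (xv n A 0 ^ a * G)) := fun j h1 h2 =>
      hG.DL_cycW j h1 (by omega)
    rw [psiW, DL_append, DL_cycW_mono (by omega) hl hG, ih hl (by omega) hs, ← DL_append]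
    change _ * DL n A (psiW (l.length + 1)) _ = _
    rw [DL_psiW_pow_mul hn ha hG, revMono, Nat.add_sub_cancel, psiW]
    ring

end Words

end SympSchubert

end

noncomputable section

namespace SympSchubert

open MvPolynomial

/-! ### Pfaffians of lists -/

section Contraction

variable {R : Type*} [CommRing R]

/-- Contraction: the alternating sum of `φ (l_i) G (l without l_i)`. -/
def iota (φ : ℕ → R) : (List ℕ → R) → List ℕ → R
  | _, [] => 0
  | G, a :: l => φ a * G l - iota φ (fun m => G (a :: m)) l

theorem iota_nil (φ : ℕ → R) (G : List ℕ → R) : iota φ G [] = 0 := rfl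

theorem iota_cons (φ : ℕ → R) (G : List ℕ → R) (a : ℕ) (l : List ℕ) :
    iota φ G (a :: l) = φ a * G l - iota φ (fun m => G (a :: m)) l := rfl

theorem iota_cons_fun (φ : ℕ → R) (G : List ℕ → R) (a : ℕ) :
    (fun m => iota φ G (a :: m)) = fun m => φ a * G m - iota φ (fun m => G (a :: m)) m := rfl

theorem iota_congr (φ : ℕ → R) {G H : List ℕ → R} {l : List ℕ}
    (h : ∀ m : List ℕ, m.length + 1 = l.length → G m = H m) : iota φ G l = iota φ H l := by
  induction l generalizing G H with
  | nil => rfl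
  | cons a l ih =>
    rw [iota_cons, iota_cons, h l rfl, ih fun m hm => h (a :: m) (by simp [hm])]

theorem iota_add (φ : ℕ → R) (G H : List ℕ → R) (l : List ℕ) :
    iota φ (fun m => G m + H m) l = iota φ G l + iota φ H l := by
  induction l generalizing G H with
  | nil => simp [iota_nil]
  | cons a l ih => simp only [iota_cons, ih]; ring

theorem iota_mul (φ : ℕ → R) (c : R) (G : List ℕ → R) (l : List ℕ) :
    iota φ (fun m => c * G m) l = c * iota φ G l := by
  induction l generalizing G with
  | nil => simp [iota_nil]
  | cons a l ih => simp only [iota_cons, ih]; ring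

theorem iota_neg (φ : ℕ → R) (G : List ℕ → R) (l : List ℕ) :
    iota φ (fun m => -G m) l = -iota φ G l := by
  have := iota_mul φ (-1) G l
  simpa using this

theorem iota_sub (φ : ℕ → R) (G H : List ℕ → R) (l : List ℕ) :
    iota φ (fun m => G m - H m) l = iota φ G l - iota φ H l := by
  simp only [sub_eq_add_neg, iota_add, iota_neg]

theorem iota_zero (φ : ℕ → R) (l : List ℕ) : iota φ (fun _ => 0) l = 0 := by
  have := iota_mul φ 0 (fun _ => 0) l
  simpa using this

theorem iota_add_left (φ ψ : ℕ → R) (G : List ℕ → R) (l : List ℕ) :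
    iota (fun a => φ a + ψ a) G l = iota φ G l + iota ψ G l := by
  induction l generalizing G with
  | nil => simp [iota_nil]
  | cons a l ih => simp only [iota_cons, ih]; ring

theorem iota_mul_left (φ : ℕ → R) (c : R) (G : List ℕ → R) (l : List ℕ) :
    iota (fun a => c * φ a) G l = c * iota φ G l := by
  induction l generalizing G with
  | nil => simp [iota_nil]
  | cons a l ih => simp only [iota_cons, ih]; ring

theorem iota_sub_left (φ ψ : ℕ → R) (G : List ℕ → R) (l : List ℕ) :
    iota (fun a => φ a - ψ a) G l = iota φ G l - iota ψ G l := by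
  have := iota_add_left φ (fun a => (-1) * ψ a) G l
  rw [iota_mul_left] at this
  simpa [sub_eq_add_neg] using this

/-- Contractions behave like interior products, squaring to zero and anticommuting, although G is
not assumed alternating: only the signs of the removed positions matter. -/
theorem iota_iota_self (φ : ℕ → R) (G : List ℕ → R) (l : List ℕ) : iota φ (iota φ G) l = 0 := by
  induction l generalizing G with
  | nil => rfl
  | cons a l ih =>
    rw [iota_cons, iota_cons_fun, iota_sub, iota_mul, ih]; ring

theorem iota_iota (φ ψ : ℕ → R) (G : List ℕ → R) (l : List ℕ) :
    iota φ (iota ψ G) l = -iota ψ (iota φ G) l := by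
  have h := iota_iota_self (fun a => φ a + ψ a) G l
  have e : iota (fun a => φ a + ψ a) G = fun m => iota φ G m + iota ψ G m :=
    funext fun m => iota_add_left φ ψ G m
  rw [e, iota_add_left, iota_add, iota_add, iota_iota_self, iota_iota_self] at h
  linear_combination h

theorem iota_append_singleton (φ : ℕ → R) (G : List ℕ → R) (l : List ℕ) (c : ℕ) :
    iota φ G (l ++ [c]) = iota φ (fun m => G (m ++ [c])) l + (-1) ^ l.length * φ c * G l := by
  induction l generalizing G with
  | nil => simp [iota_cons, iota_nil]
  | cons a l ih =>
    simp only [List.cons_append, iota_cons, ih, List.length_cons]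
    ring

/-- Auxiliary recursion for the Pfaffian of the array `Q` along a list. -/
def pfAux (Q : ℕ → ℕ → R) : ℕ → List ℕ → R
  | _, [] => 1
  | 0, _ :: _ => 0
  | k + 1, a :: l => iota (Q a) (pfAux Q k) l

theorem pfAux_succ (Q : ℕ → ℕ → R) {k : ℕ} {l : List ℕ} (h : l.length ≤ k) :
    pfAux Q (k + 1) l = pfAux Q k l := by
  induction k generalizing l with
  | zero =>
    obtain rfl : l = [] := List.eq_nil_of_length_eq_zero (by omega)
    rfl
  | succ k ih =>
    cases l with
    | nil => rfl
    | cons a l =>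
      rw [List.length_cons] at h
      exact iota_congr _ fun m hm => ih (by omega)

theorem pfAux_eq (Q : ℕ → ℕ → R) {k : ℕ} {l : List ℕ} (h : l.length ≤ k) :
    pfAux Q k l = pfAux Q l.length l := by
  induction k, h using Nat.le_induction with
  | base => rfl
  | succ k hk ih => rw [pfAux_succ Q hk, ih]

/-- The Pfaffian of the array `Q` along a list; it vanishes on lists of odd length. -/
def pfL (Q : ℕ → ℕ → R) (l : List ℕ) : R := pfAux Q l.length l

theorem pfL_nil (Q : ℕ → ℕ → R) : pfL Q [] = 1 := rfl

theorem pfL_cons (Q : ℕ → ℕ → R) (a : ℕ) (l : List ℕ) :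
    pfL Q (a :: l) = iota (Q a) (pfL Q) l :=
  iota_congr _ fun _ hm => pfAux_eq Q (by omega)

theorem pfL_cons_fun (Q : ℕ → ℕ → R) (a : ℕ) :
    (fun l => pfL Q (a :: l)) = iota (Q a) (pfL Q) := funext fun l => pfL_cons Q a l

theorem iota_of_parity (φ : ℕ → R) {G : List ℕ → R} {l : List ℕ}
    (h : ∀ m : List ℕ, m.length % 2 ≠ l.length % 2 → G m = 0) : iota φ G l = 0 := by
  rw [iota_congr φ (H := fun _ => 0) fun m hm => h m (by omega), iota_zero]

theorem pfL_of_odd (Q : ℕ → ℕ → R) {l : List ℕ} (h : l.length % 2 = 1) : pfL Q l = 0 := by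
  induction hk : l.length using Nat.strong_induction_on generalizing l with
  | _ k ih =>
    cases l with
    | nil => simp at h
    | cons a l =>
      rw [List.length_cons] at h hk
      rw [pfL_cons, iota_congr (H := fun _ => 0), iota_zero]
      intro m hm
      exact ih m.length (by omega) (by omega) rfl

/-- Expansion of the Pfaffian along the last column. -/
theorem pfL_append_singleton (Q : ℕ → ℕ → R) (c : ℕ) (l : List ℕ) (h : l.length % 2 = 1) :
    pfL Q (l ++ [c]) = iota (fun a => Q a c) (pfL Q) l := by
  induction hk : l.length using Nat.strong_induction_on generalizing l with
  | _ k ih =>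
    cases l with
    | nil => simp at h
    | cons a l =>
      rw [List.length_cons] at h hk
      rw [List.cons_append, pfL_cons, iota_append_singleton, iota_cons, pfL_cons_fun, iota_iota,
        iota_congr (Q a) (H := iota (fun a => Q a c) (pfL Q))]
      · have : (-1 : R) ^ l.length = 1 := Even.neg_one_pow (Nat.even_iff.2 (by omega))
        rw [this, iota_iota]; ring
      · intro m hm
        exact ih m.length (by omega) m (by omega) rfl

/-- The Pfaffian along a list, completed by a zero when the length is odd. -/
def pfT (Q : ℕ → ℕ → R) (e : ℕ → R) (l : List ℕ) : R := pfL Q l + iota e (pfL Q) l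

theorem pfT_of_even (Q : ℕ → ℕ → R) (e : ℕ → R) {l : List ℕ} (h : l.length % 2 = 0) :
    pfT Q e l = pfL Q l := by
  rw [pfT, iota_of_parity, add_zero]
  intro m hm
  exact pfL_of_odd Q (by omega)

theorem pfT_of_odd (Q : ℕ → ℕ → R) (e : ℕ → R) {l : List ℕ} (h : l.length % 2 = 1) :
    pfT Q e l = iota e (pfL Q) l := by rw [pfT, pfL_of_odd Q h, zero_add]

/-- The derivation that raises one entry of a list by one. -/
def shift : (List ℕ → R) → List ℕ → R
  | _, [] => 0
  | G, a :: l => G ((a + 1) :: l) + shift (fun m => G (a :: m)) l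

theorem shift_cons (G : List ℕ → R) (a : ℕ) (l : List ℕ) :
    shift G (a :: l) = G ((a + 1) :: l) + shift (fun m => G (a :: m)) l := rfl

theorem shift_add (G H : List ℕ → R) (l : List ℕ) :
    shift (fun m => G m + H m) l = shift G l + shift H l := by
  induction l generalizing G H with
  | nil => simp [shift]
  | cons a l ih => simp only [shift_cons, ih]; ring

theorem shift_mul (c : R) (G : List ℕ → R) (l : List ℕ) :
    shift (fun m => c * G m) l = c * shift G l := by
  induction l generalizing G with
  | nil => simp [shift]
  | cons a l ih => simp only [shift_cons, ih]; ring

theorem shift_sub (G H : List ℕ → R) (l : List ℕ) :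
    shift (fun m => G m - H m) l = shift G l - shift H l := by
  have := shift_add G (fun m => (-1) * H m) l
  rw [shift_mul] at this
  simpa [sub_eq_add_neg] using this

theorem shift_congr {G H : List ℕ → R} {l : List ℕ}
    (h : ∀ m : List ℕ, m.length = l.length → G m = H m) : shift G l = shift H l := by
  induction l generalizing G H with
  | nil => rfl
  | cons a l ih =>
    rw [shift_cons, shift_cons, h _ (by simp), ih fun m hm => h (a :: m) (by simp [hm])]

/-- A Leibniz rule: the raised entry is either one that survives the contraction or the one that is
removed. -/
theorem shift_iota (φ : ℕ → R) (G : List ℕ → R) (l : List ℕ) :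
    shift (iota φ G) l = iota φ (shift G) l + iota (fun b => φ (b + 1)) G l := by
  induction l generalizing G with
  | nil => simp [shift, iota_nil]
  | cons a l ih =>
    rw [shift_cons, iota_cons, iota_cons_fun, shift_sub, shift_mul, ih, iota_cons, iota_cons,
      show (fun m => shift G (a :: m)) =
        fun m => G ((a + 1) :: m) + shift (fun m => G (a :: m)) m from rfl, iota_add]
    ring

/-- If `Q_a` is replaced by `Q_a + φ_a ψ - ψ_a φ`, the Pfaffian changes by `ι_φ ι_ψ`. -/
theorem iota_iota_pfL_cons (Q : ℕ → ℕ → R) (φ ψ : ℕ → R) (a : ℕ) (l : List ℕ) :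
    iota φ (iota ψ (pfL Q)) (a :: l) = φ a * iota ψ (pfL Q) l - ψ a * iota φ (pfL Q) l +
      iota (Q a) (iota φ (iota ψ (pfL Q))) l := by
  have e1 : iota ψ (iota (Q a) (pfL Q)) = fun m => -iota (Q a) (iota ψ (pfL Q)) m :=
    funext fun m => iota_iota _ _ _ _
  rw [iota_cons, iota_cons_fun, iota_sub, iota_mul, pfL_cons_fun, e1, iota_neg, iota_iota φ (Q a)]
  ring

section Recursion

variable {Q : ℕ → ℕ → R} {e : ℕ → R}

/-- The hypothesis says that the derivative of the array Q is the rank-two form built from e and its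
shift. The derivative of a Pfaffian along such a form is the double contraction with the two
factors, by `iota_iota_pfL_cons`. -/
theorem shift_pfL (hQ : ∀ a b, Q a (b + 1) + Q (a + 1) b = e a * e (b + 1) - e (a + 1) * e b)
    (l : List ℕ) : shift (pfL Q) l = iota e (iota (fun b => e (b + 1)) (pfL Q)) l := by
  induction hk : l.length using Nat.strong_induction_on generalizing l with
  | _ k ih =>
    cases l with
    | nil => rfl
    | cons a l =>
      rw [List.length_cons] at hk
      have h1 : iota (fun b => Q a (b + 1)) (pfL Q) l + iota (Q (a + 1)) (pfL Q) l =
          e a * iota (fun b => e (b + 1)) (pfL Q) l - e (a + 1) * iota e (pfL Q) l := by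
        rw [← iota_add_left, ← iota_mul_left, ← iota_mul_left, ← iota_sub_left]
        congr 1
        exact funext fun b => hQ a b
      rw [shift_cons, pfL_cons, pfL_cons_fun, shift_iota, iota_iota_pfL_cons,
        iota_congr (Q a) (G := shift (pfL Q)) (H := iota e (iota (fun b => e (b + 1)) (pfL Q)))]
      · linear_combination h1
      · intro m hm
        exact ih _ (by omega) m rfl

/-- The Pieri formula for `e_1`. -/
theorem pfT_pieri (hQ : ∀ a b, Q a (b + 1) + Q (a + 1) b = e a * e (b + 1) - e (a + 1) * e b)
    (h0 : ∀ a, Q a 0 = e a) (he : e 0 = 1) (l : List ℕ) :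
    e 1 * pfT Q e l = 2 * shift (pfT Q e) l + pfT Q e (l ++ [1]) := by
  have hQ1 : (fun a => Q a 1) = fun a => e 1 * e a - 2 * e (a + 1) := by
    funext a
    have := hQ a 0
    rw [h0, he, zero_add] at this
    linear_combination this
  have hι : ∀ m, iota (fun a => Q a 1) (pfL Q) m =
      e 1 * iota e (pfL Q) m - 2 * iota (fun b => e (b + 1)) (pfL Q) m := by
    intro m
    rw [hQ1, iota_sub_left, iota_mul_left, iota_mul_left]
  -- Exactly one of l and l ++ [1] has odd length and needs the completing zero; in both cases a
  -- double contraction with e drops out.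
  rcases Nat.mod_two_eq_zero_or_one l.length with h | h
  · have h1 : (-1 : R) ^ l.length = 1 := Even.neg_one_pow (Nat.even_iff.2 h)
    rw [pfT_of_even Q e h, pfT_of_odd Q e (by simp; omega), iota_append_singleton, h1,
      shift_congr (H := pfL Q) fun m hm => pfT_of_even Q e (by omega), shift_pfL hQ,
      iota_congr e (G := fun m => pfL Q (m ++ [1])) (H := fun m => e 1 * iota e (pfL Q) m - 2 * iota (fun b => e (b + 1)) (pfL Q) m)
        fun m hm => by rw [pfL_append_singleton Q 1 m (by omega), hι],
      iota_sub, iota_mul, iota_mul, iota_iota_self]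
    ring
  · have e1 : shift (pfL Q) = iota e (iota (fun b => e (b + 1)) (pfL Q)) :=
      funext fun m => shift_pfL hQ m
    rw [pfT_of_odd Q e h, pfT_of_even Q e (by simp; omega), pfL_append_singleton Q 1 l h, hι,
      shift_congr (H := iota e (pfL Q)) fun m hm => pfT_of_odd Q e (by omega), shift_iota, e1,
      iota_iota_self]
    ring

end Recursion

/-- Two equal adjacent entries `b, b` contribute the factor `c`, when at most `N` entries precede
them. -/
def Doubles (c : R) (b N : ℕ) (G : List ℕ → R) : Prop :=
  ∀ l₁ l₂ : List ℕ, l₁.length ≤ N → G (l₁ ++ b :: b :: l₂) = c * G (l₁ ++ l₂)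

theorem Doubles.iota {c : R} {b N : ℕ} {G : List ℕ → R} (h : Doubles c b N G) (φ : ℕ → R) :
    Doubles c b N (iota φ G) := by
  intro l₁ l₂ hl
  induction l₁ generalizing N G with
  | nil =>
    simp only [List.nil_append]
    rw [iota_cons, iota_cons, ← iota_mul, iota_congr φ (G := fun m => G (b :: b :: m))
      (H := fun m => c * G m) fun m _ => h [] m (by simp)]
    ring
  | cons a l₁ ih =>
    rw [List.length_cons] at hl
    rw [List.cons_append, iota_cons, List.cons_append, iota_cons, h l₁ l₂ (by omega),
      ih (N := N - 1) (G := fun m => G (a :: m)) _ (by omega)]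
    · ring
    · intro m₁ m₂ hm
      exact h (a :: m₁) m₂ (by simp; omega)

/-- With the equal entries in front, expansion gives the diagonal entry times the rest, minus a
double contraction along the same row, which is zero. The preceding entries are then absorbed one
contraction at a time. -/
theorem doubles_pfL (Q : ℕ → ℕ → R) (b N : ℕ) : Doubles (Q b b) b N (pfL Q) := by
  induction N with
  | zero =>
    intro l₁ l₂ hl
    obtain rfl : l₁ = [] := List.eq_nil_of_length_eq_zero (by omega)
    rw [List.nil_append, List.nil_append, pfL_cons, iota_cons, pfL_cons_fun, iota_iota_self,
      sub_zero]
  | succ N ih =>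
    intro l₁ l₂ hl
    cases l₁ with
    | nil => exact ih [] l₂ (by simp)
    | cons a l₁ =>
      rw [List.length_cons] at hl
      rw [List.cons_append, pfL_cons, List.cons_append, pfL_cons]
      exact ih.iota (Q a) l₁ l₂ (by omega)

theorem pfT_doubles (Q : ℕ → ℕ → R) (e : ℕ → R) (b : ℕ) (l₁ l₂ : List ℕ) :
    pfT Q e (l₁ ++ b :: b :: l₂) = Q b b * pfT Q e (l₁ ++ l₂) := by
  rw [pfT, pfT, doubles_pfL Q b _ l₁ l₂ le_rfl, (doubles_pfL Q b _).iota e l₁ l₂ le_rfl]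
  ring

theorem pfT_cons_of_zero {Q : ℕ → ℕ → R} {e : ℕ → R} {a : ℕ} (h : ∀ b, Q a b = 0) (he : e a = 0)
    (l : List ℕ) : pfT Q e (a :: l) = 0 := by
  have h1 : ∀ l, pfL Q (a :: l) = 0 := by
    intro l
    rw [pfL_cons, show Q a = fun b => 0 * Q a b by funext b; simp [h b], iota_mul_left, zero_mul]
  rw [pfT, h1, iota_cons, he, iota_congr e (H := fun _ => 0) fun m _ => h1 m, iota_zero]
  ring

/-- The effect on the completed Pfaffian of a twisted derivation. -/
theorem derivation_pfT {σ : R →+* R} {D : R → R} {x : R} {d : ℕ → R} {Q : ℕ → ℕ → R} {e : ℕ → R}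
    (hadd : ∀ f g, D (f + g) = D f + D g) (hsub : ∀ f g, D (f - g) = D f - D g)
    (hmul : ∀ f g, D (f * g) = D f * g + σ f * D g) (h0 : D 0 = 0) (h1 : D 1 = 0)
    (hσ : ∀ f, σ f = f - x * D f) (hd : ∀ a, D (e a) = d a)
    (hQ : ∀ a b, D (Q a b) = d a * e b - e a * d b) (l : List ℕ) :
    D (pfT Q e l) = iota d (pfT Q e) l := by
  -- The twist contributes a term quadratic in D. In both uses it vanishes, by a repeated
  -- contraction along d or, after anticommuting, along e.
  have hι : ∀ (φ : ℕ → R) (G : List ℕ → R) (l : List ℕ), D (iota φ G l) =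
      iota (fun a => D (φ a)) G l + iota φ (fun m => D (G m)) l -
        x * iota (fun a => D (φ a)) (fun m => D (G m)) l := by
    intro φ G l
    induction l generalizing G with
    | nil => simp [iota_nil, h0]
    | cons a l ih =>
      rw [iota_cons, hsub, hmul, ih, hσ]
      simp only [iota_cons]
      ring
  have e8 : ∀ l, iota e (iota d (iota e (pfL Q))) l = 0 := by
    intro l
    rw [show iota d (iota e (pfL Q)) = fun m => -iota e (iota d (pfL Q)) m from
      funext fun m => iota_iota _ _ _ _, iota_neg, iota_iota_self, neg_zero]
  have hP : ∀ l, D (pfL Q l) = iota d (iota e (pfL Q)) l := by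
    intro l
    induction hk : l.length using Nat.strong_induction_on generalizing l with
    | _ k ih =>
      cases l with
      | nil => rw [pfL_nil, h1]; rfl
      | cons a l =>
        rw [List.length_cons] at hk
        have e1 : ∀ φ : ℕ → R, iota φ (fun m => D (pfL Q m)) l =
            iota φ (iota d (iota e (pfL Q))) l := fun φ =>
          iota_congr φ fun m hm => ih _ (by omega) m rfl
        have e2 : (fun b => D (Q a b)) = fun b => d a * e b - e a * d b := funext (hQ a)
        rw [pfL_cons, hι, e1, e1, e2, iota_iota_pfL_cons, iota_sub_left, iota_mul_left,
          iota_mul_left, iota_sub_left, iota_mul_left, iota_mul_left, iota_iota_self d, e8]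
        ring
  have e4 : (fun m => D (pfL Q m)) = iota d (iota e (pfL Q)) := funext hP
  have e5 : (fun a => D (e a)) = d := funext hd
  have e7 : iota d (pfT Q e) l = iota d (pfL Q) l + iota d (iota e (pfL Q)) l := iota_add _ _ _ _
  rw [pfT, hadd, hP, hι, e4, e5, iota_iota_self d, e7, e8]
  ring

end Contraction

end SympSchubert

end

noncomputable section

namespace SympSchubert

open MvPolynomial

/-! ### Elementary symmetric polynomials and `Q̃` -/

section Elementary

variable {n : ℕ}

variable (n) in
/-- The elementary symmetric polynomials. -/
abbrev es (a : ℕ) : MvPolynomial (Fin n) ℤ := esymm (Fin n) ℤ a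

variable (n) in
/-- The polynomials `∂_0 e_a`. -/
def des (a : ℕ) : MvPolynomial (Fin n) ℤ := DD n ℤ 0 (es n a)

theorem es_zero : es n 0 = 1 := esymm_zero _ _

theorem es_of_gt {a : ℕ} (h : n < a) : es n a = 0 := by
  rw [es, esymm, Finset.powersetCard_eq_empty.2 (by simpa using h), Finset.sum_empty]

theorem act_s_eq_rename {i : Fin n} (hi : i.val ≠ 0) (f : MvPolynomial (Fin n) ℤ) :
    act (s i) f = rename (Equiv.swap (pre i) i) f := by
  have : act (A := ℤ) (s i) = rename (Equiv.swap (pre i) i) := by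
    ext j : 1
    rw [act_s_X_pos hi, rename_X]
  rw [this]

theorem sg_es (k a : ℕ) (hk : k ≠ 0) : sg n ℤ k (es n a) = es n a := by
  rcases lt_or_ge k n with h | h
  · rw [show sg n ℤ k = act (s ⟨k, h⟩) from sg_fin ⟨k, h⟩, act_s_eq_rename hk, rename_esymm]
  · exact sg_of_le h _

/-- The f a are the elementary symmetric polynomials in the variables other than x_0, hence fixed by
s_0. Consequently ∂_0 e_{a+1} is f a. -/
theorem exists_es_decomp (h : 0 < n) : ∃ f : ℕ → MvPolynomial (Fin n) ℤ,
    (∀ a, sg n ℤ 0 (f a) = f a) ∧ f 0 = 1 ∧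
      ∀ a, es n (a + 1) = f (a + 1) + xv n ℤ 0 * f a := by
  classical
  let z : Fin n := ⟨0, h⟩
  let t : Multiset (MvPolynomial (Fin n) ℤ) := (Finset.univ.erase z).val.map X
  have ht : Finset.univ.val.map X = X z ::ₘ t := by
    rw [← Finset.insert_erase (Finset.mem_univ z),
      Finset.insert_val_of_notMem (Finset.notMem_erase z _), Multiset.map_cons]
  refine ⟨t.esymm, fun a => ?_, ?_, fun a => ?_⟩
  · rw [Finset.esymm_map_val, map_sum]
    refine Finset.sum_congr rfl fun u hu => ?_
    rw [map_prod]
    refine Finset.prod_congr rfl fun i hi => ?_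
    have hz : i ≠ z := fun h' => by
      have := (Finset.mem_powersetCard.1 hu).1 hi
      rw [h'] at this
      exact Finset.notMem_erase z _ this
    have := sg_zero_xv_of_ne (n := n) (A := ℤ) (j := i) fun h' => hz (Fin.ext h')
    rwa [xv_of_lt i.2] at this
  · simp [Multiset.esymm]
  · rw [es, esymm_eq_multiset_esymm, ht, xv_of_lt h]
    simp only [Multiset.esymm, Multiset.powersetCard_cons, Multiset.map_add, Multiset.sum_add,
      Multiset.map_map, Function.comp_def, Multiset.prod_cons, Multiset.sum_map_mul_left]
    rfl

theorem des_zero : des n 0 = 0 := by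
  rw [des, es, esymm_zero]
  exact DD_of_inv (map_one _)

theorem des_succ (h : 0 < n) (a : ℕ) : des n (a + 1) = es n a - xv n ℤ 0 * des n a := by
  obtain ⟨f, hf, hf0, hfs⟩ := exists_es_decomp h
  have key : ∀ a, des n (a + 1) = f a := by
    intro a
    rw [des, hfs, DD_add, DD_of_inv (hf _), DD_mul_of_inv' (hf a), DD_xv h]
    ring
  rw [key]
  cases a with
  | zero => rw [des_zero, hf0, es, esymm_zero]; ring
  | succ a => rw [key, hfs]; ring

theorem des_of_gt {a : ℕ} (h : n < a) : des n a = 0 := by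
  rw [des, es_of_gt h, DD_zero]

theorem Qpair_zero (a : ℕ) : Qpair n a 0 = es n a := by simp [Qpair]

theorem Qpair_succ (a b : ℕ) :
    Qpair n a (b + 1) + Qpair n (a + 1) b = es n a * es n (b + 1) - es n (a + 1) * es n b := by
  have h : ∑ k ∈ Finset.Icc 1 (b + 1),
      (-1 : MvPolynomial (Fin n) ℤ) ^ k * esymm (Fin n) ℤ (a + k) * esymm (Fin n) ℤ (b + 1 - k) =
        -(esymm (Fin n) ℤ (a + 1) * esymm (Fin n) ℤ b) - ∑ k ∈ Finset.Icc 1 b,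
          (-1) ^ k * esymm (Fin n) ℤ (a + 1 + k) * esymm (Fin n) ℤ (b - k) := by
    have e1 : Finset.Icc 1 (b + 1) = Finset.Ico 1 (b + 2) := by ext; simp only [Finset.mem_Icc, Finset.mem_Ico]; omega
    have e2 : Finset.Icc 1 b = Finset.Ico 1 (b + 1) := by ext; simp only [Finset.mem_Icc, Finset.mem_Ico]; omega
    rw [e1, e2, Finset.sum_eq_sum_Ico_succ_bot (by omega), ← Finset.sum_Ico_add' _ 1 (b + 1) 1,
      sub_eq_add_neg, ← Finset.sum_neg_distrib]
    congr 1
    · simp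
    · refine Finset.sum_congr rfl fun k hk => ?_
      rw [show a + (k + 1) = a + 1 + k by ring, show b + 1 - (k + 1) = b - k by omega]
      ring
  rw [Qpair, Qpair, h]
  ring

theorem sg_zero_eq (f : MvPolynomial (Fin n) ℤ) (h : 0 < n) :
    sg n ℤ 0 f = f - 2 * xv n ℤ 0 * DD n ℤ 0 f := by rw [sg_eq, rt_zero h]

theorem DD_zero_es_mul (h : 0 < n) (a b : ℕ) : DD n ℤ 0 (es n a * es n b) =
    des n a * es n b - es n a * des n b + 2 * des n (a + 1) * des n b := by
  rw [DD_mul, sg_zero_eq _ h, des_succ h a]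
  simp only [des]
  ring

/-- In the recursion for Q̃_{a,b} the twist terms of the two products combine with the induction
hypothesis, leaving an alternating expression. This is the form required by `derivation_pfT`, and
for a = b it gives invariance under s_0. -/
theorem DD_zero_Qpair (h : 0 < n) (a b : ℕ) :
    DD n ℤ 0 (Qpair n a b) = des n a * es n b - es n a * des n b := by
  induction b generalizing a with
  | zero => rw [Qpair_zero, des_zero, es_zero, mul_one, mul_zero, sub_zero]; rfl
  | succ b ih =>
    have e : Qpair n a (b + 1) =
        es n a * es n (b + 1) - es n (a + 1) * es n b - Qpair n (a + 1) b := by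
      rw [← Qpair_succ]; ring
    rw [e, DD_sub, DD_sub, DD_zero_es_mul h, DD_zero_es_mul h, ih]
    have h1 := des_succ h (a + 1)
    have h2 := des_succ h b
    rw [h1, h2]
    ring

variable (n) in
/-- The Pfaffian defining `Q̃` along a list of parts. -/
def QT (l : List ℕ) : MvPolynomial (Fin n) ℤ := pfT (Qpair n) (es n) l

theorem DD_zero_QT (h : 0 < n) (l : List ℕ) : DD n ℤ 0 (QT n l) = iota (des n) (QT n) l := by
  refine derivation_pfT (σ := (sg n ℤ 0).toRingHom) (x := 2 * xv n ℤ 0) (DD_add 0) (DD_sub 0)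
    (DD_mul 0) (DD_zero 0) (DD_of_inv (map_one _)) (fun f => sg_zero_eq f h) (fun _ => rfl)
    (DD_zero_Qpair h) l

theorem map_pfT {R S : Type*} [CommRing R] [CommRing S] (φ : R →+* S) (Q : ℕ → ℕ → R) (e : ℕ → R)
    (l : List ℕ) : φ (pfT Q e l) = pfT (fun a b => φ (Q a b)) (fun a => φ (e a)) l := by
  have hι : ∀ (ψ : ℕ → R) (G : List ℕ → R) (l : List ℕ),
      φ (iota ψ G l) = iota (fun a => φ (ψ a)) (fun m => φ (G m)) l := by
    intro ψ G l
    induction l generalizing G with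
    | nil => simp [iota_nil]
    | cons a l ih => rw [iota_cons, map_sub, map_mul, ih, iota_cons]
  have hP : ∀ l, φ (pfL Q l) = pfL (fun a b => φ (Q a b)) l := by
    intro l
    induction hk : l.length using Nat.strong_induction_on generalizing l with
    | _ k ih =>
      cases l with
      | nil => exact map_one φ
      | cons a l =>
        rw [List.length_cons] at hk
        rw [pfL_cons, pfL_cons, hι]
        exact iota_congr _ fun m hm => ih _ (by omega) m rfl
  rw [pfT, pfT, map_add, hP, hι]
  congr 1
  exact iota_congr _ fun m _ => hP m

theorem map_Qpair_of_fix {φ : MvPolynomial (Fin n) ℤ →+* MvPolynomial (Fin n) ℤ}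
    (h : ∀ a, φ (es n a) = es n a) (a b : ℕ) : φ (Qpair n a b) = Qpair n a b := by
  simp only [es] at h
  simp only [Qpair, map_add, map_mul, map_ofNat, map_sum, map_pow, map_neg, map_one, h]

theorem map_QT_of_fix {φ : MvPolynomial (Fin n) ℤ →+* MvPolynomial (Fin n) ℤ}
    (h : ∀ a, φ (es n a) = es n a) (l : List ℕ) : φ (QT n l) = QT n l := by
  rw [QT, map_pfT]
  simp only [map_Qpair_of_fix h, h]

theorem sg_QT {k : ℕ} (hk : k ≠ 0) (l : List ℕ) : sg n ℤ k (QT n l) = QT n l :=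
  map_QT_of_fix (φ := (sg n ℤ k).toRingHom) (fun a => sg_es k a hk) l

theorem symTo_QT (m : ℕ) (l : List ℕ) : SymTo m (QT n l) := fun _ h _ => sg_QT (by omega) l

/-- The Q̃_{b,b} are the nontrivial coefficients in the Pieri rule; their invariance lets the rule
be transported by group elements. -/
theorem sg_Qpair_self (k b : ℕ) : sg n ℤ k (Qpair n b b) = Qpair n b b := by
  cases k with
  | zero =>
    rcases Nat.eq_zero_or_pos n with rfl | h
    · exact sg_of_le le_rfl _
    · rw [← DD_eq_zero_iff, DD_zero_Qpair h]; ring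
  | succ k =>
    exact map_Qpair_of_fix (φ := (sg n ℤ (k + 1)).toRingHom)
      (fun a => sg_es (k + 1) a (by omega)) b b

/-! ### Removing a part by divided differences -/

theorem neg_xv_pow_mul_des (h : 0 < n) (j a : ℕ) : (-xv n ℤ 0) ^ j * des n a =
    des n (a + j) - ∑ i ∈ Finset.range j, (-xv n ℤ 0) ^ (j - 1 - i) * es n (a + i) := by
  induction j with
  | zero => simp
  | succ j ih =>
    have e : ∑ i ∈ Finset.range j, (-xv n ℤ 0) ^ (j + 1 - 1 - i) * es n (a + i) =
        -xv n ℤ 0 * ∑ i ∈ Finset.range j, (-xv n ℤ 0) ^ (j - 1 - i) * es n (a + i) := by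
      rw [Finset.mul_sum]
      refine Finset.sum_congr rfl fun i hi => ?_
      rw [Finset.mem_range] at hi
      rw [show j + 1 - 1 - i = j - 1 - i + 1 by omega]
      ring
    rw [pow_succ', mul_assoc, ih, Finset.sum_range_succ, e, show a + (j + 1) = a + j + 1 by ring,
      des_succ h, show j + 1 - 1 - j = 0 by omega]
    ring

theorem des_eq_sum (h : 0 < n) (a : ℕ) :
    des n a = ∑ i ∈ Finset.range a, (-xv n ℤ 0) ^ (a - 1 - i) * es n i := by
  have := neg_xv_pow_mul_des h a 0
  rw [des_zero, mul_zero, zero_add] at this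
  simp only [zero_add] at this
  linear_combination -this

theorem DL_sweepW_pow_mul_es {b : ℕ} (hb : b < n) (a : ℕ) :
    DL n ℤ (sweepW 0 (n - 1)) ((-xv n ℤ 0) ^ b * es n a) = if b = n - 1 then es n a else 0 := by
  have h1 : ∀ k ∈ sweepW 0 (n - 1), sg n ℤ k (es n a) = es n a := by
    intro k hk
    rw [mem_sweepW] at hk
    exact sg_es k a (by omega)
  rw [DL_mul_of_inv' h1, neg_pow, DL_neg_one_pow_mul, DL_sweepW_pow (by omega) (by omega)]
  split_ifs with h2
  · rw [h2, ← mul_pow]; simp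
  · ring

/-- Among powers of x_0 below the n-th, the sweep detects only x_0^{n-1}. Rewriting the product as
∂_0 e_{a+j} plus powers below n - 1, and expanding ∂_0 e_{a+j} in powers of x_0, this exponent
occurs only with e_0 and only when a + j = n; beyond n the derivative is zero. -/
theorem DL_sweepW_pow_mul_des {j a : ℕ} (hj : j < n) :
    DL n ℤ (sweepW 0 (n - 1)) ((-xv n ℤ 0) ^ j * des n a) = if a + j = n then 1 else 0 := by
  have h : 0 < n := by omega
  rw [neg_xv_pow_mul_des h, DL_sub, DL_sum, Finset.sum_eq_zero (s := Finset.range j), sub_zero]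
  · by_cases h1 : n < a + j
    · rw [des_of_gt h1, DL_zero, if_neg (by omega)]
    · rw [des_eq_sum h, DL_sum]
      split_ifs with h2
      · rw [Finset.sum_eq_single 0, DL_sweepW_pow_mul_es (by omega), if_pos (by omega), es,
          esymm_zero]
        · intro i hi h0
          rw [Finset.mem_range] at hi
          rw [DL_sweepW_pow_mul_es (by omega), if_neg (by omega)]
        · intro h0
          rw [Finset.mem_range] at h0
          omega
      · refine Finset.sum_eq_zero fun i hi => ?_
        rw [Finset.mem_range] at hi
        rw [DL_sweepW_pow_mul_es (by omega), if_neg (by omega)]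
  · intro i hi
    rw [Finset.mem_range] at hi
    rw [DL_sweepW_pow_mul_es (by omega), if_neg (by omega)]

/-- The full cycle applied to x_0^j Q̃ deletes the part n - j. By `DD_zero_QT`, ∂_0 acts on the
Pfaffian as contraction with ∂_0 e; the symmetric coefficients pass through the sweep, which turns
that contraction into one with a delta function. The Leibniz term that differentiates x_0^j has too
low a degree in x_0 to survive. -/
theorem DL_cycW_QT {j : ℕ} (hj : j < n) (l : List ℕ) :
    DL n ℤ (cycW (n - 1)) (xv n ℤ 0 ^ j * QT n l) =
      iota (fun a => if a + j = n then 1 else 0) (QT n) l := by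
  have h : 0 < n := by omega
  have hι : ∀ (c : MvPolynomial (Fin n) ℤ) (φ : ℕ → MvPolynomial (Fin n) ℤ)
      (G : List ℕ → MvPolynomial (Fin n) ℤ) (l : List ℕ),
      (∀ m, ∀ k ∈ sweepW 0 (n - 1), sg n ℤ k (G m) = G m) →
      DL n ℤ (sweepW 0 (n - 1)) (c * iota φ G l) =
        iota (fun a => DL n ℤ (sweepW 0 (n - 1)) (c * φ a)) G l := by
    intro c φ G l hG
    induction l generalizing G with
    | nil => rw [iota_nil, iota_nil, mul_zero, DL_zero]
    | cons a l ih =>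
      rw [iota_cons, iota_cons, mul_sub, DL_sub, ih _ fun m => hG _, ← mul_assoc,
        DL_mul_of_inv' (hG l)]
  have hs : ∀ m, ∀ k ∈ sweepW 0 (n - 1), sg n ℤ k (QT n m) = QT n m := by
    intro m k hk
    rw [mem_sweepW] at hk
    exact sg_QT (by omega) m
  have h0 : ∀ b < n, ∀ b' < b, DL n ℤ (sweepW 0 (n - 1)) ((-xv n ℤ 0) ^ b' * QT n l) = 0 := by
    intro b hb b' hb'
    rw [DL_mul_of_inv' (hs l), neg_pow, DL_neg_one_pow_mul, DL_sweepW_pow (by omega) (by omega),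
      if_neg (by omega), mul_zero, zero_mul]
  have h1 : DD n ℤ 0 (xv n ℤ 0 ^ j * QT n l) =
      DD n ℤ 0 (xv n ℤ 0 ^ j) * QT n l + (-xv n ℤ 0) ^ j * iota (des n) (QT n) l := by
    rw [DD_mul, DD_zero_QT h, map_pow, sg_zero_xv h]
  have h2 : DL n ℤ (sweepW 0 (n - 1)) (DD n ℤ 0 (xv n ℤ 0 ^ j) * QT n l) = 0 := by
    rcases Nat.even_or_odd j with he | ho
    · rw [DD_of_inv, zero_mul, DL_zero]
      rw [map_pow, sg_zero_xv h, he.neg_pow]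
    · obtain ⟨i, rfl⟩ := ho
      have : DD n ℤ 0 (xv n ℤ 0 ^ (2 * i + 1)) = (-xv n ℤ 0) ^ (2 * i) := by
        rw [pow_succ, DD_mul_of_inv, DD_xv h, mul_one, (even_two_mul i).neg_pow]
        rw [map_pow, sg_zero_xv h, (even_two_mul i).neg_pow]
      rw [this, h0 (2 * i + 1) hj _ (by omega)]
  rw [DL_cycW, h1, DL_add, h2, zero_add, hι _ _ _ _ hs]
  congr 1
  funext a
  exact DL_sweepW_pow_mul_des hj

end Elementary

end SympSchubert

end

noncomputable section

namespace SympSchubert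

open MvPolynomial

/-! ### Lists of parts -/

section Parts

variable {n : ℕ}

/-- The index `i` belongs to the strict partition. -/
def memN (lam : StrictPart n) (i : ℕ) : Prop := ∃ h : i < n, (⟨i, h⟩ : Fin n) ∈ lam

instance (lam : StrictPart n) (i : ℕ) : Decidable (memN lam i) :=
  inferInstanceAs (Decidable (∃ _, _))

theorem memN_compl {lam : StrictPart n} {i : ℕ} (h : i < n) : memN lamᶜ i ↔ ¬memN lam i := by
  simp [memN, h]

/-- The parts with index in `[k, m)`, in decreasing order. -/
def hi (lam : StrictPart n) (k : ℕ) : ℕ → List ℕ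
  | 0 => []
  | m + 1 => if k ≤ m ∧ memN lam m then (m + 1) :: hi lam k m else hi lam k m

theorem hi_of_le {lam : StrictPart n} {k m : ℕ} (h : m ≤ k) : hi lam k m = [] := by
  induction m with
  | zero => rfl
  | succ m ih => rw [hi, if_neg (by omega), ih (by omega)]

theorem mem_hi {lam : StrictPart n} {k m a : ℕ} :
    a ∈ hi lam k m ↔ ∃ i, a = i + 1 ∧ k ≤ i ∧ i < m ∧ memN lam i := by
  induction m with
  | zero => simp [hi]
  | succ m ih =>
    rw [hi]
    split_ifs with h
    · rw [List.mem_cons, ih]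
      constructor
      · rintro (rfl | ⟨i, h1, h2, h3, h4⟩)
        · exact ⟨m, rfl, h.1, by omega, h.2⟩
        · exact ⟨i, h1, h2, by omega, h4⟩
      · rintro ⟨i, h1, h2, h3, h4⟩
        rcases Nat.lt_succ_iff_lt_or_eq.1 h3 with h3 | rfl
        · exact Or.inr ⟨i, h1, h2, h3, h4⟩
        · exact Or.inl h1
    · rw [ih]
      constructor
      · rintro ⟨i, h1, h2, h3, h4⟩
        exact ⟨i, h1, h2, by omega, h4⟩
      · rintro ⟨i, h1, h2, h3, h4⟩
        refine ⟨i, h1, h2, ?_, h4⟩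
        rcases Nat.lt_succ_iff_lt_or_eq.1 h3 with h3 | rfl
        · exact h3
        · exact absurd ⟨h2, h4⟩ h

theorem hi_append {lam : StrictPart n} {j k m : ℕ} (h1 : j ≤ k) (h2 : k ≤ m) :
    hi lam j m = hi lam k m ++ hi lam j k := by
  induction m, h2 using Nat.le_induction with
  | base => rw [hi_of_le le_rfl, List.nil_append]
  | succ m hm ih =>
    rw [hi, hi, ih]
    by_cases h : memN lam m
    · rw [if_pos ⟨h1.trans hm, h⟩, if_pos ⟨hm, h⟩, List.cons_append]
    · rw [if_neg fun h' => h h'.2, if_neg fun h' => h h'.2]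

theorem hi_congr {lam mu : StrictPart n} {k m : ℕ}
    (h : ∀ i, k ≤ i → i < m → (memN lam i ↔ memN mu i)) : hi lam k m = hi mu k m := by
  induction m with
  | zero => rfl
  | succ m ih =>
    rw [hi, hi, ih fun i h1 h2 => h i h1 (by omega)]
    by_cases hk : k ≤ m
    · simp only [hk, true_and, h m hk (by omega)]
    · rw [if_neg fun h' => hk h'.1, if_neg fun h' => hk h'.1]

theorem hi_self_succ (lam : StrictPart n) (k : ℕ) :
    hi lam k (k + 1) = if memN lam k then [k + 1] else [] := by
  simp [hi, hi_of_le]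

theorem hi_pairwise (lam : StrictPart n) (k m : ℕ) : (hi lam k m).Pairwise (· > ·) := by
  induction m with
  | zero => exact List.Pairwise.nil
  | succ m ih =>
    rw [hi]
    split_ifs
    · refine List.Pairwise.cons (fun a ha => ?_) ih
      obtain ⟨i, rfl, _, h, _⟩ := mem_hi.1 ha
      change _ < _
      omega
    · exact ih

theorem map_sort_ge (lam : StrictPart n) :
    (lam.sort (· ≥ ·)).map (fun j : Fin n => j.val + 1) = hi lam 0 n := by
  have h1 : ((lam.sort (· ≥ ·)).map (fun j : Fin n => j.val + 1)).Pairwise (· > ·) := by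
    rw [List.pairwise_map]
    refine (Finset.sortedGT_sort lam).pairwise.imp fun {a b} h => ?_
    have : b.val < a.val := h
    change _ < _
    omega
  refine List.Perm.eq_of_pairwise (le := (· > ·)) ?_ h1 (hi_pairwise lam 0 n) ?_
  · intro a b _ _ h h'
    exact absurd h (lt_asymm h')
  · refine (List.perm_ext_iff_of_nodup (h1.imp fun h => ne_of_gt h)
      ((hi_pairwise lam 0 n).imp fun h => ne_of_gt h)).2 fun a => ?_
    rw [mem_hi, List.mem_map]
    constructor
    · rintro ⟨j, hj, rfl⟩
      exact ⟨j, rfl, by omega, j.2, j.2, (Finset.mem_sort _).1 hj⟩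
    · rintro ⟨i, rfl, _, _, h, h'⟩
      exact ⟨⟨i, h⟩, (Finset.mem_sort _).2 h', rfl⟩

theorem map_sort_le (lam : StrictPart n) :
    (lam.sort (· ≤ ·)).map (fun j : Fin n => j.val + 1) = (hi lam 0 n).reverse := by
  rw [← map_sort_ge, ← List.map_reverse]
  congr 1
  refine List.Perm.eq_of_pairwise (le := (· < ·)) ?_ (Finset.sortedLT_sort lam).pairwise ?_ ?_
  · intro a b _ _ h h'
    exact absurd h (lt_asymm h')
  · rw [List.pairwise_reverse]
    exact (Finset.sortedGT_sort lam).pairwise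
  · refine (List.perm_ext_iff_of_nodup (Finset.sort_nodup _ _) ?_).2 fun a => ?_
    · rw [List.nodup_reverse]; exact Finset.sort_nodup _ _
    · simp

/-! ### `Q̃_λ` as a Pfaffian along the list of parts -/

theorem iota_eq_sum {R : Type*} [CommRing R] (φ : ℕ → R) (G : List ℕ → R) (l : List ℕ) :
    iota φ G l = ∑ j : Fin l.length, (-1) ^ j.val * φ (l.getD j 0) * G (l.eraseIdx j) := by
  induction l generalizing G with
  | nil => simp [iota_nil]
  | cons a l ih =>
    rw [iota_cons, ih]
    change _ = ∑ j : Fin (l.length + 1), _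
    rw [Fin.sum_univ_succ, sub_eq_add_neg, ← Finset.sum_neg_distrib]
    congr 1
    · simp
    · refine Finset.sum_congr rfl fun j _ => ?_
      simp only [Fin.val_succ, List.getD_cons_succ, List.eraseIdx_cons_succ]
      ring

theorem getD_eraseIdx {r : ℕ} (l : List ℕ) (j : Fin (r + 1)) (p : Fin r) :
    (l.eraseIdx j).getD p 0 = l.getD (j.succAbove p) 0 := by
  rw [List.getD_eq_getElem?_getD, List.getD_eq_getElem?_getD, List.getElem?_eraseIdx]
  congr 1
  split_ifs with h
  · rw [Fin.succAbove_of_castSucc_lt]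
    · rfl
    · exact h
  · rw [Fin.succAbove_of_le_castSucc]
    · rfl
    · exact not_lt.1 h

theorem pfaffian_eq_pfL {R : Type*} [CommRing R] (Q : ℕ → ℕ → R) (r : ℕ) (l : List ℕ)
    (h : l.length = r) :
    pfaffian r (fun i j => Q (l.getD i 0) (l.getD j 0)) = pfL Q l := by
  induction r using Nat.strong_induction_on generalizing l with
  | _ r ih =>
    match r, l, h with
    | 0, [], _ => rfl
    | 1, [a], _ => rw [pfL_cons]; rfl
    | r + 2, a :: l, h =>
      have hl : l.length = r + 1 := by simpa using h
      rw [pfL_cons, iota_eq_sum, pfaffian]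
      refine Finset.sum_equiv (finCongr hl.symm) (by simp) fun j _ => ?_
      congr 1
      change _ = pfL Q (l.eraseIdx j)
      rw [← ih r (by omega) (l.eraseIdx j) (by
        rw [List.length_eraseIdx_of_lt (by omega)]; omega)]
      congr 1
      funext p q
      rw [getD_eraseIdx, getD_eraseIdx]
      rfl

/-- For an odd number of parts the added part 0 forms a last column with entries Q̃_{a,0} = e_a, and
expanding along it gives the completing contraction of `pfT`. -/
theorem Qtilde_eq_QT (lam : StrictPart n) : Qtilde lam = QT n (hi lam 0 n) := by
  set L := hi lam 0 n with hL
  have hlen : L.length = lam.card := by rw [hL, ← map_sort_ge]; simp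
  have hp : ∀ i, part lam i = L.getD i 0 := fun i => by rw [part, map_sort_ge]
  rcases Nat.mod_two_eq_zero_or_one lam.card with h | h
  · rw [QT, pfT_of_even _ _ (by omega), ← pfaffian_eq_pfL _ (lam.card + lam.card % 2) _ (by omega)]
    simp only [Qtilde, hp]
  · have e : (fun a => Qpair n a 0) = es n := funext Qpair_zero
    have hd : ∀ k, (L ++ [0]).getD k 0 = L.getD k 0 := by
      intro k
      rcases lt_or_ge k L.length with hk | hk
      · rw [List.getD_append _ _ _ _ hk]
      · rw [List.getD_append_right _ _ _ _ hk, List.getD_eq_default _ _ hk]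
        cases k - L.length <;> rfl
    have h1 : (L ++ [0]).length = lam.card + lam.card % 2 := by
      rw [List.length_append, hlen, h]; rfl
    have h2 := pfaffian_eq_pfL (Qpair n) _ _ h1
    simp only [hd] at h2
    rw [QT, pfT_of_odd _ _ (by omega), ← e, ← pfL_append_singleton _ 0 _ (by omega), ← h2]
    simp only [Qtilde, hp]

/-! ### Contraction with a delta function -/

theorem iota_delta_of_notMem {R : Type*} [CommRing R] {φ : ℕ → R} (G : List ℕ → R) {l : List ℕ}
    (h : ∀ a ∈ l, φ a = 0) : iota φ G l = 0 := by
  induction l generalizing G with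
  | nil => rfl
  | cons a l ih =>
    rw [iota_cons, h a List.mem_cons_self, ih _ fun b hb => h b (List.mem_cons_of_mem _ hb)]
    ring

theorem iota_delta_append {R : Type*} [CommRing R] {φ : ℕ → R} (G : List ℕ → R) {a : ℕ}
    {l₁ l₂ : List ℕ} (ha : φ a = 1) (h1 : ∀ b ∈ l₁, φ b = 0) (h2 : ∀ b ∈ l₂, φ b = 0) :
    iota φ G (l₁ ++ a :: l₂) = (-1) ^ l₁.length * G (l₁ ++ l₂) := by
  induction l₁ generalizing G with
  | nil => simp [iota_cons, ha, iota_delta_of_notMem _ h2]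
  | cons b l₁ ih =>
    rw [List.cons_append, iota_cons, ih _ fun c hc => h1 c (List.mem_cons_of_mem _ hc),
      h1 b List.mem_cons_self, List.length_cons, List.cons_append]
    ring

end Parts

end SympSchubert

end

noncomputable section

namespace SympSchubert

open MvPolynomial

/-! ### One-line notation along words -/

section Lines

variable {n : ℕ}

theorem oneLine_injective {u v : W n} (h : ∀ k < n, oneLine u k = oneLine v k) : u = v := by
  have hr : u.right = v.right := by
    ext i
    have h1 := natAbs_oneLine u i
    have h2 := natAbs_oneLine v i
    rw [h i i.2] at h1
    omega
  refine SemidirectProduct.ext ?_ hr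
  funext j
  obtain ⟨i, rfl⟩ := u.right.surjective j
  have h1 := h i i.2
  rw [oneLine_fin, oneLine_fin, ← hr] at h1
  have h2 : ((u.right i : ℕ) : ℤ) + 1 ≠ 0 := by omega
  exact Units.ext (mul_right_cancel₀ h2 h1)

theorem oneLine_mul_sN_succ (w : W n) {k : ℕ} (h : k + 1 < n) (j : ℕ) :
    oneLine (w * sN n (k + 1)) j = if j = k then oneLine w (k + 1)
      else if j = k + 1 then oneLine w k else oneLine w j := by
  rw [sN, dif_pos h, oneLine_mul_succ w h]

theorem nprod_cons (k : ℕ) (l : List ℕ) : nprod n (k :: l) = sN n k * nprod n l := by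
  simp [nprod]

theorem oneLine_mul_sweep {k t : ℕ} (h : k + t < n) (w : W n) (j : ℕ) :
    oneLine (w * nprod n (sweepW k t)) j = if j = k then oneLine w (k + t)
      else if k < j ∧ j ≤ k + t then oneLine w (j - 1) else oneLine w j := by
  induction t generalizing w with
  | zero =>
    rw [sweepW, nprod_nil, mul_one]
    split_ifs with h1 h2
    · rw [h1]; rfl
    · omega
    · rfl
  | succ t ih =>
    rw [sweepW_succ', nprod_cons, ← mul_assoc, ih (by omega), oneLine_mul_sN_succ _ (by omega),
      oneLine_mul_sN_succ _ (by omega), oneLine_mul_sN_succ _ (by omega)]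
    split_ifs <;> first | rfl | omega | (congr 1; omega)

theorem oneLine_mul_cyc (h : 0 < n) (w : W n) {j : ℕ} (hj : j < n) :
    oneLine (w * nprod n (cycW (n - 1))) j =
      if j = 0 then -oneLine w (n - 1) else oneLine w (j - 1) := by
  rw [cycW, nprod_append, nprod_singleton, ← mul_assoc, sN, dif_pos h, oneLine_mul_zero _ h,
    oneLine_mul_sweep (by omega), oneLine_mul_sweep (by omega)]
  by_cases h1 : j = 0
  · rw [if_pos h1, if_pos h1, if_pos rfl, zero_add]
  · rw [if_neg h1, if_neg h1, if_neg h1, if_pos (by omega)]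

/-- The function takes the values in the list at `i, i + 1, …`. -/
def Seg (u : ℕ → ℤ) : ℕ → List ℤ → Prop
  | _, [] => True
  | i, a :: l => u i = a ∧ Seg u (i + 1) l

theorem seg_append {u : ℕ → ℤ} {i : ℕ} {l m : List ℤ} :
    Seg u i (l ++ m) ↔ Seg u i l ∧ Seg u (i + l.length) m := by
  induction l generalizing i with
  | nil => simp [Seg]
  | cons a l ih =>
    rw [List.cons_append, Seg, Seg, ih, and_assoc, List.length_cons, add_assoc, add_comm 1]

theorem Seg.congr {u v : ℕ → ℤ} {i k : ℕ} {l : List ℤ} (h : Seg u i l)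
    (huv : ∀ j, i ≤ j → j < i + l.length → v (j + k) = u j) : Seg v (i + k) l := by
  induction l generalizing i with
  | nil => trivial
  | cons a l ih =>
    rw [List.length_cons] at huv
    refine ⟨(huv i le_rfl (by omega)).trans h.1, ?_⟩
    have := ih h.2 fun j h1 h2 => huv j (by omega) (by omega)
    rwa [add_right_comm]

theorem seg_of_getElem {u : ℕ → ℤ} {i : ℕ} {l : List ℤ}
    (h : ∀ j (hj : j < l.length), u (i + j) = l[j]) : Seg u i l := by
  induction l generalizing i with
  | nil => trivial
  | cons a l ih =>
    refine ⟨h 0 (by simp), ih fun j hj => ?_⟩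
    have := h (j + 1) (by simpa using hj)
    simpa [add_assoc, add_comm 1] using this

theorem Seg.cyc {w : W n} {l : List ℤ} {c : ℤ} (hl : l.length + 1 = n)
    (h : Seg (oneLine w) 0 (l ++ [c])) :
    Seg (oneLine (w * nprod n (cycW (n - 1)))) 0 (-c :: l) := by
  obtain ⟨h1, h2, -⟩ := seg_append.1 h
  constructor
  · rw [oneLine_mul_cyc (by omega) _ (by omega), if_pos rfl, ← h2]
    congr 2
    omega
  · refine h1.congr (k := 1) fun j _ hj => ?_
    rw [oneLine_mul_cyc (by omega) _ (by omega), if_neg (by omega), Nat.add_sub_cancel]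

/-- One cycle moves the last entry to the front and changes its sign; repeated, it carries the whole
final block to the front in the same order. -/
theorem Seg.cycPow {w : W n} {l m : List ℤ} (hl : l.length + m.length = n)
    (h : Seg (oneLine w) 0 (l ++ m)) :
    Seg (oneLine (w * nprod n (cycWPow (n - 1) m.length))) 0 (m.map (fun c => -c) ++ l) := by
  induction m using List.reverseRecOn generalizing l w with
  | nil => simpa [cycWPow, nprod_nil] using h
  | append_singleton m c ih =>
    rw [List.length_append, List.length_singleton] at hl ⊢
    rw [← List.append_assoc] at h
    have h1 := h.cyc (by rw [List.length_append]; omega)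
    rw [← List.cons_append] at h1
    have h2 := ih (l := -c :: l) (by rw [List.length_cons]; omega) h1
    have hc : ∀ k, cycWPow (n - 1) (k + 1) = cycW (n - 1) ++ cycWPow (n - 1) k := by
      intro k
      induction k with
      | zero => simp [cycWPow]
      | succ k ihk =>
        conv_lhs => rw [cycWPow, ihk, List.append_assoc]
        rfl
    rw [hc, nprod_append, ← mul_assoc, List.map_append]
    simpa using h2

/-- The letters of `λᶜ` in increasing order followed by those of `λ` in decreasing order, all with
index at least `n - r` and barred. -/
def merged (lam : StrictPart n) : ℕ → List ℤ
  | 0 => []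
  | r + 1 => if memN lam (n - (r + 1)) then merged lam r ++ [-(((n - (r + 1) : ℕ) : ℤ) + 1)]
      else -(((n - (r + 1) : ℕ) : ℤ) + 1) :: merged lam r

/-- The barred letters with index at least `n - r`, in order. -/
def barred (n : ℕ) : ℕ → List ℤ
  | 0 => []
  | r + 1 => -(((n - (r + 1) : ℕ) : ℤ) + 1) :: barred n r

theorem length_merged (lam : StrictPart n) (r : ℕ) : (merged lam r).length = r := by
  induction r with
  | zero => rfl
  | succ r ih => rw [merged]; split_ifs <;> simp [ih]

/-- A word sorting `merged lam r`. -/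
def sortW (lam : StrictPart n) : ℕ → ℕ → List ℕ
  | _, 0 => []
  | i, r + 1 => if memN lam (n - (r + 1)) then sortW lam i r ++ sweepW i r
      else sortW lam (i + 1) r

theorem mem_sortW {lam : StrictPart n} {i r j : ℕ} (h : j ∈ sortW lam i r) : i < j ∧ j < i + r := by
  induction r generalizing i with
  | zero => simp [sortW] at h
  | succ r ih =>
    rw [sortW] at h
    split_ifs at h
    · rw [List.mem_append, mem_sweepW] at h
      rcases h with h | h
      · have := ih h; omega
      · omega
    · have := ih h; omega

theorem oneLine_mul_sortW (lam : StrictPart n) {i r : ℕ} (hr : i + r ≤ n) (w : W n) {j : ℕ}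
    (hj : j < i ∨ i + r ≤ j) : oneLine (w * nprod n (sortW lam i r)) j = oneLine w j := by
  induction r generalizing i w with
  | zero => rw [sortW, nprod_nil, mul_one]
  | succ r ih =>
    rw [sortW]
    split_ifs
    · rw [nprod_append, ← mul_assoc, oneLine_mul_sweep (by omega), if_neg (by omega),
        if_neg (by omega), ih (by omega) _ (by omega)]
    · rw [ih (by omega) _ (by omega)]

theorem Seg.sortW {lam : StrictPart n} {i r : ℕ} (hr : i + r ≤ n) {w : W n}
    (h : Seg (oneLine w) i (merged lam r)) :
    Seg (oneLine (w * nprod n (sortW lam i r))) i (barred n r) := by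
  induction r generalizing i w with
  | zero => trivial
  | succ r ih =>
    rw [merged] at h
    rw [SympSchubert.sortW, barred]
    split_ifs at h ⊢ with hm
    · obtain ⟨h1, h2, -⟩ := seg_append.1 h
      rw [length_merged] at h2
      have h3 := ih (by omega) h1
      have hlen : (barred n r).length = r := by
        clear * -
        induction r with
        | zero => rfl
        | succ r ih => rw [barred, List.length_cons, ih]
      rw [nprod_append, ← mul_assoc]
      constructor
      · rw [oneLine_mul_sweep (by omega), if_pos rfl, oneLine_mul_sortW _ (by omega) _ (by omega),
          h2]
      · refine h3.congr (k := 1) fun j h4 h5 => ?_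
        rw [hlen] at h5
        rw [oneLine_mul_sweep (by omega), if_neg (by omega), if_pos (by omega), Nat.add_sub_cancel]
    · refine ⟨?_, ih (by omega) h.2⟩
      rw [oneLine_mul_sortW _ (by omega) _ (by omega), h.1]

theorem oneLine_w0 {j : ℕ} (hj : j < n) : oneLine (w0 n) j = -((j : ℤ) + 1) := by
  simp [oneLine, w0, hj]

theorem eq_w0_of_seg {w : W n} (h : Seg (oneLine w) 0 (barred n n)) : w = w0 n := by
  have key : ∀ r, r ≤ n → Seg (oneLine w) (n - r) (barred n r) →
      ∀ j, n - r ≤ j → j < n → oneLine w j = -((j : ℤ) + 1) := by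
    intro r
    induction r with
    | zero => intro _ _ j h1 h2; omega
    | succ r ih =>
      intro hr hs j h1 h2
      rcases Nat.eq_or_lt_of_le h1 with rfl | h1
      · exact hs.1
      · refine ih (by omega) ?_ j (by omega) h2
        have := hs.2
        rwa [show n - (r + 1) + 1 = n - r by omega] at this
  refine oneLine_injective fun k hk => ?_
  rw [oneLine_w0 hk]
  exact key n le_rfl (by simpa using h) k (by omega) hk

theorem merged_eq (lam : StrictPart n) (r : ℕ) (hr : r ≤ n) :
    merged lam r = (hi lamᶜ (n - r) n).reverse.map (fun a : ℕ => -(a : ℤ)) ++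
      (hi lam (n - r) n).map (fun a : ℕ => -(a : ℤ)) := by
  induction r with
  | zero => simp [merged, hi_of_le]
  | succ r ih =>
    have e : ∀ mu : StrictPart n, hi mu (n - (r + 1)) n =
        hi mu (n - r) n ++ if memN mu (n - (r + 1)) then [n - (r + 1) + 1] else [] := by
      intro mu
      rw [← hi_self_succ, show n - (r + 1) + 1 = n - r by omega]
      exact hi_append (by omega) (by omega)
    rw [merged, ih (by omega), e, e]
    by_cases hm : memN lam (n - (r + 1))
    · rw [if_pos hm, if_pos hm, if_neg (by rw [memN_compl (by omega)]; exact not_not.2 hm)]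
      simp
    · rw [if_neg hm, if_neg hm, if_pos ((memN_compl (by omega)).2 hm)]
      simp

theorem seg_grass (lam : StrictPart n) : Seg (oneLine (grass lam)) 0
    ((hi lam 0 n).map (fun a : ℕ => -(a : ℤ)) ++ (hi lamᶜ 0 n).reverse.map (fun a : ℕ => (a : ℤ))) := by
  have e : (hi lam 0 n).map (fun a : ℕ => -(a : ℤ)) ++
      (hi lamᶜ 0 n).reverse.map (fun a : ℕ => (a : ℤ)) =
      (grassWord lam).map fun j => if j ∈ lam then -((j : ℤ) + 1) else (j : ℤ) + 1 := by
    rw [← map_sort_ge, ← map_sort_le, grassWord, List.map_append, List.map_map, List.map_map]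
    congr 1
    · refine List.map_congr_left fun j hj => ?_
      rw [Finset.mem_sort] at hj
      simp [hj]
    · refine List.map_congr_left fun j hj => ?_
      rw [Finset.mem_sort, Finset.mem_compl] at hj
      simp [hj]
  rw [e]
  refine seg_of_getElem fun j hj => ?_
  rw [List.length_map, ← length_grassWord] at hj
  have h1 : (grass lam).right ⟨j, hj⟩ = (grassWord lam)[j]'(by rwa [← length_grassWord]) := rfl
  rw [zero_add, oneLine, dif_pos hj, h1, List.getElem_map]
  simp only [grass]
  split_ifs <;> simp

/-- The cycles bring the unbarred letters λ' of w_λ to the front and bar them, so all letters are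
barred; sorting the result gives w_0. The word therefore spells w_λ⁻¹ w_0. -/
theorem grass_mul_word (lam : StrictPart n) :
    grass lam * nprod n (cycWPow (n - 1) (hi lamᶜ 0 n).length ++ sortW lam 0 n) = w0 n := by
  have hl : (hi lam 0 n).length + (hi lamᶜ 0 n).length = n := by
    have h1 := congrArg List.length (map_sort_ge lam)
    have h2 := congrArg List.length (map_sort_ge lamᶜ)
    simp only [List.length_map, Finset.length_sort] at h1 h2
    rw [← h1, ← h2, Finset.card_add_card_compl, Fintype.card_fin]
  have h := (seg_grass lam).cycPow (by simpa using hl)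
  rw [List.map_map, List.length_map, List.length_reverse] at h
  rw [nprod_append, ← mul_assoc]
  refine eq_w0_of_seg (Seg.sortW (by omega) ?_)
  rw [merged_eq lam n le_rfl, Nat.sub_self]
  exact h

end Lines

end SympSchubert

end

noncomputable section

namespace SympSchubert

open MvPolynomial

/-! ### Specialising `Y` to zero -/

section Specialise

variable {n : ℕ} {A B : Type*} [CommRing A] [CommRing B]

theorem map_act (φ : A →+* B) (w : W n) (f : MvPolynomial (Fin n) A) :
    MvPolynomial.map φ (act w f) = act w (MvPolynomial.map φ f) := by
  induction f using MvPolynomial.induction_on with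
  | C a => simp [act]
  | add p q hp hq => simp only [map_add, hp, hq]
  | mul_X p i hp => simp only [map_mul, hp, act_X, map_X, map_intCast]

theorem map_root' (φ : A →+* B) (i : Fin n) :
    MvPolynomial.map φ (root' A i) = root' B i := by
  unfold root'
  split_ifs <;> simp

variable [IsDomain A] [CharZero A] [IsDomain B] [CharZero B]

theorem map_dd' (φ : A →+* B) (i : Fin n) (f : MvPolynomial (Fin n) A) :
    MvPolynomial.map φ (dd' i f) = dd' i (MvPolynomial.map φ f) := by
  refine (dd'_unique ?_).symm
  rw [← map_root' φ, ← map_mul, root'_mul_dd', map_sub, map_act]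

theorem map_ddW' (φ : A →+* B) (w : W n) (f : MvPolynomial (Fin n) A) :
    MvPolynomial.map φ (ddW' w f) = ddW' w (MvPolynomial.map φ f) := by
  change MvPolynomial.map φ ((reducedWord w).foldr dd' f) = (reducedWord w).foldr dd' _
  generalize reducedWord w = l
  induction l with
  | nil => rfl
  | cons i l ih => rw [List.foldr_cons, List.foldr_cons, map_dd', ih]

end Specialise

section Single

variable {n : ℕ}

theorem atYZero_inX (f : MvPolynomial (Fin n) ℤ) : atYZero (inX f) = f := by
  rw [atYZero, inX, MvPolynomial.map_map,
    show (constantCoeff : MvPolynomial (Fin n) ℤ →+* ℤ).comp C = RingHom.id ℤ by ext; simp,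
    MvPolynomial.map_id]

theorem atYZero_inY (f : MvPolynomial (Fin n) ℤ) : atYZero (inY f) = C (constantCoeff f) := by
  simp [atYZero, inY]

theorem constantCoeff_es {a : ℕ} (h : a ≠ 0) : constantCoeff (es n a) = 0 := by
  rw [es, esymm, map_sum]
  refine Finset.sum_eq_zero fun t ht => ?_
  rw [map_prod]
  obtain ⟨i, hi⟩ : t.Nonempty := by
    rw [← Finset.card_pos, (Finset.mem_powersetCard.1 ht).2]; omega
  exact Finset.prod_eq_zero hi (by simp)

theorem constantCoeff_Qtilde (lam : StrictPart n) :
    constantCoeff (Qtilde lam) = if lam = ∅ then 1 else 0 := by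
  rw [Qtilde_eq_QT]
  split_ifs with h
  · subst h
    have : hi (∅ : StrictPart n) 0 n = [] := by
      rw [← map_sort_ge]; simp
    rw [this]
    change constantCoeff (pfT _ _ []) = 1
    simp [pfT, pfL_nil, iota_nil]
  · obtain ⟨a, l, hl⟩ : ∃ a l, hi lam 0 n = a :: l := by
      rw [← map_sort_ge]
      refine List.exists_cons_of_ne_nil fun h' => h ?_
      rw [List.map_eq_nil_iff] at h'
      rw [← Finset.sort_toFinset lam (· ≥ ·), h']; rfl
    have ha : a ≠ 0 := by
      have : a ∈ hi lam 0 n := by rw [hl]; exact List.mem_cons_self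
      obtain ⟨i, rfl, -⟩ := mem_hi.1 this
      omega
    rw [hl, QT, map_pfT]
    have he : ∀ b, constantCoeff (esymm (Fin n) ℤ (a + b)) = 0 := fun b =>
      constantCoeff_es (n := n) (by omega)
    refine pfT_cons_of_zero (fun b => ?_) (he 0) _
    have := he 0
    rw [add_zero] at this
    simp only [Qpair, map_add, map_mul, map_sum, he, this]
    simp

/-- The exponents `r - 1, …, 1, 0`. -/
def stairL : ℕ → List ℕ
  | 0 => []
  | r + 1 => r :: stairL r

variable (n) in
/-- The monomial `x_0^{n-1} x_1^{n-2} ⋯ x_{n-2}`. -/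
def xdelta : MvPolynomial (Fin n) ℤ := mono n ℤ 0 (stairL n)

theorem length_stairL (r : ℕ) : (stairL r).length = r := by
  induction r with
  | zero => rfl
  | succ r ih => rw [stairL, List.length_cons, ih]

theorem stair_stairL (r : ℕ) : Stair r (stairL r) := by
  induction r with
  | zero => trivial
  | succ r ih => exact ⟨by omega, by rwa [Nat.add_sub_cancel]⟩

theorem mono_stairL (k r : ℕ) (h : k + r = n) :
    mono n ℤ k (stairL r) = ∏ i ∈ Finset.Ico k n, xv n ℤ i ^ (n - 1 - i) := by
  induction r generalizing k with
  | zero => rw [Finset.Ico_eq_empty (by omega)]; rfl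
  | succ r ih =>
    rw [stairL, mono, ih (k + 1) (by omega), Finset.prod_eq_prod_Ico_succ_bot (a := k) (by omega),
      show n - 1 - k = r by omega]

theorem xdelta_eq_prod : xdelta n = ∏ i : Fin n, X i ^ (n - 1 - i.val) := by
  rw [xdelta, mono_stairL 0 n (by omega), ← Finset.range_eq_Ico, Finset.prod_range]
  refine Finset.prod_congr rfl fun i _ => ?_
  rw [xv_of_lt i.2]

theorem card_filter_add_le (i : Fin n) :
    (Finset.univ.filter fun j : Fin n => (i.val + 1) + (j.val + 1) ≤ n).card = n - 1 - i.val := by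
  conv_rhs => rw [← Finset.card_range (n - 1 - i.val)]
  refine Finset.card_bij (fun j _ => j.val) ?_ (fun _ _ _ _ h => Fin.ext h) ?_
  · intro j hj
    rw [Finset.mem_filter] at hj
    rw [Finset.mem_range]
    omega
  · intro k hk
    rw [Finset.mem_range] at hk
    exact ⟨⟨k, by omega⟩, by simp; omega, rfl⟩

theorem prod_staircase {R : Type*} [CommMonoid R] (f : Fin n → R) :
    ∏ p : Fin n × Fin n with (p.1.val + 1) + (p.2.val + 1) ≤ n, f p.1 =
      ∏ i, f i ^ (n - 1 - i.val) := by
  rw [Finset.prod_filter, Fintype.prod_prod_type]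
  refine Finset.prod_congr rfl fun i _ => ?_
  rw [← Finset.prod_filter, ← card_filter_add_le, ← Finset.prod_const]

theorem atYZero_Delta : atYZero (Delta n) = xdelta n := by
  rw [xdelta_eq_prod, ← prod_staircase, Delta, atYZero, map_prod]
  refine Finset.prod_congr rfl fun p _ => ?_
  rw [map_sub]
  change atYZero _ - atYZero _ = _
  rw [atYZero_inX, atYZero_inY]
  simp

theorem atYZero_QKernel : atYZero (QKernel n) = Qtilde Finset.univ := by
  rw [QKernel, atYZero, map_sum, Finset.sum_eq_single Finset.univ]
  · rw [map_mul]
    change atYZero _ * atYZero _ = _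
    rw [atYZero_inX, atYZero_inY, constantCoeff_Qtilde, if_pos (by simp)]
    simp
  · intro mu _ hmu
    rw [map_mul]
    change atYZero _ * atYZero _ = _
    rw [atYZero_inX, atYZero_inY, constantCoeff_Qtilde, if_neg]
    · simp
    · rwa [Finset.compl_eq_empty_iff]
  · simp

/-- At Y = 0 the product Δ becomes x^δ, and in the kernel only the term with λ' empty survives,
namely Q̃_ρ. -/
theorem CS_eq (w : W n) : CS w =
    (-1) ^ (n * (n - 1) / 2) * ddW' (w⁻¹ * w0 n) (xdelta n * Qtilde Finset.univ) := by
  rw [CS, CC, atYZero, map_mul, map_ddW', map_mul, map_pow, map_neg, map_one]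
  change _ * ddW' _ (atYZero _ * atYZero _) = _
  rw [atYZero_Delta, atYZero_QKernel]

/-! ### The polynomials of maximal Grassmannian elements -/

/-- The exponents `n - 1 - i` for the indices `i ≥ n - r` not in the strict partition. -/
def gaps (lam : StrictPart n) : ℕ → List ℕ
  | 0 => []
  | r + 1 => if memN lam (n - (r + 1)) then gaps lam r else r :: gaps lam r

/-- The sum of `n - 1 - i` over the indices `i ≥ n - r` in the strict partition. -/
def wt (lam : StrictPart n) : ℕ → ℕ
  | 0 => 0
  | r + 1 => if memN lam (n - (r + 1)) then wt lam r + r else wt lam r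

theorem wt_add_wt_compl (lam : StrictPart n) {r : ℕ} (hr : r ≤ n) :
    wt lam r + wt lamᶜ r = r * (r - 1) / 2 := by
  have : wt lam r + wt lamᶜ r = ∑ i ∈ Finset.range r, i := by
    induction r with
    | zero => rfl
    | succ r ih =>
      rw [wt, wt, Finset.sum_range_succ, ← ih (by omega)]
      simp only [memN_compl (lam := lam) (show n - (r + 1) < n by omega)]
      split_ifs <;> omega
  rw [this, Finset.sum_range_id]

theorem stair_gaps (lam : StrictPart n) (r : ℕ) : Stair r (gaps lam r) := by
  induction r with
  | zero => trivial
  | succ r ih =>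
    rw [gaps]
    split_ifs
    · exact ih.of_le (by omega)
    · exact ⟨by omega, by rwa [Nat.add_sub_cancel]⟩

theorem length_gaps (lam : StrictPart n) {r : ℕ} (hr : r ≤ n) :
    (gaps lam r).length = (hi lamᶜ (n - r) n).length := by
  induction r with
  | zero => rw [hi_of_le (by omega)]; rfl
  | succ r ih =>
    have e : hi lamᶜ (n - (r + 1)) n =
        hi lamᶜ (n - r) n ++ if memN lamᶜ (n - (r + 1)) then [n - (r + 1) + 1] else [] := by
      rw [← hi_self_succ, show n - (r + 1) + 1 = n - r by omega]
      exact hi_append (by omega) (by omega)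
    rw [e, gaps]
    simp only [memN_compl (lam := lam) (show n - (r + 1) < n by omega)]
    split_ifs <;> simp [ih (by omega)]

/-- For an index in λ, the sweep replaces x_i^r by (-1)^r and shifts the rest of the monomial onto
x_i; other indices keep their exponent. The exponents left over are the gaps. -/
theorem DL_sortW_mono (lam : StrictPart n) {i r : ℕ} (h : i + r ≤ n) :
    DL n ℤ (sortW lam i r) (mono n ℤ i (stairL r)) =
      (-1) ^ wt lam r * mono n ℤ i (gaps lam r) := by
  induction r generalizing i with
  | zero => simp [sortW, DL_nil, stairL, gaps, wt]
  | succ r ih =>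
    rw [sortW, wt, gaps, stairL, mono]
    split_ifs
    · rw [DL_append, mul_comm, DL_sweepW_mono (by omega) (stair_stairL r),
        DL_sweepW_pow le_rfl (by omega), if_pos rfl, mul_comm, DL_neg_one_pow_mul,
        ih (by omega), pow_add]
      · ring
      · intro j h1 h2
        rw [map_pow, sg_xv_of_ne (by omega) (by omega)]
    · rw [DL_mul_of_inv, ih (by omega), mono]
      · ring
      · intro j hj
        have := mem_sortW hj
        rw [map_pow, sg_xv_of_ne (by omega) (by omega)]

theorem cycIter_mul_neg_one_pow (m : ℕ) (l : List ℕ) (k : ℕ) (f : MvPolynomial (Fin n) ℤ) :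
    cycIter n ℤ m l ((-1) ^ k * f) = (-1) ^ k * cycIter n ℤ m l f := by
  induction l generalizing f with
  | nil => rfl
  | cons a l ih =>
    rw [cycIter, cycIter, mul_left_comm, DL_neg_one_pow_mul, ih]

theorem cycIter_zero (m : ℕ) (l : List ℕ) : cycIter n ℤ m l 0 = 0 := by
  induction l with
  | nil => rfl
  | cons a l ih => rw [cycIter, mul_zero, DL_zero, ih]

theorem memN_univ {i : ℕ} (h : i < n) : memN (Finset.univ : StrictPart n) i :=
  ⟨h, Finset.mem_univ _⟩

theorem length_hi_univ {r : ℕ} (hr : r ≤ n) :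
    (hi (Finset.univ : StrictPart n) (n - r) n).length = r := by
  induction r with
  | zero => rw [hi_of_le (by omega)]; rfl
  | succ r ih =>
    rw [hi_append (k := n - (r + 1) + 1) (by omega) (by omega), hi_self_succ,
      if_pos (memN_univ (by omega)), show n - (r + 1) + 1 = n - r by omega, List.length_append,
      ih (by omega)]
    rfl

/-- The exponent r is present exactly when the part n - r is missing from λ, and its cycle deletes
that part from ρ. At that moment r larger parts precede it, whence the sign (-1)^r collected in `wt
lamᶜ`. -/
theorem cycIter_gaps (lam : StrictPart n) {r : ℕ} (hr : r ≤ n) :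
    cycIter n ℤ (n - 1) (gaps lam r)
      (QT n (hi (Finset.univ : StrictPart n) (n - r) n ++ hi lam 0 (n - r))) =
        (-1) ^ wt lamᶜ r * QT n (hi lam 0 n) := by
  induction r with
  | zero => simp [gaps, cycIter, wt, hi_of_le]
  | succ r ih =>
    have hi' : n - (r + 1) + 1 = n - r := by omega
    have e1 : hi (Finset.univ : StrictPart n) (n - (r + 1)) n =
        hi (Finset.univ : StrictPart n) (n - r) n ++ [n - r] := by
      rw [hi_append (k := n - (r + 1) + 1) (by omega) (by omega), hi_self_succ,
        if_pos (memN_univ (by omega)), hi']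
    have e2 : hi lam 0 (n - r) =
        (if memN lam (n - (r + 1)) then [n - r] else []) ++ hi lam 0 (n - (r + 1)) := by
      rw [hi_append (k := n - (r + 1)) (by omega) (by omega)]
      congr 1
      have := hi_self_succ lam (n - (r + 1))
      rwa [hi'] at this
    rw [gaps, wt, e1]
    simp only [memN_compl (lam := lam) (show n - (r + 1) < n by omega)]
    by_cases hm : memN lam (n - (r + 1))
    · rw [if_pos hm] at e2
      rw [if_pos hm, if_neg (not_not.2 hm), List.append_assoc, ← e2, ih (by omega)]
    · rw [if_neg hm] at e2
      rw [if_neg hm, if_pos hm, cycIter, DL_cycW_QT (by omega), List.append_assoc,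
        List.singleton_append, iota_delta_append, length_hi_univ (by omega),
        cycIter_mul_neg_one_pow, ← List.nil_append (hi lam 0 (n - (r + 1))), ← e2, ih (by omega),
        pow_add]
      · ring
      · rw [if_pos (by omega)]
      · intro b hb
        obtain ⟨i, rfl, h1, -⟩ := mem_hi.1 hb
        rw [if_neg (by omega)]
      · intro b hb
        obtain ⟨i, rfl, -, h1, -⟩ := mem_hi.1 hb
        rw [if_neg (by omega)]

/-- For strictly decreasing parts, the cycle with exponent n - a removes the leading part a, so a
vanishing Pfaffian would force the shorter one to vanish, down to Q̃_∅ = 1. -/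
theorem QT_ne_zero {l : List ℕ} (h : l.Pairwise (· > ·)) (h1 : ∀ a ∈ l, 1 ≤ a ∧ a ≤ n) :
    QT n l ≠ 0 := by
  induction l with
  | nil =>
    change pfT _ _ [] ≠ 0
    simp [pfT, pfL_nil, iota_nil]
  | cons a l ih =>
    have h2 := List.pairwise_cons.1 h
    have ha := h1 a List.mem_cons_self
    have h3 := ih h2.2 fun b hb => h1 b (List.mem_cons_of_mem _ hb)
    intro h0
    have h4 := DL_cycW_QT (n := n) (j := n - a) (by omega) (a :: l)
    rw [h0, mul_zero, DL_zero, iota_cons, if_pos (by omega), iota_delta_of_notMem] at h4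
    · rw [one_mul, sub_zero] at h4
      exact h3 h4.symm
    · intro b hb
      have : b < a := h2.1 b hb
      rw [if_neg (by omega)]

theorem QT_hi_ne_zero (lam : StrictPart n) : QT n (hi lam 0 n) ≠ 0 := by
  refine QT_ne_zero (hi_pairwise lam 0 n) fun a ha => ?_
  obtain ⟨i, rfl, -, h1, -⟩ := mem_hi.1 ha
  omega

/-- The word of `grass_mul_word` is evaluated on x^δ Q̃_ρ by `DL_sortW_mono` and `cycIter_gaps`. The
two signs multiply to (-1)^{n(n-1)/2}, which the normalisation cancels, and nonvanishing of the
result shows that the composite is the operator of w_λ⁻¹ w_0. -/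
theorem CPart_eq_Qtilde (lam : StrictPart n) : CPart lam = Qtilde lam := by
  rcases Nat.eq_zero_or_pos n with rfl | hn
  -- The cycle word uses the index n - 1, which is out of range for n = 0.
  · rw [CPart, CS_eq, show (grass lam)⁻¹ * w0 0 = 1 from oneLine_injective fun k hk => by omega, ddW'_one,
      Subsingleton.elim lam Finset.univ]
    simp [xdelta, stairL, mono]
  · have h1 : (grass lam)⁻¹ * w0 n =
        nprod n (cycWPow (n - 1) (gaps lam n).length ++ sortW lam 0 n) := by
      rw [length_gaps lam le_rfl, Nat.sub_self, ← grass_mul_word, inv_mul_cancel_left]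
    have h2 : DL n ℤ (cycWPow (n - 1) (gaps lam n).length ++ sortW lam 0 n)
        (xdelta n * Qtilde Finset.univ) = (-1) ^ (n * (n - 1) / 2) * QT n (hi lam 0 n) := by
      have h3 := cycIter_gaps lam le_rfl
      rw [Nat.sub_self, hi_of_le (k := 0) (m := 0) le_rfl, List.append_nil] at h3
      rw [Qtilde_eq_QT, DL_append, DL_mul_of_inv', xdelta, DL_sortW_mono lam (by omega), mul_assoc,
        DL_neg_one_pow_mul, DL_cycWPow (by omega) ((stair_gaps lam n).of_le (by omega))
          (symTo_QT _ _), h3, ← mul_assoc, ← pow_add, wt_add_wt_compl lam le_rfl]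
      intro j hj
      have := mem_sortW hj
      exact sg_QT (by omega) _
    have h4 : ((-1 : MvPolynomial (Fin n) ℤ) ^ (n * (n - 1) / 2)) *
        (-1) ^ (n * (n - 1) / 2) = 1 := by rw [← mul_pow]; simp
    rw [CPart, CS_eq, h1, ← DL_eq_ddW'_of_ne_zero (g := xdelta n * Qtilde Finset.univ), h2,
      ← mul_assoc, h4, one_mul, Qtilde_eq_QT]
    rw [h2]
    refine mul_ne_zero (fun h0 => ?_) (QT_hi_ne_zero lam)
    rw [h0, mul_zero] at h4
    exact zero_ne_one h4

end Single

end SympSchubert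

end

noncomputable section

namespace SympSchubert

open MvPolynomial

/-! ### Longest elements -/

section Longest

variable {n : ℕ}

theorem oneLine_w0_mul (u : W n) (j : ℕ) : oneLine (w0 n * u) j = -oneLine u j := by
  unfold oneLine
  split_ifs with h
  · rw [left_mul_apply]
    simp [w0]
  · rfl

theorem desc_w0_mul {u : W n} {i : ℕ} (hi : i < n) : Desc (w0 n * u) i ↔ ¬Desc u i := by
  cases i with
  | zero =>
    have := oneLine_ne_zero u hi
    rw [desc_zero, desc_zero, oneLine_w0_mul]
    omega
  | succ i =>
    have : oneLine u i ≠ oneLine u (i + 1) := fun h => by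
      have := oneLine_natAbs_inj u (by omega) hi (congrArg Int.natAbs h)
      omega
    rw [desc_succ, desc_succ, oneLine_w0_mul, oneLine_w0_mul]
    omega

theorem w0_mul_w0 : w0 n * w0 n = 1 := by
  refine oneLine_injective fun k hk => ?_
  rw [oneLine_w0_mul, oneLine_w0 hk]
  simp [oneLine, hk]

theorem w0_comm (u : W n) : w0 n * u = u * w0 n := by
  refine oneLine_injective fun k hk => ?_
  rw [oneLine_w0_mul]
  unfold oneLine
  rw [dif_pos hk, dif_pos hk, left_mul_apply]
  simp [w0]

theorem oneLine_ofPerm (p : Equiv.Perm (Fin n)) {k : ℕ} (hk : k < n) :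
    oneLine (ofPerm p) k = (p ⟨k, hk⟩ : ℕ) + 1 := by
  simp [oneLine, ofPerm, hk]

theorem ofPerm_mul (p q : Equiv.Perm (Fin n)) : ofPerm (p * q) = ofPerm p * ofPerm q :=
  map_mul SemidirectProduct.inr p q

theorem ofPerm_one : ofPerm (1 : Equiv.Perm (Fin n)) = 1 := map_one SemidirectProduct.inr

theorem ofPerm_inv (p : Equiv.Perm (Fin n)) : ofPerm p⁻¹ = (ofPerm p)⁻¹ :=
  map_inv SemidirectProduct.inr p

theorem eq_ofPerm_of_left {w : W n} (h : w.left = 1) : w = ofPerm w.right :=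
  SemidirectProduct.ext h rfl

theorem revPerm_mul_self : revPerm n * revPerm n = 1 := by
  ext i
  simp [revPerm]

theorem revPerm_inv : (revPerm n)⁻¹ = revPerm n := inv_eq_of_mul_eq_one_left revPerm_mul_self

variable (n) in
/-- The longest element of `S_n` in `W_n`. -/
def zA : W n := ofPerm (revPerm n)

theorem zA_mul_zA : zA n * zA n = 1 := by
  rw [zA, ← ofPerm_mul, revPerm_mul_self, ofPerm_one]

theorem zA_inv : (zA n)⁻¹ = zA n := inv_eq_of_mul_eq_one_left zA_mul_zA

theorem oneLine_zA_mul {u : W n} (hu : u.left = 1) {j : ℕ} (hj : j < n) :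
    oneLine (zA n * u) j = n + 1 - oneLine u j := by
  rw [eq_ofPerm_of_left hu, zA, ← ofPerm_mul, oneLine_ofPerm _ hj, oneLine_ofPerm _ hj,
    Equiv.Perm.mul_apply, revPerm, Fin.revPerm_apply, Fin.val_rev]
  omega

theorem oneLine_pos_of_left {u : W n} (hu : u.left = 1) {j : ℕ} (hj : j < n) :
    0 < oneLine u j := by
  rw [eq_ofPerm_of_left hu, oneLine_ofPerm _ hj]
  omega

theorem ne_zero_of_desc {u : W n} (hu : u.left = 1) {i : Fin n} (h : Desc u i) : i.val ≠ 0 := by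
  intro h0
  rw [h0, desc_zero] at h
  have := oneLine_pos_of_left hu i.pos
  omega

theorem desc_zA_mul {u : W n} (hu : u.left = 1) {i : Fin n} (hi : i.val ≠ 0) :
    Desc (zA n * u) i ↔ ¬Desc u i := by
  obtain ⟨i, hin⟩ := i
  obtain ⟨i, rfl⟩ : ∃ k, i = k + 1 := ⟨i - 1, by simp at hi; omega⟩
  have : oneLine u i ≠ oneLine u (i + 1) := fun h => by
    have := oneLine_natAbs_inj u (by omega) hin (congrArg Int.natAbs h)
    omega
  simp only [desc_succ]
  rw [oneLine_zA_mul hu hin, oneLine_zA_mul hu (by omega)]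
  omega

theorem s_left {i : Fin n} (hi : i.val ≠ 0) : (s i).left = 1 := by simp [s, hi]

theorem left_mul_of_left {u v : W n} (hu : u.left = 1) (hv : v.left = 1) : (u * v).left = 1 := by
  rw [eq_ofPerm_of_left hu, eq_ofPerm_of_left hv, ← ofPerm_mul]; rfl

theorem left_inv_of_left {u : W n} (hu : u.left = 1) : u⁻¹.left = 1 := by
  rw [eq_ofPerm_of_left hu, ← ofPerm_inv]; rfl

theorem exists_desc_inv {v : W n} (hv : v ≠ 1) : ∃ i : Fin n, Desc v⁻¹ i := by
  by_contra! h
  exact hv (inv_eq_one.1 (eq_one_of_no_desc h))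

theorem not_desc_inv_s_mul {v : W n} {i : Fin n} (h : Desc v⁻¹ i) : ¬Desc (s i * v)⁻¹ i := by
  rw [mul_inv_rev, s_inv]
  exact fun h' => desc_mul_s.1 h' h

theorem len_s_mul {v : W n} {i : Fin n} (h : Desc v⁻¹ i) : len (s i * v) + 1 = len v := by
  rw [← len_inv, ← len_inv v, mul_inv_rev, s_inv]
  exact len_mul_s_of_desc h

variable {A : Type*} [CommRing A] [IsDomain A] [CharZero A]

/-- Left factors of a longest element: the lengths of `z v⁻¹` and `v` add up. -/
theorem ddW'_split {z : W n} {P : W n → Prop} (hP : ∀ i v, P v → Desc v⁻¹ i.val → P (s i * v))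
    (hz : ∀ (i : Fin n) v, P v → P (s i * v) → ¬Desc v⁻¹ i → Desc (z * v⁻¹) i) {v : W n}
    (hv : P v) : (∀ f : MvPolynomial (Fin n) A, ddW' (z * v⁻¹) (ddW' v f) = ddW' z f) ∧
      len (z * v⁻¹) + len v = len z := by
  induction hk : len v using Nat.strong_induction_on generalizing v with
  | _ k ih =>
    by_cases h1 : v = 1
    · subst h1
      rw [len_one] at hk
      exact ⟨fun f => by rw [inv_one, mul_one, ddW'_one], by rw [inv_one, mul_one, ← hk]; rfl⟩
    obtain ⟨i, hi⟩ := exists_desc_inv h1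
    have h2 := not_desc_inv_s_mul hi
    have h3 := len_s_mul hi
    have hv' := hP i v hv hi
    obtain ⟨h4, h5⟩ := ih _ (by omega) hv' rfl
    have h6 : s i * (s i * v) = v := by rw [← mul_assoc, s_mul_s, one_mul]
    have h7 := hz i _ hv' (by rwa [h6]) h2
    have h8 : z * (s i * v)⁻¹ = z * v⁻¹ * s i := by rw [mul_inv_rev, s_inv, mul_assoc]
    rw [h8] at h4 h5 h7
    have h9 := len_mul_s_of_not_desc (desc_mul_s.1 h7)
    refine ⟨fun f => ?_, by omega⟩
    have e1 := dd'_ddW'_of_not_desc h2 f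
    rw [h6] at e1
    rw [← e1, ddW'_dd'_of_not_desc (desc_mul_s.1 h7), h4]

theorem ddW'_w0_split (v : W n) (f : MvPolynomial (Fin n) A) :
    ddW' (w0 n * v⁻¹) (ddW' v f) = ddW' (w0 n) f :=
  (ddW'_split (P := fun _ => True) (fun _ _ _ _ => trivial)
    (fun i _ _ _ h => (desc_w0_mul i.2).2 h) trivial).1 f

theorem zA_split {v : W n} (hv : v.left = 1) :
    (∀ f : MvPolynomial (Fin n) A, ddW' (zA n * v⁻¹) (ddW' v f) = ddW' (zA n) f) ∧
      len (zA n * v⁻¹) + len v = len (zA n) := by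
  refine ddW'_split (P := fun v => v.left = 1) (fun i v hv h => ?_) (fun i v hv hv' h => ?_) hv
  · exact left_mul_of_left (s_left (ne_zero_of_desc (left_inv_of_left hv) h)) hv
  · have hi : i.val ≠ 0 := by
      intro h0
      have h1 := left_mul_of_left hv' (left_inv_of_left hv)
      rw [mul_assoc, mul_inv_cancel, mul_one] at h1
      have := congrFun h1 i
      simp [s, h0] at this
    exact (desc_zA_mul (left_inv_of_left hv) hi).2 h

/-- For an unbarred permutation `∂'_v` is a composite of the `∂'_k` with `k ≥ 1`. -/
theorem exists_word_of_left {v : W n} (hv : v.left = 1) :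
    ∃ l : List ℕ, (∀ k ∈ l, 1 ≤ k ∧ k < n) ∧ l.length = len v ∧
      ∀ f : MvPolynomial (Fin n) A, ddW' v f = DL n A l f := by
  induction hk : len v using Nat.strong_induction_on generalizing v with
  | _ k ih =>
    by_cases h1 : v = 1
    · subst h1
      rw [len_one] at hk
      exact ⟨[], by simp, by simp [← hk], fun f => by rw [ddW'_one, DL_nil]⟩
    obtain ⟨i, hi⟩ := exists_desc_inv h1
    have h0 := ne_zero_of_desc (left_inv_of_left hv) hi
    have h2 := not_desc_inv_s_mul hi
    have h3 := len_s_mul hi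
    obtain ⟨l, h4, h5, h6⟩ := ih _ (by omega) (left_mul_of_left (s_left h0) hv) rfl
    refine ⟨i.val :: l, ?_, by rw [List.length_cons]; omega, fun f => ?_⟩
    · intro j hj
      rcases List.mem_cons.1 hj with rfl | hj
      · exact ⟨by omega, i.2⟩
      · exact h4 j hj
    · have e1 := dd'_ddW'_of_not_desc h2 f
      rw [← mul_assoc, s_mul_s, one_mul] at e1
      rw [← e1, DL_cons, ← h6, DD_fin]

/-! ### The operator `∂'_{w_0 ϖ_0}` -/

theorem oneLine_mul_cycW {m : ℕ} (h : m < n) (w : W n) (j : ℕ) :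
    oneLine (w * nprod n (cycW m)) j =
      if j = 0 then -oneLine w m else if j ≤ m then oneLine w (j - 1) else oneLine w j := by
  rw [cycW, nprod_append, nprod_singleton, ← mul_assoc, sN, dif_pos (by omega),
    oneLine_mul_zero _ (by omega), oneLine_mul_sweep (by omega), oneLine_mul_sweep (by omega)]
  split_ifs <;> first | rfl | omega | (congr 2; omega)

theorem oneLine_mul_psiW {m : ℕ} (h : m ≤ n) (w : W n) (j : ℕ) :
    oneLine (w * nprod n (psiW m)) j =
      if j < m then -oneLine w (m - 1 - j) else oneLine w j := by
  induction m generalizing j with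
  | zero => simp [psiW, nprod_nil]
  | succ m ih =>
    rw [psiW, nprod_append, ← mul_assoc, oneLine_mul_cycW (by omega), ih (by omega), ih (by omega),
      ih (by omega)]
    split_ifs <;> first | rfl | omega | (congr 2; omega)

theorem oneLine_zA {j : ℕ} (hj : j < n) : oneLine (zA n) j = n - j := by
  rw [zA, oneLine_ofPerm _ hj, revPerm, Fin.revPerm_apply, Fin.val_rev]
  simp
  omega

theorem oneLine_one {j : ℕ} (hj : j < n) : oneLine (1 : W n) j = j + 1 := by
  simp [oneLine, hj]

theorem nprod_psiW : nprod n (psiW n) = w0 n * zA n := by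
  refine oneLine_injective fun k hk => ?_
  have := oneLine_mul_psiW (le_refl n) 1 k
  rw [one_mul] at this
  rw [this, if_pos hk, oneLine_one (by omega), oneLine_w0_mul, oneLine_zA hk]
  omega

theorem card_posPairs (n : ℕ) : (posPairs n).card = ∑ i ∈ Finset.range n, i := by
  have : posPairs n = (Finset.range n).biUnion fun b => (Finset.range b).image fun a => (a, b) := by
    ext ⟨a, b⟩
    rw [mem_posPairs]
    simp
    constructor
    · rintro ⟨h1, h2⟩; exact ⟨h2, h1⟩
    · rintro ⟨h1, h2⟩; exact ⟨h2, h1⟩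
  rw [this, Finset.card_biUnion]
  · refine Finset.sum_congr rfl fun b _ => ?_
    rw [Finset.card_image_of_injective _ fun x y h => (Prod.ext_iff.1 h).1, Finset.card_range]
  · intro x _ y _ hxy
    rw [Function.onFun, Finset.disjoint_left]
    rintro ⟨a, b⟩ h1 h2
    simp at h1 h2
    omega

theorem len_w0_zA : len (w0 n * zA n) = ∑ i ∈ Finset.range n, (i + 1) := by
  have h : ∀ k < n, oneLine (w0 n * zA n) k = -(n - k) := fun k hk => by
    rw [oneLine_w0_mul, oneLine_zA hk]
  rw [len, invCount, Finset.sum_add_distrib, ← card_posPairs, Finset.card_eq_sum_ones, add_comm]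
  congr 1
  · refine Finset.sum_congr rfl fun p hp => ?_
    rw [mem_posPairs] at hp
    rw [h _ (by omega), h _ hp.2, pairInv, if_neg (by omega), if_pos (by omega)]
  · refine Finset.sum_congr rfl fun k hk => ?_
    rw [Finset.mem_range] at hk
    rw [h k hk, if_pos (by omega)]

theorem length_psiW (m : ℕ) : (psiW m).length = ∑ i ∈ Finset.range m, (i + 1) := by
  have : ∀ k t, (sweepW k t).length = t := by
    intro k t
    induction t generalizing k with
    | zero => rfl
    | succ t ih => rw [sweepW, List.length_append, ih]; rfl
  induction m with
  | zero => rfl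
  | succ m ih =>
    rw [psiW, List.length_append, ih, Finset.sum_range_succ, cycW, List.length_append, this]; rfl

theorem DL_eq_ddW'_of_len {l : List ℕ} (hl : ∀ k ∈ l, k < n) (h : l.length = len (nprod n l))
    (f : MvPolynomial (Fin n) A) : DL n A l f = ddW' (nprod n l) f := by
  obtain ⟨m, rfl⟩ : ∃ m : List (Fin n), m.map Fin.val = l := by
    clear h
    induction l with
    | nil => exact ⟨[], rfl⟩
    | cons k l ih =>
      obtain ⟨m, rfl⟩ := ih fun j hj => hl j (List.mem_cons_of_mem _ hj)
      exact ⟨⟨k, hl k List.mem_cons_self⟩ :: m, rfl⟩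
  have e1 : DL n A (m.map Fin.val) f = ddL m f := by
    clear h hl
    induction m with
    | nil => rfl
    | cons i m ih => rw [List.map_cons, DL_cons, ih, DD_fin]; rfl
  have e2 : nprod n (m.map Fin.val) = wprod m := by
    rw [nprod, wprod, List.map_map]
    congr 2
    funext i
    simp [sN]
  rw [e2, List.length_map] at h
  rw [e1, e2, ddL_eq_ddW' h]

theorem DL_psiW_eq (f : MvPolynomial (Fin n) A) :
    DL n A (psiW n) f = ddW' (w0 n * zA n) f := by
  rw [← nprod_psiW]
  refine DL_eq_ddW'_of_len (fun k hk => mem_psiW hk) ?_ f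
  rw [nprod_psiW, len_w0_zA, length_psiW]

theorem seg_merged_univ {u : ℕ → ℤ} {r : ℕ} (hr : r ≤ n) (h : ∀ j < r, u j = -((n : ℤ) - j)) :
    Seg u 0 (merged (Finset.univ : StrictPart n) r) := by
  induction r with
  | zero => trivial
  | succ r ih =>
    rw [merged, if_pos (memN_univ (by omega)), seg_append, length_merged]
    refine ⟨ih (by omega) fun j hj => h j (by omega), ?_, trivial⟩
    rw [zero_add, h r (by omega)]
    omega

/-- The word w_0 ϖ_0 is the barred word (n, …, 1), which is what the sorting word for the full
partition takes to w_0; cancelling w_0 shows that this sorting word spells the involution ϖ_0. -/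
theorem nprod_sortW_univ : nprod n (sortW (Finset.univ : StrictPart n) 0 n) = zA n := by
  have h : w0 n * zA n * nprod n (sortW (Finset.univ : StrictPart n) 0 n) = w0 n := by
    refine eq_w0_of_seg (Seg.sortW (by omega) (seg_merged_univ le_rfl fun j hj => ?_))
    rw [oneLine_w0_mul, oneLine_zA hj]
  rw [mul_assoc] at h
  have h1 := mul_eq_left.1 h
  rw [← zA_inv, eq_comm, inv_eq_iff_mul_eq_one]
  exact h1

theorem nprod_cycWPow : nprod n (cycWPow (n - 1) n) = w0 n := by
  have h : ∀ r ≤ n, Seg (oneLine (1 : W n)) (n - r) ((barred n r).map fun c => -c) := by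
    intro r
    induction r with
    | zero => intro _; trivial
    | succ r ih =>
      intro hr
      refine ⟨?_, ?_⟩
      · rw [oneLine_one (by omega)]; simp
      · have := ih (by omega)
        rwa [show n - r = n - (r + 1) + 1 by omega] at this
  have hlen : ∀ r, (barred n r).length = r := by
    intro r
    induction r with
    | zero => rfl
    | succ r ih => rw [barred, List.length_cons, ih]
  have h1 := h n le_rfl
  rw [Nat.sub_self] at h1
  have h2 := Seg.cycPow (l := []) (by rw [List.length_map, hlen]; simp) h1
  rw [List.map_map, List.length_map, hlen, one_mul, List.append_nil] at h2
  refine eq_w0_of_seg ?_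
  convert h2 using 1
  conv_lhs => rw [← List.map_id (barred n n)]
  refine List.map_congr_left fun c _ => ?_
  simp

end Longest

end SympSchubert

end

noncomputable section

namespace SympSchubert

open MvPolynomial

/-! ### Values of the longest operators -/

section Values

variable {n : ℕ}

theorem wt_univ {r : ℕ} (hr : r ≤ n) : wt (Finset.univ : StrictPart n) r = r * (r - 1) / 2 := by
  have h : ∀ r, wt (∅ : StrictPart n) r = 0 := by
    intro r
    induction r with
    | zero => rfl
    | succ r ih => rw [wt, if_neg (by simp [memN]), ih]
  have := wt_add_wt_compl (Finset.univ : StrictPart n) hr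
  rwa [Finset.compl_univ, h, add_zero] at this

theorem gaps_univ {r : ℕ} (hr : r ≤ n) : gaps (Finset.univ : StrictPart n) r = [] := by
  induction r with
  | zero => rfl
  | succ r ih => rw [gaps, if_pos (memN_univ (by omega)), ih (by omega)]

theorem neg_one_pow_mul_self {R : Type*} [CommRing R] (k : ℕ) : (-1 : R) ^ k * (-1) ^ k = 1 := by
  rw [← mul_pow]; simp

theorem neg_one_pow_ne_zero {R : Type*} [CommRing R] [Nontrivial R] (k : ℕ) :
    (-1 : R) ^ k ≠ 0 := fun h => by
  have := neg_one_pow_mul_self (R := R) k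
  rw [h, mul_zero] at this
  exact zero_ne_one this

theorem ddW'_zA_xdelta : ddW' (zA n) (xdelta n) = (-1) ^ (n * (n - 1) / 2) := by
  have h := DL_sortW_mono (Finset.univ : StrictPart n) (i := 0) (r := n) (by omega)
  rw [wt_univ le_rfl, gaps_univ le_rfl, mono, mul_one] at h
  rw [← h, ← nprod_sortW_univ]
  refine (DL_eq_ddW'_of_ne_zero (g := xdelta n) ?_ _).symm
  rw [xdelta, h]
  exact neg_one_pow_ne_zero _

theorem ddW'_mul_of_left {v : W n} (hv : v.left = 1) (f : MvPolynomial (Fin n) ℤ)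
    {g : MvPolynomial (Fin n) ℤ} (hg : ∀ k, 1 ≤ k → k < n → sg n ℤ k g = g) :
    ddW' v (f * g) = ddW' v f * g := by
  obtain ⟨l, hl, -, h⟩ := exists_word_of_left (A := ℤ) hv
  rw [h, h, DL_mul_of_inv']
  intro k hk
  exact hg k (hl k hk).1 (hl k hk).2

theorem ddW'_neg_one_pow_mul (w : W n) (k : ℕ) (f : MvPolynomial (Fin n) ℤ) :
    ddW' w ((-1) ^ k * f) = (-1) ^ k * ddW' w f := by
  rw [ddW'_eq_DL, ddW'_eq_DL, DL_neg_one_pow_mul]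

theorem hi_sub_succ {lam : StrictPart n} {r : ℕ} (hr : r + 1 ≤ n) :
    hi lam (n - (r + 1)) n =
      hi lam (n - r) n ++ if memN lam (n - (r + 1)) then [n - r] else [] := by
  rw [hi_append (k := n - (r + 1) + 1) (by omega) (by omega), hi_self_succ,
    show n - (r + 1) + 1 = n - r by omega]

/-- With all exponents present, every part from n - r + 1 to n is called for deletion once; the
contraction for a part missing from λ is zero. -/
theorem cycIter_stairL_eq_zero {lam : StrictPart n} {r : ℕ} (hr : r ≤ n)
    (h : ∃ i, n - r ≤ i ∧ i < n ∧ ¬memN lam i) :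
    cycIter n ℤ (n - 1) (stairL r) (QT n (hi lam (n - r) n)) = 0 := by
  induction r with
  | zero => obtain ⟨i, h1, h2, -⟩ := h; omega
  | succ r ih =>
    rw [stairL, cycIter, DL_cycW_QT (by omega), hi_sub_succ hr]
    have hd : ∀ b ∈ hi lam (n - r) n,
        (if b + r = n then 1 else 0 : MvPolynomial (Fin n) ℤ) = 0 := by
      intro b hb
      obtain ⟨i, rfl, h1, -⟩ := mem_hi.1 hb
      rw [if_neg (by omega)]
    split_ifs with hm
    · rw [iota_delta_append _ (by rw [if_pos (by omega)]) hd (by simp), List.append_nil,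
        cycIter_mul_neg_one_pow, ih (by omega), mul_zero]
      obtain ⟨i, h1, h2, h3⟩ := h
      refine ⟨i, ?_, h2, h3⟩
      by_contra h4
      have : i = n - (r + 1) := by omega
      exact h3 (this ▸ hm)
    · rw [List.append_nil, iota_delta_of_notMem _ hd, cycIter_zero]

theorem QT_nil : QT n [] = 1 := by
  change pfT _ _ [] = 1
  simp [pfT, pfL_nil, iota_nil]

theorem hi_empty : hi (∅ : StrictPart n) 0 n = [] := by rw [← map_sort_ge]; simp

theorem ddW'_w0_xdelta_mul_Qtilde (lam : StrictPart n) :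
    ddW' (w0 n) (xdelta n * Qtilde lam) =
      if lam = Finset.univ then (-1) ^ (n * (n - 1) / 2) else 0 := by
  rcases Nat.eq_zero_or_pos n with rfl | hn
  · rw [if_pos (Subsingleton.elim _ _), show w0 0 = 1 from oneLine_injective fun k hk => by omega,
      ddW'_one, Qtilde_eq_QT, hi_of_le le_rfl, QT_nil]
    simp [xdelta, stairL, mono]
  have h1 : ∀ lam : StrictPart n, DL n ℤ (cycWPow (n - 1) n) (xdelta n * Qtilde lam) =
      cycIter n ℤ (n - 1) (stairL n) (QT n (hi lam (n - n) n)) := by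
    intro lam
    have := DL_cycWPow (n := n) (A := ℤ) (m := n - 1) (by omega) (l := stairL n)
      ((stair_stairL n).of_le (by omega)) (symTo_QT (n - 1) (hi lam 0 n))
    rw [length_stairL] at this
    rw [Qtilde_eq_QT, Nat.sub_self]
    exact this
  have h2 : DL n ℤ (cycWPow (n - 1) n) (xdelta n * Qtilde Finset.univ) =
      (-1) ^ (n * (n - 1) / 2) := by
    have h3 := cycIter_gaps (∅ : StrictPart n) le_rfl
    have h4 : ∀ r, gaps (∅ : StrictPart n) r = stairL r := by
      intro r
      induction r with
      | zero => rfl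
      | succ r ih => rw [gaps, if_neg (by simp [memN]), ih, stairL]
    rw [h4, hi_empty, hi_of_le (k := 0) (m := n - n) (by omega), List.append_nil,
      Finset.compl_empty, wt_univ le_rfl, QT_nil, mul_one] at h3
    rw [h1, h3]
  rw [← nprod_cycWPow, ← DL_eq_ddW'_of_ne_zero (g := xdelta n * Qtilde Finset.univ)
    (by rw [h2]; exact neg_one_pow_ne_zero _)]
  split_ifs with h
  · rw [h, h2]
  · rw [h1, cycIter_stairL_eq_zero le_rfl]
    by_contra! h5
    refine h (Finset.eq_univ_iff_forall.2 fun i => ?_)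
    obtain ⟨_, h6⟩ := h5 i (by omega) i.2
    exact h6

theorem sg_Qtilde {k : ℕ} (hk : k ≠ 0) (lam : StrictPart n) :
    sg n ℤ k (Qtilde lam) = Qtilde lam := by
  rw [Qtilde_eq_QT]; exact sg_QT hk _

variable (n) in
/-- The element `w_0 ϖ_0`. -/
def w1 : W n := w0 n * zA n

theorem ddW'_w0_eq (f : MvPolynomial (Fin n) ℤ) : ddW' (w0 n) f = ddW' (w1 n) (ddW' (zA n) f) := by
  have := ddW'_w0_split (zA n) f
  rw [zA_inv] at this
  exact this.symm

/-- Since w_0 = (w_0 ϖ_0) ϖ_0 with lengths adding and Q̃_λ is symmetric, ∂'_{ϖ_0} consumes x^δ and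
leaves a sign; the values of ∂'_{w_0} on x^δ Q̃_λ then give the claim. -/
theorem ddW'_w1_Qtilde (lam : StrictPart n) :
    ddW' (w1 n) (Qtilde lam) = if lam = Finset.univ then 1 else 0 := by
  have h := ddW'_w0_xdelta_mul_Qtilde lam
  rw [ddW'_w0_eq, ddW'_mul_of_left rfl _ fun k hk _ => sg_Qtilde (by omega) lam, ddW'_zA_xdelta,
    ddW'_neg_one_pow_mul] at h
  refine mul_left_cancel₀ (neg_one_pow_ne_zero (n * (n - 1) / 2)) (h.trans ?_)
  split_ifs <;> simp

/-! ### Reversal of the variables -/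

variable (n) in
/-- The substitution `x_i ↦ -x_{n+1-i}` as a homomorphism. -/
def negRevHom : MvPolynomial (Fin n) ℤ →ₐ[ℤ] MvPolynomial (Fin n) ℤ :=
  aeval fun i => -X (revPerm n i)

theorem negRevVars_eq (f : MvPolynomial (Fin n) ℤ) : negRevVars f = negRevHom n f := rfl

theorem negRevHom_xv {k : ℕ} (h : k < n) : negRevHom n (xv n ℤ k) = -xv n ℤ (n - 1 - k) := by
  rw [xv_of_lt h, xv_of_lt (show n - 1 - k < n by omega), negRevHom, aeval_X]
  congr 2
  ext
  rw [revPerm, Fin.revPerm_apply, Fin.val_rev]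
  simp
  omega

theorem negRevHom_negRevHom (f : MvPolynomial (Fin n) ℤ) : negRevHom n (negRevHom n f) = f := by
  have : (negRevHom n).comp (negRevHom n) = AlgHom.id ℤ _ := by
    ext i : 1
    simp [negRevHom, revPerm]
  exact congrArg (fun φ => φ f) this

theorem negRevHom_sg {k : ℕ} (h1 : 1 ≤ k) (h2 : k < n) (f : MvPolynomial (Fin n) ℤ) :
    negRevHom n (sg n ℤ k f) = sg n ℤ (n - k) (negRevHom n f) := by
  obtain ⟨k, rfl⟩ : ∃ j, k = j + 1 := ⟨k - 1, by omega⟩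
  obtain ⟨m, hm⟩ : ∃ m, n - (k + 1) = m + 1 := ⟨n - (k + 1) - 1, by omega⟩
  rw [hm]
  have : (negRevHom n).comp (sg n ℤ (k + 1)) = (sg n ℤ (m + 1)).comp (negRevHom n) := by
    refine algHom_ext_xv fun j hj => ?_
    simp only [AlgHom.comp_apply]
    by_cases e1 : j = k
    · subst e1
      rw [sg_succ_xv h2, negRevHom_xv h2, negRevHom_xv hj, map_neg,
        show n - 1 - (j + 1) = m by omega, show n - 1 - j = m + 1 by omega,
        sg_succ_xv' (by omega)]
    by_cases e2 : j = k + 1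
    · subst e2
      rw [sg_succ_xv' h2, negRevHom_xv h2, negRevHom_xv (by omega), map_neg,
        show n - 1 - (k + 1) = m by omega, show n - 1 - k = m + 1 by omega,
        sg_succ_xv (by omega)]
    rw [sg_succ_xv_of_ne e1 e2, negRevHom_xv hj, map_neg, sg_succ_xv_of_ne (by omega) (by omega)]
  exact congrArg (fun φ => φ f) this

/-- Reversing the variables alone would send simple roots to negatives of simple roots; the extra
sign of the variables repairs this. -/
theorem negRevHom_DD {k : ℕ} (h1 : 1 ≤ k) (h2 : k < n) (f : MvPolynomial (Fin n) ℤ) :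
    negRevHom n (DD n ℤ k f) = DD n ℤ (n - k) (negRevHom n f) := by
  refine (DD_unique ?_).symm
  have hr : negRevHom n (rt n ℤ k) = rt n ℤ (n - k) := by
    obtain ⟨k, rfl⟩ : ∃ j, k = j + 1 := ⟨k - 1, by omega⟩
    obtain ⟨m, hm⟩ : ∃ m, n - (k + 1) = m + 1 := ⟨n - (k + 1) - 1, by omega⟩
    rw [hm, rt_succ h2, rt_succ (by omega), map_sub, negRevHom_xv h2, negRevHom_xv (by omega),
      show n - 1 - (k + 1) = m by omega, show n - 1 - k = m + 1 by omega]
    ring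
  rw [← negRevHom_sg h1 h2, ← map_sub, ← rt_mul_DD, map_mul, hr]

theorem revMono_stairL {k r : ℕ} (h : k + r = n) :
    revMono n ℤ (stairL r) = negRevHom n (mono n ℤ k (stairL r)) := by
  induction r generalizing k with
  | zero => simp [stairL, revMono, mono]
  | succ r ih =>
    rw [stairL, revMono, mono, map_mul, map_pow, negRevHom_xv (by omega),
      ← ih (k := k + 1) (by omega), length_stairL, show n - 1 - k = r by omega]

theorem ddW'_w1_xdelta_mul {G : MvPolynomial (Fin n) ℤ} (hG : SymTo (n - 1) G) :
    ddW' (w1 n) (xdelta n * G) = negRevHom n (xdelta n) * ddW' (w1 n) G := by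
  have := DL_psiW_mono (n := n) (A := ℤ) (l := stairL n)
    (by rw [length_stairL]; exact stair_stairL n) (by rw [length_stairL]) (G := G)
    (by rwa [length_stairL])
  rw [length_stairL, DL_psiW_eq, DL_psiW_eq, revMono_stairL (k := 0) (by omega)] at this
  exact this

theorem zA_mul_s {k : ℕ} (h1 : 1 ≤ k) (h2 : k < n) :
    zA n * s ⟨k, h2⟩ = s ⟨n - k, by omega⟩ * zA n := by
  have e1 : s (n := n) ⟨k, h2⟩ = ofPerm (Equiv.swap ⟨k - 1, by omega⟩ ⟨k, h2⟩) := by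
    rw [s, if_neg (by simp; omega)]; rfl
  have e2 : s (n := n) ⟨n - k, by omega⟩ =
      ofPerm (Equiv.swap ⟨n - k - 1, by omega⟩ ⟨n - k, by omega⟩) := by
    rw [s, if_neg (by simp; omega)]; rfl
  rw [e1, e2, zA, ← ofPerm_mul, ← ofPerm_mul, Equiv.mul_swap_eq_swap_mul, Equiv.swap_comm]
  have e3 : revPerm n ⟨k, h2⟩ = ⟨n - k - 1, by omega⟩ := by
    ext
    rw [revPerm, Fin.revPerm_apply, Fin.val_rev]
    simp
    omega
  have e4 : revPerm n ⟨k - 1, by omega⟩ = ⟨n - k, by omega⟩ := by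
    ext
    rw [revPerm, Fin.revPerm_apply, Fin.val_rev]
    simp
    omega
  rw [e3, e4]

theorem not_desc_w1 {k : ℕ} (h1 : 1 ≤ k) (h2 : k < n) : ¬Desc (w1 n) k := by
  obtain ⟨k, rfl⟩ : ∃ j, k = j + 1 := ⟨k - 1, by omega⟩
  rw [desc_succ, w1, oneLine_w0_mul, oneLine_w0_mul, oneLine_zA h2, oneLine_zA (by omega)]
  omega

theorem w1_inv : (w1 n)⁻¹ = w1 n := by
  refine inv_eq_of_mul_eq_one_left ?_
  rw [w1, mul_assoc, ← mul_assoc (zA n), ← w0_comm, mul_assoc (w0 n) (zA n), zA_mul_zA, mul_one,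
    w0_mul_w0]

/-- Both sides are the operator of w_0 ϖ_0 s_k = s_{n-k} w_0 ϖ_0, the length increasing on either
side. -/
theorem ddW'_w1_DD {k : ℕ} (h1 : 1 ≤ k) (h2 : k < n) (f : MvPolynomial (Fin n) ℤ) :
    ddW' (w1 n) (DD n ℤ k f) = DD n ℤ (n - k) (ddW' (w1 n) f) := by
  have e1 := ddW'_dd'_of_not_desc (i := ⟨k, h2⟩) (not_desc_w1 h1 h2) f
  have e2 := dd'_ddW'_of_not_desc (w := w1 n) (i := ⟨n - k, by omega⟩)
    (by rw [w1_inv]; exact not_desc_w1 (k := n - k) (by omega) (by omega)) f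
  rw [← DD_fin] at e1 e2
  rw [e1, e2]
  congr 1
  rw [w1, mul_assoc, zA_mul_s h1 h2, ← mul_assoc, ← mul_assoc, w0_comm]

/-- Both ∂'_{w_0 ϖ_0} and the substitution X ↦ -ϖ_0 X exchange ∂'_k with ∂'_{n-k}, which reduces the
claim to trivial v. There x^δ passes through the operator and Q̃_ρ is sent to 1. -/
theorem ddW'_w1_mul_Qtilde {v : W n} (hv : v.left = 1) :
    ddW' (w1 n) (ddW' v (xdelta n * Qtilde Finset.univ)) = negRevHom n (ddW' v (xdelta n)) := by
  obtain ⟨l, hl, -, h⟩ := exists_word_of_left (A := ℤ) hv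
  have e1 : ∀ f, ddW' (w1 n) (DL n ℤ l f) = DL n ℤ (l.map fun k => n - k) (ddW' (w1 n) f) := by
    intro f
    clear h
    induction l with
    | nil => rfl
    | cons k l ih =>
      have hk := hl k List.mem_cons_self
      rw [DL_cons, ddW'_w1_DD hk.1 hk.2, ih fun j hj => hl j (List.mem_cons_of_mem _ hj)]
      rfl
  have e2 : ∀ f, negRevHom n (DL n ℤ l f) = DL n ℤ (l.map fun k => n - k) (negRevHom n f) := by
    intro f
    clear h e1
    induction l with
    | nil => rfl
    | cons k l ih =>
      have hk := hl k List.mem_cons_self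
      rw [DL_cons, negRevHom_DD hk.1 hk.2, ih fun j hj => hl j (List.mem_cons_of_mem _ hj)]
      rfl
  rw [h, h, e1, e2, ddW'_w1_xdelta_mul, ddW'_w1_Qtilde, if_pos rfl, mul_one]
  intro k h1 _
  exact sg_Qtilde (by omega) _

/-- The polynomials `∂'_v x^δ` for permutations `v`. -/
def typeA (p : Equiv.Perm (Fin n)) : MvPolynomial (Fin n) ℤ := ddW' (ofPerm p) (xdelta n)

/-- From ϖ⁻¹ w_0 = (w_0 ϖ_0)(ϖ_0 ϖ⁻¹). That the two operators compose to the operator of the product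
is certified by a test polynomial, the image under ∂'_ϖ of x^δ Q̃_ρ: completing the composite to
∂'_{w_0} gives a sign. -/
theorem CPerm_eq (p : Equiv.Perm (Fin n)) : CPerm p =
    (-1) ^ (n * (n - 1) / 2) * negRevVars (typeA (revPerm n * p⁻¹)) := by
  have h1 : (ofPerm p)⁻¹ * w0 n = w1 n * ofPerm (revPerm n * p⁻¹) := by
    rw [ofPerm_mul, w1, ofPerm_inv, ← w0_comm]
    change _ = w0 n * zA n * (zA n * _)
    rw [mul_assoc, ← mul_assoc (zA n), zA_mul_zA, one_mul]
  have h2 : ofPerm (revPerm n * p⁻¹) = zA n * (ofPerm p)⁻¹ := by rw [ofPerm_mul, ofPerm_inv]; rfl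
  have h3 := (zA_split (A := ℤ) (v := ofPerm p) rfl).1 (xdelta n * Qtilde Finset.univ)
  rw [CPerm, CS_eq, h1, ← ddW'_ddW'_of_ne_zero (g := ddW' (ofPerm p) (xdelta n * Qtilde Finset.univ)),
    ddW'_w1_mul_Qtilde rfl]
  · rfl
  · rw [h2, h3, ← ddW'_w0_eq, ddW'_w0_xdelta_mul_Qtilde, if_pos rfl]
    exact neg_one_pow_ne_zero _

end Values

end SympSchubert

end

noncomputable section

namespace SympSchubert

open MvPolynomial

/-! ### Polynomials of staircase degree -/

section Staircase

variable {n : ℕ} {A : Type*} [CommRing A] [IsDomain A] [CharZero A]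

theorem sg_eq_rename {k : ℕ} (h : k + 1 < n) (f : MvPolynomial (Fin n) A) :
    sg n A (k + 1) f = rename (Equiv.swap ⟨k, by omega⟩ ⟨k + 1, h⟩) f := by
  have : sg n A (k + 1) = rename (Equiv.swap ⟨k, by omega⟩ ⟨k + 1, h⟩) := by
    ext j : 1
    rw [show sg n A (k + 1) = act (s ⟨k + 1, h⟩) from sg_fin ⟨k + 1, h⟩, act_s_X_pos (by simp),
      rename_X]
    rfl
  rw [this]

theorem degreeOf_sg {k : ℕ} (h : k + 1 < n) (f : MvPolynomial (Fin n) A) (j : Fin n) :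
    degreeOf j (sg n A (k + 1) f) = degreeOf (Equiv.swap ⟨k, by omega⟩ ⟨k + 1, h⟩ j) f := by
  rw [sg_eq_rename h]
  conv_lhs => rw [← Equiv.swap_apply_self (⟨k, by omega⟩ : Fin n) ⟨k + 1, h⟩ j]
  rw [degreeOf_rename_of_injective (Equiv.injective _)]

/-- The degree in `x_j` is at most `n - 1 - j`, the variables being counted from `0`. -/
def Staircase (f : MvPolynomial (Fin n) A) : Prop := ∀ j : Fin n, degreeOf j f ≤ n - 1 - j.val

/-- Only the variable x_{k+1} is at risk, where f - s f may exceed the bound by one; division by the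
root, which has positive degree in it, restores the bound. -/
theorem Staircase.DD {f : MvPolynomial (Fin n) A} (hf : Staircase f) {k : ℕ} (h : k + 1 < n) :
    Staircase (DD n A (k + 1) f) := by
  intro j
  by_cases h0 : SympSchubert.DD n A (k + 1) f = 0
  · rw [h0, degreeOf_zero]; omega
  have h1 : degreeOf j (rt n A (k + 1)) + degreeOf j (SympSchubert.DD n A (k + 1) f) =
      degreeOf j (f - sg n A (k + 1) f) := by
    rw [← degreeOf_mul_eq (rt_ne_zero _) h0, rt_mul_DD]
  have h2 := degreeOf_sub_le j f (sg n A (k + 1) f)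
  rw [degreeOf_sg h] at h2
  have hk : ∀ j : Fin n, (j.val = k ∨ j.val = k + 1) → degreeOf j (rt n A (k + 1)) ≠ 0 := by
    intro j hj h3
    rw [rt_succ h, xv_of_lt h, xv_of_lt (show k < n by omega)] at h3
    have h4 : (X ⟨k, by omega⟩ : MvPolynomial (Fin n) A) ≠ 0 := X_ne_zero _
    rcases hj with hj | hj
    · have : degreeOf j (X ⟨k + 1, h⟩ : MvPolynomial (Fin n) A) <
          degreeOf j (-X ⟨k, by omega⟩ : MvPolynomial (Fin n) A) := by
        rw [degreeOf_neg, degreeOf_X_of_ne (by simp [Fin.ext_iff]; omega)]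
        rw [show (⟨k, by omega⟩ : Fin n) = j from Fin.ext hj.symm, degreeOf_X_self]
        omega
      rw [sub_eq_add_neg, add_comm, degreeOf_add_eq_of_degreeOf_lt this] at h3
      omega
    · have : degreeOf j (-X ⟨k, by omega⟩ : MvPolynomial (Fin n) A) <
          degreeOf j (X ⟨k + 1, h⟩ : MvPolynomial (Fin n) A) := by
        rw [degreeOf_neg, degreeOf_X_of_ne (by simp [Fin.ext_iff]; omega)]
        rw [show (⟨k + 1, by omega⟩ : Fin n) = j from Fin.ext hj.symm, degreeOf_X_self]
        omega
      rw [sub_eq_add_neg, degreeOf_add_eq_of_degreeOf_lt this] at h3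
      omega
  have h3 := hf j
  by_cases e1 : j.val = k
  · obtain rfl : j = ⟨k, Nat.lt_of_succ_lt h⟩ := Fin.ext e1
    rw [Equiv.swap_apply_left] at h2
    have h4 := hf ⟨k + 1, h⟩
    have h5 := hk _ (Or.inl e1)
    simp only at h3 h4
    omega
  by_cases e2 : j.val = k + 1
  · obtain rfl : j = ⟨k + 1, h⟩ := Fin.ext e2
    rw [Equiv.swap_apply_right] at h2
    have h4 := hf ⟨k, by omega⟩
    have h5 := hk _ (Or.inr e2)
    simp only at h3 h4
    omega
  · rw [Equiv.swap_apply_of_ne_of_ne (by simpa [Fin.ext_iff] using e1)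
      (by simpa [Fin.ext_iff] using e2)] at h2
    omega

theorem totalDegree_DD_lt {f : MvPolynomial (Fin n) A} {k : ℕ} (h : k + 1 < n)
    (h0 : DD n A (k + 1) f ≠ 0) : totalDegree (DD n A (k + 1) f) < totalDegree f := by
  have h1 := totalDegree_mul_of_isDomain (rt_ne_zero (n := n) (A := A) (k + 1)) h0
  have h2 := totalDegree_sub f (sg n A (k + 1) f)
  rw [← rt_mul_DD, h1, sg_eq_rename h] at h2
  have h3 := totalDegree_rename_le (Equiv.swap (⟨k, by omega⟩ : Fin n) ⟨k + 1, h⟩) f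
  have h4 : totalDegree (rt n A (k + 1)) ≠ 0 := by
    intro h4
    rw [totalDegree_eq_zero_iff_eq_C] at h4
    have h5 := sg_rt (A := A) (k + 1) h
    rw [h4, ← algebraMap_eq, AlgHom.commutes, algebraMap_eq, ← h4, eq_neg_iff_add_eq_zero,
      ← two_mul] at h5
    exact mul_ne_zero two_ne_zero (rt_ne_zero _) h5
  have h5 := max_le (le_refl (totalDegree f)) h3
  omega

/-- A polynomial of staircase degree is determined by the values at `0` of its divided
differences. -/
theorem eq_zero_of_constantCoeff_DL {f : MvPolynomial (Fin n) A} (hf : Staircase f)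
    (h : ∀ l : List ℕ, (∀ k ∈ l, 1 ≤ k ∧ k < n) → constantCoeff (DL n A l f) = 0) : f = 0 := by
  induction hd : totalDegree f using Nat.strong_induction_on generalizing f with
  | _ d ih =>
    -- By induction on total degree all the ∂'_k f with k ≥ 1 vanish, so f is symmetric.
    have h1 : ∀ k, k + 1 < n → sg n A (k + 1) f = f := by
      intro k hk
      rw [← DD_eq_zero_iff]
      by_contra h0
      refine h0 (ih _ (hd ▸ totalDegree_DD_lt hk h0) (hf.DD hk) (fun l hl => ?_) rfl)
      have := h (l ++ [k + 1]) (by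
        intro j hj
        rcases List.mem_append.1 hj with hj | hj
        · exact hl j hj
        · rw [List.mem_singleton.1 hj]; omega)
      rwa [DL_append] at this
    -- The staircase bound is zero for the last variable, and symmetry passes this on to every other
    -- variable, so f is constant.
    have h2 : ∀ r, ∀ j : Fin n, j.val + r + 1 = n → degreeOf j f = 0 := by
      intro r
      induction r with
      | zero =>
        intro j hj
        have := hf j
        omega
      | succ r ihr =>
        intro j hj
        have hj1 : j.val + 1 < n := by omega
        have := degreeOf_sg hj1 f j
        rw [h1 _ hj1, Equiv.swap_apply_left] at this
        rw [this]
        exact ihr ⟨j.val + 1, hj1⟩ (by simp; omega)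
    have h3 : f = C (coeff 0 f) := by
      refine vars_eq_empty_iff_eq_C.1 ?_
      refine Finset.eq_empty_of_forall_notMem fun j hj => ?_
      rw [mem_vars_iff_degreeOf_ne_zero] at hj
      exact hj (h2 (n - 1 - j.val) j (by omega))
    have h4 := h [] (by simp)
    rw [DL_nil, constantCoeff_eq] at h4
    rw [h3, h4, C_0]

theorem Staircase.DL {f : MvPolynomial (Fin n) A} (hf : Staircase f) {l : List ℕ}
    (hl : ∀ k ∈ l, 1 ≤ k ∧ k < n) : Staircase (DL n A l f) := by
  induction l with
  | nil => exact hf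
  | cons k l ih =>
    have hk := hl k List.mem_cons_self
    obtain ⟨k, rfl⟩ : ∃ j, k = j + 1 := ⟨k - 1, by omega⟩
    exact (ih fun j hj => hl j (List.mem_cons_of_mem _ hj)).DD hk.2

variable (n A) in
/-- The substitution `x_i ↦ 2 x_i`. -/
def scaleHom : MvPolynomial (Fin n) A →ₐ[A] MvPolynomial (Fin n) A := aeval fun i => 2 * X i

omit [IsDomain A] [CharZero A] in
theorem scaleHom_X (j : Fin n) : scaleHom n A (X j) = 2 * X j := by rw [scaleHom, aeval_X]

omit [IsDomain A] [CharZero A] in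
theorem constantCoeff_scaleHom (f : MvPolynomial (Fin n) A) :
    constantCoeff (scaleHom n A f) = constantCoeff f := by
  have : constantCoeff.comp (scaleHom n A).toRingHom = constantCoeff := by
    ext i <;> simp [scaleHom]
  exact congrArg (fun φ => φ f) this

/-- Scaling the variables by 2 serves as a test of homogeneity: the operator lowers the degree by
one, hence the factor 2. -/
theorem scaleHom_DD {k : ℕ} (h : k + 1 < n) (f : MvPolynomial (Fin n) A) :
    DD n A (k + 1) (scaleHom n A f) = 2 * scaleHom n A (DD n A (k + 1) f) := by
  refine DD_unique ?_
  have h1 : scaleHom n A (rt n A (k + 1)) = 2 * rt n A (k + 1) := by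
    rw [rt_succ h, xv_of_lt h, xv_of_lt (show k < n by omega), map_sub, scaleHom_X, scaleHom_X]
    ring
  have h2 : scaleHom n A (sg n A (k + 1) f) = sg n A (k + 1) (scaleHom n A f) := by
    have : (scaleHom n A).comp (sg n A (k + 1)) = (sg n A (k + 1)).comp (scaleHom n A) := by
      ext j : 1
      rw [AlgHom.comp_apply, AlgHom.comp_apply, sg_eq_rename h, scaleHom_X, map_mul, map_ofNat,
        sg_eq_rename h, rename_X, scaleHom_X]
    exact congrArg (fun φ => φ f) this
  have h3 := congrArg (scaleHom n A) (rt_mul_DD (k + 1) f)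
  rw [map_mul, h1, map_sub, h2] at h3
  rw [← h3]
  ring

theorem scaleHom_DL {l : List ℕ} (hl : ∀ k ∈ l, 1 ≤ k ∧ k < n) (f : MvPolynomial (Fin n) A) :
    DL n A l (scaleHom n A f) = 2 ^ l.length * scaleHom n A (DL n A l f) := by
  induction l with
  | nil => simp [DL_nil]
  | cons k l ih =>
    have hk := hl k List.mem_cons_self
    obtain ⟨k, rfl⟩ : ∃ j, k = j + 1 := ⟨k - 1, by omega⟩
    rw [DL_cons, ih fun j hj => hl j (List.mem_cons_of_mem _ hj), DD_mul_of_inv (by rw [map_pow, map_ofNat]),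
      scaleHom_DD hk.2, List.length_cons, DL_cons, pow_succ, mul_assoc]

/-- A constant term survives only when the number of divided differences is the degree. -/
theorem length_eq_of_constantCoeff_ne_zero {l : List ℕ} (hl : ∀ k ∈ l, 1 ≤ k ∧ k < n)
    {f : MvPolynomial (Fin n) A} {d : ℕ} (hf : scaleHom n A f = 2 ^ d * f)
    (h : constantCoeff (DL n A l f) ≠ 0) : l.length = d := by
  have h1 := congrArg constantCoeff (scaleHom_DL hl f)
  rw [hf, DL_mul_of_inv (fun k _ => by rw [map_pow, map_ofNat]), map_mul, map_mul, constantCoeff_scaleHom] at h1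
  have h2 := mul_right_cancel₀ h h1
  rw [map_pow, map_pow, map_ofNat] at h2
  have h3 : (2 : ℕ) ^ d = 2 ^ l.length := by exact_mod_cast h2
  exact (Nat.pow_right_injective le_rfl h3).symm

end Staircase

end SympSchubert

end

noncomputable section

namespace SympSchubert

open MvPolynomial

/-! ### The Cauchy formula of type `A` -/

section CauchyA

variable {n : ℕ}

section Map

variable {A B : Type*} [CommRing A] [CommRing B] [IsDomain A] [CharZero A] [IsDomain B] [CharZero B]

theorem map_DD (φ : A →+* B) (k : ℕ) (f : MvPolynomial (Fin n) A) :
    MvPolynomial.map φ (DD n A k f) = DD n B k (MvPolynomial.map φ f) := by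
  by_cases h : k < n
  · have h1 := DD_fin (A := A) ⟨k, h⟩ f
    have h2 := DD_fin (A := B) ⟨k, h⟩ (MvPolynomial.map φ f)
    simp only at h1 h2
    rw [h1, h2, map_dd']
  · rw [DD_of_le (by omega), DD_of_le (by omega), map_zero]

theorem map_DL (φ : A →+* B) (l : List ℕ) (f : MvPolynomial (Fin n) A) :
    MvPolynomial.map φ (DL n A l f) = DL n B l (MvPolynomial.map φ f) := by
  induction l with
  | nil => rfl
  | cons k l ih => rw [DL_cons, DL_cons, map_DD, ih]

end Map

/-- The divided differences in `X` and in `Y` are opposite to one another. -/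
def Balanced (E : DoublePoly n) : Prop := ∀ i m, (i + 1) + (m + 1) = n →
  C (rt n ℤ (m + 1)) * DD n _ (i + 1) E = MvPolynomial.map (sg n ℤ (m + 1)).toRingHom E - E

/-- Here the constant coefficient is the value at X = 0, a polynomial in Y. The innermost operator
in X can be traded for a difference in Y, which commutes with the remaining operators, so vanishing
at X = 0 is inherited inductively. -/
theorem Balanced.constantCoeff_DL {E : DoublePoly n} (hE : Balanced E)
    (h0 : constantCoeff E = 0) {l : List ℕ} (hl : ∀ k ∈ l, 1 ≤ k ∧ k < n) :
    constantCoeff (DL n _ l E) = 0 := by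
  induction l using List.reverseRecOn with
  | nil => exact h0
  | append_singleton l k ih =>
    have hk := hl k (by simp)
    obtain ⟨i, rfl⟩ : ∃ i, k = i + 1 := ⟨k - 1, by omega⟩
    have h1 := congrArg (fun F => constantCoeff (DL n _ l F)) (hE i (n - 2 - i) (by omega))
    rw [DL_mul_of_inv (fun j _ => by rw [← algebraMap_eq, AlgHom.commutes]), DL_sub, ← map_DL,
      map_mul, map_sub, constantCoeff_map, ih fun j hj => hl j (by simp [hj]), map_zero, sub_zero,
      constantCoeff_C] at h1
    rw [DL_append]
    exact (mul_eq_zero.1 h1).resolve_left (rt_ne_zero _)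

theorem Balanced.sub {E F : DoublePoly n} (hE : Balanced E) (hF : Balanced F) :
    Balanced (E - F) := by
  intro i m h
  rw [DD_sub, map_sub, mul_sub, hE i m h, hF i m h]
  ring

theorem Staircase.sub {A : Type*} [CommRing A] {f g : MvPolynomial (Fin n) A} (hf : Staircase f)
    (hg : Staircase g) : Staircase (f - g) := fun j =>
  (degreeOf_sub_le j f g).trans (max_le (hf j) (hg j))

theorem Balanced.eq {E F : DoublePoly n} (hE : Balanced E) (hF : Balanced F) (hE' : Staircase E)
    (hF' : Staircase F) (h : constantCoeff E = constantCoeff F) : E = F :=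
  sub_eq_zero.1 <| eq_zero_of_constantCoeff_DL (hE'.sub hF') fun _ hl =>
    (hE.sub hF).constantCoeff_DL (by rw [map_sub, h, sub_self]) hl

/-! #### The product `Δ` -/

theorem staircase_Delta : Staircase (Delta n) := by
  intro j
  refine (degreeOf_prod_le j _ _).trans ?_
  have h1 : ∀ p : Fin n × Fin n, degreeOf j (inX (X p.1) - inY (X p.2) : DoublePoly n) ≤
      if p.1 = j then 1 else 0 := by
    intro p
    refine (degreeOf_sub_le _ _ _).trans ?_
    rw [inX, inY, map_X, degreeOf_C, degreeOf_X]
    split_ifs with h1 h2 h2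
    · simp
    · exact absurd h1.symm h2
    · exact absurd h2.symm h1
    · simp
  refine (Finset.sum_le_sum fun p _ => h1 p).trans ?_
  rw [Finset.sum_filter, Fintype.sum_prod_type, Finset.sum_eq_single j]
  · rw [← card_filter_add_le j, Finset.card_filter]
    simp
  · intro b _ hb
    refine Finset.sum_eq_zero fun y _ => ?_
    simp [hb]
  · simp

variable (n) in
/-- The substitution `x_i ↦ -x_i`. -/
def negHom : MvPolynomial (Fin n) ℤ →ₐ[ℤ] MvPolynomial (Fin n) ℤ := aeval fun i => -X i

theorem constantCoeff_Delta : constantCoeff (Delta n) = negHom n (xdelta n) := by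
  rw [xdelta_eq_prod, ← prod_staircase, Delta, map_prod, map_prod]
  refine Finset.prod_bij (fun p _ => (p.2, p.1)) ?_ ?_ ?_ ?_
  · intro p hp
    simp at hp ⊢
    omega
  · intro p _ q _ h
    rw [Prod.mk.injEq] at h
    exact Prod.ext h.2 h.1
  · intro p hp
    refine ⟨(p.2, p.1), ?_, rfl⟩
    simp at hp ⊢
    omega
  · intro p _
    simp [inX, inY, negHom]

theorem sg_inX_X {i : ℕ} (h : i + 1 < n) (j : Fin n) :
    sg n (MvPolynomial (Fin n) ℤ) (i + 1) (inX (X j)) =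
      inX (X (Equiv.swap ⟨i, by omega⟩ ⟨i + 1, h⟩ j)) := by
  rw [inX, map_X, sg_eq_rename h, rename_X, inX, map_X]

theorem map_sg_inY_X {m : ℕ} (h : m + 1 < n) (j : Fin n) :
    MvPolynomial.map (sg n ℤ (m + 1)).toRingHom (inY (X j)) =
      inY (X (Equiv.swap ⟨m, by omega⟩ ⟨m + 1, h⟩ j)) := by
  rw [inY, map_C, inY]
  congr 1
  change sg n ℤ (m + 1) (X j) = _
  rw [sg_eq_rename h, rename_X]

theorem sg_inY {i : ℕ} (f : MvPolynomial (Fin n) ℤ) :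
    sg n (MvPolynomial (Fin n) ℤ) i (inY f) = inY f := by
  rw [inY, ← algebraMap_eq, AlgHom.commutes]

theorem map_inX (φ : MvPolynomial (Fin n) ℤ →+* MvPolynomial (Fin n) ℤ)
    (f : MvPolynomial (Fin n) ℤ) : MvPolynomial.map φ (inX f) = inX f := by
  rw [inX, MvPolynomial.map_map, Subsingleton.elim (φ.comp C) C]

theorem val_swap {i : ℕ} (h : i + 1 < n) (j : Fin n) :
    (Equiv.swap (⟨i, by omega⟩ : Fin n) ⟨i + 1, h⟩ j : ℕ) =
      if j.val = i then i + 1 else if j.val = i + 1 then i else j.val := by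
  rw [Equiv.swap_apply_def]
  simp only [Fin.ext_iff]
  split_ifs <;> rfl

/-- The index set of Δ is a staircase. Removing the corner factor x_i - y_m leaves a set stable
under swapping i, i + 1 in the first index and under swapping m, m + 1 in the second, so only that
linear factor has to be differentiated. -/
theorem balanced_Delta : Balanced (Delta n) := by
  intro i m him
  have hi : i + 1 < n := by omega
  have hm : m + 1 < n := by omega
  set p₀ : Fin n × Fin n := (⟨i, by omega⟩, ⟨m, by omega⟩) with hp₀
  set T : Finset (Fin n × Fin n) :=
    (Finset.univ.filter fun p : Fin n × Fin n => (p.1.val + 1) + (p.2.val + 1) ≤ n).erase p₀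
    with hT
  set S : DoublePoly n := ∏ p ∈ T, (inX (X p.1) - inY (X p.2)) with hS
  have hmem : ∀ p, p ∈ T ↔ ¬(p.1.val = i ∧ p.2.val = m) ∧ (p.1.val + 1) + (p.2.val + 1) ≤ n := by
    intro p
    rw [hT, Finset.mem_erase, Finset.mem_filter, hp₀, Ne, Prod.ext_iff, Fin.ext_iff, Fin.ext_iff]
    simp
  have hΔ : Delta n = (inX (X p₀.1) - inY (X p₀.2)) * S := by
    rw [Delta, hS, hT, Finset.mul_prod_erase _ (fun p : Fin n × Fin n =>
      (inX (X p.1) - inY (X p.2) : DoublePoly n))]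
    rw [Finset.mem_filter, hp₀]
    exact ⟨Finset.mem_univ _, by simp only; omega⟩
  have hσ : sg n _ (i + 1) S = S := by
    rw [hS, map_prod]
    refine Finset.prod_equiv (Equiv.prodCongr (Equiv.swap ⟨i, by omega⟩ ⟨i + 1, hi⟩)
      (Equiv.refl _)) (fun p => ?_) fun p _ => ?_
    · rw [hmem, hmem]
      simp only [Equiv.prodCongr_apply, Prod.map_fst, Prod.map_snd, Equiv.refl_apply]
      rw [val_swap hi]
      split_ifs <;> omega
    · rw [map_sub, sg_inX_X hi, sg_inY]
      rfl
  have hτ : MvPolynomial.map (sg n ℤ (m + 1)).toRingHom S = S := by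
    rw [hS, map_prod]
    refine Finset.prod_equiv (Equiv.prodCongr (Equiv.refl _)
      (Equiv.swap ⟨m, by omega⟩ ⟨m + 1, hm⟩)) (fun p => ?_) fun p _ => ?_
    · rw [hmem, hmem]
      simp only [Equiv.prodCongr_apply, Prod.map_fst, Prod.map_snd, Equiv.refl_apply]
      rw [val_swap hm]
      split_ifs <;> omega
    · rw [map_sub, map_sg_inY_X hm, map_inX]
      rfl
  have h1 := rt_mul_DD (A := MvPolynomial (Fin n) ℤ) (i + 1) (Delta n)
  apply mul_left_cancel₀ (rt_ne_zero (n := n) (A := MvPolynomial (Fin n) ℤ) (i + 1))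
  rw [mul_left_comm, h1, hΔ, map_mul, map_mul, hσ, hτ, map_sub, map_sub, sg_inX_X hi, sg_inY,
    map_inX, map_sg_inY_X hm, hp₀, Equiv.swap_apply_left, Equiv.swap_apply_left, rt_succ hi,
    rt_succ hm, xv_of_lt hi, xv_of_lt (show i < n by omega), xv_of_lt hm,
    xv_of_lt (show m < n by omega)]
  simp only [inX, inY, map_X, map_sub]
  ring

/-! #### The sum over permutations -/

theorem negHom_X (j : Fin n) : negHom n (X j) = -X j := by rw [negHom, aeval_X]

theorem negHom_sg {k : ℕ} (h : k + 1 < n) (f : MvPolynomial (Fin n) ℤ) :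
    negHom n (sg n ℤ (k + 1) f) = sg n ℤ (k + 1) (negHom n f) := by
  have : (negHom n).comp (sg n ℤ (k + 1)) = (sg n ℤ (k + 1)).comp (negHom n) := by
    ext j : 1
    rw [AlgHom.comp_apply, AlgHom.comp_apply, sg_eq_rename h, negHom_X, map_neg,
      sg_eq_rename h, rename_X, negHom_X]
  exact congrArg (fun φ => φ f) this

theorem rt_mul_negHom_DD {k : ℕ} (h : k + 1 < n) (f : MvPolynomial (Fin n) ℤ) :
    rt n ℤ (k + 1) * negHom n (DD n ℤ (k + 1) f) = sg n ℤ (k + 1) (negHom n f) - negHom n f := by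
  have h1 := congrArg (negHom n) (rt_mul_DD (k + 1) f)
  have h2 : negHom n (rt n ℤ (k + 1)) = -rt n ℤ (k + 1) := by
    rw [rt_succ h, xv_of_lt h, xv_of_lt (show k < n by omega), map_sub, negHom_X, negHom_X]
    ring
  rw [map_mul, h2, map_sub, negHom_sg h] at h1
  linear_combination -h1

variable (n) in
/-- The transposition of `k` and `k + 1`. -/
def adj (k : ℕ) : Equiv.Perm (Fin n) :=
  if h : k + 1 < n then Equiv.swap ⟨k, by omega⟩ ⟨k + 1, h⟩ else 1

theorem ofPerm_adj {k : ℕ} (h : k + 1 < n) : ofPerm (adj n k) = s ⟨k + 1, h⟩ := by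
  rw [adj, dif_pos h, s, if_neg (by simp)]
  rfl

theorem adj_mul_adj (k : ℕ) : adj n k * adj n k = 1 := by
  rw [adj]
  split_ifs
  · rw [Equiv.swap_mul_self]
  · rw [one_mul]

theorem adj_inv (k : ℕ) : (adj n k)⁻¹ = adj n k := inv_eq_of_mul_eq_one_left (adj_mul_adj k)

theorem DD_typeA {k : ℕ} (h : k + 1 < n) (p : Equiv.Perm (Fin n)) :
    DD n ℤ (k + 1) (typeA p) = if p⁻¹ ⟨k + 1, h⟩ < p⁻¹ ⟨k, by omega⟩ then 0
      else typeA (adj n k * p) := by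
  have h1 := DD_fin (A := ℤ) ⟨k + 1, h⟩ (typeA p)
  simp only at h1
  have h2 : Desc (ofPerm p)⁻¹ (k + 1) ↔ p⁻¹ ⟨k + 1, h⟩ < p⁻¹ ⟨k, by omega⟩ := by
    rw [← ofPerm_inv, desc_succ, oneLine_ofPerm _ h, oneLine_ofPerm _ (show k < n by omega),
      Fin.lt_def]
    omega
  rw [h1]
  split_ifs with h3
  · exact dd'_ddW'_of_desc (i := ⟨k + 1, h⟩) (h2.2 h3) _
  · rw [typeA, dd'_ddW'_of_not_desc (i := ⟨k + 1, h⟩) (fun h4 => h3 (h2.1 h4)), typeA, ofPerm_mul,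
      ofPerm_adj h]

theorem revPerm_mk {k : ℕ} (h : k < n) : revPerm n ⟨k, h⟩ = ⟨n - 1 - k, by omega⟩ := by
  ext
  rw [revPerm, Fin.revPerm_apply, Fin.val_rev]
  simp only
  omega

theorem adj_mul_revPerm {i m : ℕ} (h : (i + 1) + (m + 1) = n) :
    adj n m * revPerm n = revPerm n * adj n i := by
  rw [adj, adj, dif_pos (show m + 1 < n by omega), dif_pos (show i + 1 < n by omega),
    Equiv.mul_swap_eq_swap_mul, Equiv.swap_comm, revPerm_mk, revPerm_mk]
  congr 3
  · omega
  · omega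

/-- A permutation p contributes to the X side when it ascends at i and to the Y side when it
descends there. Right multiplication by the adjacent transposition exchanges the two classes and
matches the terms. -/
theorem balanced_sum_typeA : Balanced (∑ p : Equiv.Perm (Fin n),
    inX (typeA p⁻¹) * inY (negHom n (typeA (revPerm n * p⁻¹)))) := by
  intro i m him
  have hi : i + 1 < n := by omega
  have hm : m + 1 < n := by omega
  have e1 : ∀ p : Equiv.Perm (Fin n), DD n ℤ (i + 1) (typeA p⁻¹) =
      if p ⟨i + 1, hi⟩ < p ⟨i, by omega⟩ then 0 else typeA (p * adj n i)⁻¹ := by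
    intro p
    rw [DD_typeA hi, inv_inv, mul_inv_rev, adj_inv]
  have e2 : ∀ p : Equiv.Perm (Fin n), DD n ℤ (m + 1) (typeA (revPerm n * p⁻¹)) =
      if p ⟨i + 1, hi⟩ < p ⟨i, by omega⟩ then typeA (revPerm n * (p * adj n i)⁻¹) else 0 := by
    intro p
    rw [DD_typeA hm, mul_inv_rev, inv_inv, revPerm_inv, Equiv.Perm.mul_apply, Equiv.Perm.mul_apply,
      revPerm_mk, revPerm_mk, ← mul_assoc, adj_mul_revPerm him, mul_inv_rev, adj_inv, mul_assoc]
    have e3 : (⟨n - 1 - (m + 1), by omega⟩ : Fin n) = ⟨i, by omega⟩ := Fin.ext (by simp only; omega)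
    have e4 : (⟨n - 1 - m, by omega⟩ : Fin n) = ⟨i + 1, hi⟩ := Fin.ext (by simp only; omega)
    rw [e3, e4]
    have : p ⟨i, by omega⟩ ≠ p ⟨i + 1, hi⟩ := fun h => by
      have := congrArg Fin.val (p.injective h)
      simp at this
    split_ifs with h1 h2 h2
    · exact absurd h2 (lt_asymm h1)
    · rfl
    · rfl
    · exact absurd (lt_of_le_of_ne (not_lt.1 h2) this) h1
  rw [DD_sum, map_sum, ← Finset.sum_sub_distrib, Finset.mul_sum]
  have lhs : ∀ p : Equiv.Perm (Fin n), C (rt n ℤ (m + 1)) * DD n (MvPolynomial (Fin n) ℤ) (i + 1)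
      (inX (typeA p⁻¹) * inY (negHom n (typeA (revPerm n * p⁻¹)))) =
      if p ⟨i + 1, hi⟩ < p ⟨i, by omega⟩ then 0 else C (rt n ℤ (m + 1)) *
        (inX (typeA (p * adj n i)⁻¹) * inY (negHom n (typeA (revPerm n * p⁻¹)))) := by
    intro p
    rw [DD_mul_of_inv' (sg_inY _), inX, ← map_DD, e1]
    split_ifs
    · simp
    · rfl
  have rhs : ∀ p : Equiv.Perm (Fin n), MvPolynomial.map (sg n ℤ (m + 1)).toRingHom
      (inX (typeA p⁻¹) * inY (negHom n (typeA (revPerm n * p⁻¹)))) -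
      inX (typeA p⁻¹) * inY (negHom n (typeA (revPerm n * p⁻¹))) =
      if p ⟨i + 1, hi⟩ < p ⟨i, by omega⟩ then C (rt n ℤ (m + 1)) *
        (inX (typeA p⁻¹) * inY (negHom n (typeA (revPerm n * (p * adj n i)⁻¹)))) else 0 := by
    intro p
    have h3 := rt_mul_negHom_DD hm (typeA (revPerm n * p⁻¹))
    rw [e2] at h3
    rw [map_mul, map_inX, ← mul_sub, inY, map_C]
    change inX _ * (C (sg n ℤ (m + 1) _) - _) = _
    rw [← C_sub, ← h3]
    split_ifs
    · rw [C_mul, mul_left_comm]; rfl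
    · simp
  rw [Finset.sum_congr rfl fun p _ => lhs p, Finset.sum_congr rfl fun p _ => rhs p]
  refine Fintype.sum_equiv (Equiv.mulRight (adj n i)) _ _ fun p => ?_
  have h4 : (p * adj n i) ⟨i + 1, hi⟩ = p ⟨i, by omega⟩ := by
    rw [Equiv.Perm.mul_apply, adj, dif_pos hi, Equiv.swap_apply_right]
  have h5 : (p * adj n i) ⟨i, by omega⟩ = p ⟨i + 1, hi⟩ := by
    rw [Equiv.Perm.mul_apply, adj, dif_pos hi, Equiv.swap_apply_left]
  rw [Equiv.coe_mulRight, h4, h5, mul_assoc p, adj_mul_adj, mul_one]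
  have : p ⟨i, by omega⟩ ≠ p ⟨i + 1, hi⟩ := fun h => by
    have := congrArg Fin.val (p.injective h)
    simp at this
  split_ifs with h1 h2 h2
  · exact absurd h2 (lt_asymm h1)
  · rfl
  · rfl
  · exact absurd (lt_of_le_of_ne (not_lt.1 h1) this) h2

theorem staircase_xdelta : Staircase (xdelta n) := by
  intro j
  rw [xdelta_eq_prod]
  refine (degreeOf_prod_le j _ _).trans ?_
  rw [Finset.sum_eq_single j]
  · rw [degreeOf_X_self_pow]
  · intro i _ hi
    rw [degreeOf_X_pow_of_ne _ hi.symm]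
  · simp

theorem staircase_typeA (p : Equiv.Perm (Fin n)) : Staircase (typeA p) := by
  obtain ⟨l, hl, -, h⟩ := exists_word_of_left (A := ℤ) (v := ofPerm p) rfl
  rw [typeA, h]
  exact staircase_xdelta.DL hl

theorem staircase_sum_typeA : Staircase (∑ p : Equiv.Perm (Fin n),
    inX (typeA p⁻¹) * inY (negHom n (typeA (revPerm n * p⁻¹)))) := by
  intro j
  refine (degreeOf_sum_le _ _ _).trans (Finset.sup_le fun p _ => ?_)
  refine (degreeOf_mul_C_le _ _ _).trans (le_trans ?_ (staircase_typeA p⁻¹ j))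
  rw [degreeOf_le_iff]
  intro m hm
  exact monomial_le_degreeOf j (support_map_subset _ _ hm)

theorem scaleHom_xdelta : ∃ d, scaleHom n ℤ (xdelta n) = 2 ^ d * xdelta n := by
  refine ⟨∑ i : Fin n, (n - 1 - i.val), ?_⟩
  rw [xdelta_eq_prod, map_prod, ← Finset.prod_pow_eq_pow_sum, ← Finset.prod_mul_distrib]
  refine Finset.prod_congr rfl fun i _ => ?_
  rw [map_pow, scaleHom_X, mul_pow]

theorem eq_one_of_len {w : W n} (h : len w = 0) : w = 1 := by
  have h1 := wprod_reducedWord w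
  rw [List.length_eq_zero_iff.1 ((length_reducedWord w).trans h), wprod_nil] at h1
  exact h1.symm

/-- A nonzero constant term forces the length of p to equal the degree of x^δ, by the scaling test.
The longest element has a nonzero constant term and therefore that length, and lengths of
complementary factors of ϖ_0 add. -/
theorem constantCoeff_typeA (p : Equiv.Perm (Fin n)) :
    constantCoeff (typeA p) = if p = revPerm n then (-1) ^ (n * (n - 1) / 2) else 0 := by
  have h1 : constantCoeff (typeA (revPerm n)) = (-1) ^ (n * (n - 1) / 2) := by
    rw [typeA, show ofPerm (revPerm n) = zA n from rfl, ddW'_zA_xdelta]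
    simp
  split_ifs with h
  · rw [h, h1]
  · by_contra h0
    obtain ⟨d, hd⟩ := scaleHom_xdelta (n := n)
    have h2 : ∀ q : Equiv.Perm (Fin n), constantCoeff (typeA q) ≠ 0 → len (ofPerm q) = d := by
      intro q hq
      obtain ⟨l, hl, hlen, h⟩ := exists_word_of_left (A := ℤ) (v := ofPerm q) rfl
      rw [typeA, h] at hq
      rw [← hlen]
      exact length_eq_of_constantCoeff_ne_zero hl hd hq
    have h3 := h2 p h0
    have h4 := h2 (revPerm n) (by rw [h1]; exact pow_ne_zero _ (by norm_num))
    have h5 := (zA_split (A := ℤ) (v := ofPerm p) rfl).2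
    rw [h3, show zA n = ofPerm (revPerm n) from rfl, h4] at h5
    have h6 := eq_one_of_len (show len (ofPerm (revPerm n) * (ofPerm p)⁻¹) = 0 by omega)
    exact h (congrArg SemidirectProduct.right (mul_inv_eq_one.1 h6)).symm

/-- The Cauchy formula for the divided differences of the staircase monomial. -/
theorem sum_typeA : ∑ p : Equiv.Perm (Fin n),
    inX (typeA p⁻¹) * inY (negHom n (typeA (revPerm n * p⁻¹))) =
      (-1) ^ (n * (n - 1) / 2) * Delta n := by
  refine balanced_sum_typeA.eq (fun i m h => ?_) staircase_sum_typeA (fun j => ?_) ?_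
  · rw [DD_mul_of_inv (by simp), mul_left_comm, balanced_Delta i m h, map_mul, map_pow, map_neg,
      map_one, mul_sub]
  · refine le_trans ?_ (staircase_Delta j)
    rw [show ((-1 : DoublePoly n) ^ (n * (n - 1) / 2)) = C ((-1) ^ (n * (n - 1) / 2)) by simp]
    exact degreeOf_C_mul_le _ _ _
  -- At X = 0 only p = ϖ_0 contributes, its second factor being x^δ at -Y; on the other side Δ(0, Y)
  -- is the same monomial.
  · rw [map_mul, constantCoeff_Delta, map_sum, Finset.sum_eq_single (revPerm n)]
    · rw [revPerm_inv, revPerm_mul_self, map_mul, inX, constantCoeff_map, constantCoeff_typeA,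
        if_pos rfl, inY, constantCoeff_C, typeA, ofPerm_one, ddW'_one]
      simp
    · intro p _ hp
      rw [map_mul, inX, constantCoeff_map, constantCoeff_typeA, if_neg]
      · simp
      · rintro h
        exact hp (by rw [← inv_inv p, h, revPerm_inv])
    · simp

theorem negRevVars_CPerm (p : Equiv.Perm (Fin n)) :
    negRevVars (CPerm (p * revPerm n)) = (-1) ^ (n * (n - 1) / 2) * typeA p⁻¹ := by
  rw [CPerm_eq, negRevVars_eq, negRevVars_eq, map_mul, negRevHom_negRevHom, mul_inv_rev,
    mul_inv_cancel_left, map_pow, map_neg, map_one]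

variable (n) in
/-- The substitution `x_i ↦ x_{n+1-i}` as a homomorphism. -/
def revHom : MvPolynomial (Fin n) ℤ →ₐ[ℤ] MvPolynomial (Fin n) ℤ :=
  aeval fun i => X (revPerm n i)

theorem revVars_eq (f : MvPolynomial (Fin n) ℤ) : revVars f = revHom n f := rfl

theorem revHom_negRevHom (f : MvPolynomial (Fin n) ℤ) : revHom n (negRevHom n f) = negHom n f := by
  have : (revHom n).comp (negRevHom n) = negHom n := by
    ext i : 1
    simp [negRevHom, revHom, negHom, revPerm]
  exact congrArg (fun φ => φ f) this

theorem revVars_CPerm (p : Equiv.Perm (Fin n)) :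
    revVars (CPerm p) = (-1) ^ (n * (n - 1) / 2) * negHom n (typeA (revPerm n * p⁻¹)) := by
  rw [CPerm_eq, negRevVars_eq, revVars_eq, map_mul, revHom_negRevHom, map_pow, map_neg, map_one]

theorem sum_CPerm : ∑ p : Equiv.Perm (Fin n),
    inX (negRevVars (CPerm (p * revPerm n))) * inY (revVars (CPerm p)) =
      (-1) ^ (n * (n - 1) / 2) * Delta n := by
  rw [← sum_typeA]
  refine Finset.sum_congr rfl fun p _ => ?_
  rw [negRevVars_CPerm, revVars_CPerm, inX, inX, inY, inY]
  simp only [map_mul, map_pow, map_neg, map_one]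
  linear_combination
    (MvPolynomial.map C (typeA p⁻¹) * C (negHom n (typeA (revPerm n * p⁻¹))) : DoublePoly n) *
      neg_one_pow_mul_self (R := DoublePoly n) (n * (n - 1) / 2)

theorem CC_w0 : CC (w0 n) = (-1) ^ (n * (n - 1) / 2) * (Delta n * QKernel n) := by
  rw [CC, inv_mul_cancel, ddW'_one]

/-- The product of the expansion of Δ with the definition of the kernel, the Q̃ being the ℭ_λ; the
strict partitions are reindexed by complements. -/
theorem cauchy_formula : CC (w0 n) = ∑ p : Equiv.Perm (Fin n), ∑ lam : StrictPart n,
    inX (negRevVars (CPerm (p * revPerm n))) * inX (CPart lamᶜ) *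
      inY (revVars (CPerm p)) * inY (CPart lam) := by
  rw [CC_w0, ← mul_assoc, ← sum_CPerm, QKernel, Finset.sum_mul_sum]
  refine Finset.sum_congr rfl fun p _ => ?_
  refine Fintype.sum_equiv (compl_involutive.toPerm _) _ _ fun lam => ?_
  simp only [CPart_eq_Qtilde, Function.Involutive.coe_toPerm, compl_compl]
  ring

end CauchyA

end SympSchubert

end

noncomputable section

namespace SympSchubert

open MvPolynomial

/-! ### Vanishing of the kernel -/

section Kernel

variable {n : ℕ}

theorem memN_symmDiff {lam mu : StrictPart n} {i : ℕ} :
    memN (symmDiff lam mu) i ↔ (memN lam i ∧ ¬memN mu i) ∨ (memN mu i ∧ ¬memN lam i) := by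
  by_cases h : i < n
  · simp [memN, h, Finset.mem_symmDiff]
  · simp [memN, h]

variable (n) in
/-- The strict partition with the parts with indices `k` and `m`. -/
def pairPart (k m : ℕ) : StrictPart n := Finset.univ.filter fun j => j.val = k ∨ j.val = m

theorem memN_pairPart {k m i : ℕ} : memN (pairPart n k m) i ↔ i < n ∧ (i = k ∨ i = m) := by
  simp [memN, pairPart]

theorem memN_lt {lam : StrictPart n} {i : ℕ} (h : memN lam i) : i < n := h.1

theorem shift_hi {R : Type*} [CommRing R] (lam : StrictPart n) (G : List ℕ → R) (m : ℕ) :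
    shift G (hi lam 0 m) = ∑ k ∈ Finset.range m,
      if memN lam k then G (hi lam (k + 1) m ++ (k + 2) :: hi lam 0 k) else 0 := by
  induction m generalizing G with
  | zero => rfl
  | succ m ih =>
    rw [Finset.sum_range_succ]
    by_cases h : memN lam m
    · rw [if_pos h, hi, if_pos ⟨Nat.zero_le _, h⟩, shift_cons, ih, hi_of_le le_rfl, List.nil_append,
        add_comm]
      congr 1
      refine Finset.sum_congr rfl fun k hk => ?_
      rw [Finset.mem_range] at hk
      rw [show hi lam (k + 1) (m + 1) = (m + 1) :: hi lam (k + 1) m by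
        rw [hi, if_pos ⟨by omega, h⟩], List.cons_append]
    · rw [if_neg h, hi, if_neg (fun h' => h h'.2), ih, add_zero]
      refine Finset.sum_congr rfl fun k hk => ?_
      rw [show hi lam (k + 1) (m + 1) = hi lam (k + 1) m by
        rw [hi, if_neg (fun h' => h h'.2)]]

theorem hi_split {lam : StrictPart n} {k : ℕ} (hk : k + 1 < n) :
    hi lam 0 n = hi lam (k + 2) n ++ ((if memN lam (k + 1) then [k + 2] else []) ++
      ((if memN lam k then [k + 1] else []) ++ hi lam 0 k)) := by
  rw [← hi_self_succ lam (k + 1), ← hi_self_succ lam k, ← hi_append (by omega) (by omega),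
    ← hi_append (by omega) (by omega), ← hi_append (by omega) (by omega)]

variable (n) in
/-- The coefficient of the Pieri rule for raising the part with index `k`. -/
def pieriCoeff (k : ℕ) (lam : StrictPart n) : MvPolynomial (Fin n) ℤ :=
  if memN lam k ∧ k + 1 < n then (if memN lam (k + 1) then Qpair n (k + 2) (k + 2) else 1) else 0

/-- The index k stands for the part k + 1. If k + 2 is already a part, raising makes a doubled
entry, which factors out as Q̃_{k+2,k+2}; otherwise the part simply moves. Either way the membership
of both k and k + 1 is toggled. Raising the part n gives zero because e_{n+1} = 0. -/
theorem QT_raise {lam : StrictPart n} {k : ℕ} (h : memN lam k) :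
    QT n (hi lam (k + 1) n ++ (k + 2) :: hi lam 0 k) =
      pieriCoeff n k lam * Qtilde (symmDiff lam (pairPart n k (k + 1))) := by
  have hkn := memN_lt h
  rw [pieriCoeff]
  by_cases hk : k + 1 < n
  · have e0 : hi lam (k + 1) n =
        hi lam (k + 2) n ++ if memN lam (k + 1) then [k + 2] else [] := by
      rw [← hi_self_succ, ← hi_append (by omega) (by omega)]
    have e1 : hi (symmDiff lam (pairPart n k (k + 1))) (k + 2) n = hi lam (k + 2) n :=
      hi_congr fun i h1 h2 => by
        rw [memN_symmDiff, memN_pairPart]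
        have : ¬(i < n ∧ (i = k ∨ i = k + 1)) := by omega
        tauto
    have e2 : hi (symmDiff lam (pairPart n k (k + 1))) 0 k = hi lam 0 k :=
      hi_congr fun i h1 h2 => by
        rw [memN_symmDiff, memN_pairPart]
        have : ¬(i < n ∧ (i = k ∨ i = k + 1)) := by omega
        tauto
    have e3 : memN (symmDiff lam (pairPart n k (k + 1))) (k + 1) ↔ ¬memN lam (k + 1) := by
      rw [memN_symmDiff, memN_pairPart]
      have : k + 1 < n ∧ (k + 1 = k ∨ k + 1 = k + 1) := by omega
      tauto
    have e4 : ¬memN (symmDiff lam (pairPart n k (k + 1))) k := by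
      rw [memN_symmDiff, memN_pairPart]
      have : k < n ∧ (k = k ∨ k = k + 1) := by omega
      tauto
    rw [if_pos ⟨h, hk⟩, Qtilde_eq_QT, hi_split hk, e1, e2, if_neg e4, e0]
    by_cases h1 : memN lam (k + 1)
    · rw [if_pos h1, if_pos h1, if_neg (fun h' => e3.1 h' h1), List.append_assoc, QT]
      exact pfT_doubles _ _ _ _ _
    · rw [if_neg h1, if_neg h1, if_pos (e3.2 h1), one_mul, List.append_nil]
      rfl
  · rw [if_neg (fun h' => hk h'.2), zero_mul, hi_of_le (by omega), List.nil_append, QT]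
    refine pfT_cons_of_zero (fun b => ?_) (es_of_gt (by omega)) _
    have h1 : ∀ j, esymm (Fin n) ℤ (k + 2 + j) = 0 := fun j => es_of_gt (n := n) (by omega)
    have h2 := h1 0
    rw [add_zero] at h2
    simp only [Qpair, h1, h2]
    simp

variable (n) in
/-- The coefficient of the Pieri rule for adding a part `1`. -/
def pieriCoeffOne (lam : StrictPart n) : MvPolynomial (Fin n) ℤ :=
  if memN lam 0 then Qpair n 1 1 else 1

theorem QT_append_one (hn : 0 < n) (lam : StrictPart n) :
    QT n (hi lam 0 n ++ [1]) =
      pieriCoeffOne n lam * Qtilde (symmDiff lam (pairPart n 0 0)) := by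
  have e1 : hi (symmDiff lam (pairPart n 0 0)) 1 n = hi lam 1 n :=
    hi_congr fun i h1 h2 => by
      rw [memN_symmDiff, memN_pairPart]
      have : ¬(i < n ∧ (i = 0 ∨ i = 0)) := by omega
      tauto
  have e3 : memN (symmDiff lam (pairPart n 0 0)) 0 ↔ ¬memN lam 0 := by
    rw [memN_symmDiff, memN_pairPart]
    have : 0 < n ∧ (0 = 0 ∨ 0 = 0) := by omega
    tauto
  rw [pieriCoeffOne, Qtilde_eq_QT, hi_append (lam := lam) (Nat.zero_le 1) hn,
    hi_append (lam := symmDiff _ _) (Nat.zero_le 1) hn, hi_self_succ, hi_self_succ, e1]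
  by_cases h1 : memN lam 0
  · rw [if_pos h1, if_pos h1, if_neg (fun h' => e3.1 h' h1), List.append_assoc, QT]
    exact pfT_doubles _ _ _ _ _
  · rw [if_neg h1, if_neg h1, if_pos (e3.2 h1), one_mul, List.append_nil]

/-- The Pieri rule for the polynomials `Q̃_λ`. -/
theorem es_one_mul_Qtilde (hn : 0 < n) (lam : StrictPart n) : es n 1 * Qtilde lam =
    2 * ∑ k ∈ Finset.range n,
      pieriCoeff n k lam * Qtilde (symmDiff lam (pairPart n k (k + 1))) +
      pieriCoeffOne n lam * Qtilde (symmDiff lam (pairPart n 0 0)) := by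
  rw [← QT_append_one hn, Qtilde_eq_QT, QT,
    pfT_pieri (fun a b => Qpair_succ a b) Qpair_zero es_zero, shift_hi]
  congr 2
  refine Finset.sum_congr rfl fun k _ => ?_
  split_ifs with h
  · exact QT_raise h
  · rw [pieriCoeff, if_neg (fun h' => h h'.1), zero_mul]

theorem compl_symmDiff' (lam mu : StrictPart n) : (symmDiff lam mu)ᶜ = symmDiff lamᶜ mu := by
  ext i
  simp only [Finset.mem_compl, Finset.mem_symmDiff]
  tauto

/-- A term of the Pieri rule is adjoint to itself with respect to the duality of strict
partitions. -/
theorem sum_toggle {R : Type*} [CommRing R] (φ ψ c d : StrictPart n → R) (B : StrictPart n)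
    (h : ∀ mu, d (symmDiff mu B) = c muᶜ) :
    ∑ lam, d lam * φ (symmDiff lam B) * ψ lamᶜ =
      ∑ lam, φ lam * (c lamᶜ * ψ (symmDiff lamᶜ B)) := by
  have hB : Function.Involutive fun lam : StrictPart n => symmDiff lam B := fun lam =>
    symmDiff_symmDiff_cancel_right B lam
  refine Fintype.sum_equiv hB.toPerm _ _ fun lam => ?_
  rw [hB.coe_toPerm, ← h, symmDiff_symmDiff_cancel_right, ← compl_symmDiff',
    symmDiff_symmDiff_cancel_right]
  ring

/-- Each term of the Pieri rule toggles a fixed set of indices, with a coefficient fixed by φ.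
Replacing λ by its toggled version moves the term from the first tensor factor of the kernel to the
second, because the relevant membership conditions are complemented; so e_1 may act on either
factor. -/
theorem es_one_mul_sum (hn : 0 < n) (φ : MvPolynomial (Fin n) ℤ →+* MvPolynomial (Fin n) ℤ)
    (hφ : ∀ b, φ (Qpair n b b) = Qpair n b b) :
    φ (es n 1) * ∑ lam : StrictPart n, φ (Qtilde lam) * Qtilde lamᶜ =
      es n 1 * ∑ lam : StrictPart n, φ (Qtilde lam) * Qtilde lamᶜ := by
  have h1 : ∀ k, ∑ lam : StrictPart n, φ (pieriCoeff n k lam) *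
      φ (Qtilde (symmDiff lam (pairPart n k (k + 1)))) * Qtilde lamᶜ =
        ∑ lam : StrictPart n, φ (Qtilde lam) *
          (pieriCoeff n k lamᶜ * Qtilde (symmDiff lamᶜ (pairPart n k (k + 1)))) := fun k => by
    refine sum_toggle (fun lam => φ (Qtilde lam)) _ _ (fun lam => φ (pieriCoeff n k lam)) _
      fun mu => ?_
    by_cases hk : k + 1 < n
    · have e1 : memN (symmDiff mu (pairPart n k (k + 1))) k ↔ memN muᶜ k := by
        rw [memN_symmDiff, memN_pairPart, memN_compl (by omega)]
        have : k < n ∧ (k = k ∨ k = k + 1) := by omega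
        tauto
      have e2 : memN (symmDiff mu (pairPart n k (k + 1))) (k + 1) ↔ memN muᶜ (k + 1) := by
        rw [memN_symmDiff, memN_pairPart, memN_compl hk]
        have : k + 1 < n ∧ (k + 1 = k ∨ k + 1 = k + 1) := by omega
        tauto
      simp only [pieriCoeff, e1, e2]
      split_ifs
      · exact hφ _
      · exact map_one _
      · exact map_zero _
    · simp only [pieriCoeff, hk, and_false, if_false, map_zero]
  have h2 : ∑ lam : StrictPart n, φ (pieriCoeffOne n lam) *
      φ (Qtilde (symmDiff lam (pairPart n 0 0))) * Qtilde lamᶜ =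
        ∑ lam : StrictPart n, φ (Qtilde lam) *
          (pieriCoeffOne n lamᶜ * Qtilde (symmDiff lamᶜ (pairPart n 0 0))) := by
    refine sum_toggle (fun lam => φ (Qtilde lam)) _ _ (fun lam => φ (pieriCoeffOne n lam)) _
      fun mu => ?_
    have e1 : memN (symmDiff mu (pairPart n 0 0)) 0 ↔ memN muᶜ 0 := by
      rw [memN_symmDiff, memN_pairPart, memN_compl hn]
      have : 0 < n ∧ (0 = 0 ∨ 0 = 0) := by omega
      tauto
    simp only [pieriCoeffOne, e1]
    split_ifs
    · exact hφ _
    · exact map_one _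
  have lhs : ∀ lam : StrictPart n, φ (es n 1) * (φ (Qtilde lam) * Qtilde lamᶜ) =
      2 * ∑ k ∈ Finset.range n, φ (pieriCoeff n k lam) *
        φ (Qtilde (symmDiff lam (pairPart n k (k + 1)))) * Qtilde lamᶜ +
      φ (pieriCoeffOne n lam) * φ (Qtilde (symmDiff lam (pairPart n 0 0))) * Qtilde lamᶜ := by
    intro lam
    rw [← mul_assoc, ← map_mul, es_one_mul_Qtilde hn, map_add, map_mul, map_sum, add_mul,
      mul_assoc, Finset.sum_mul, map_ofNat]
    simp only [map_mul]
  have rhs : ∀ lam : StrictPart n, es n 1 * (φ (Qtilde lam) * Qtilde lamᶜ) =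
      2 * ∑ k ∈ Finset.range n, φ (Qtilde lam) *
          (pieriCoeff n k lamᶜ * Qtilde (symmDiff lamᶜ (pairPart n k (k + 1)))) +
      φ (Qtilde lam) * (pieriCoeffOne n lamᶜ * Qtilde (symmDiff lamᶜ (pairPart n 0 0))) := by
    intro lam
    rw [mul_left_comm, es_one_mul_Qtilde hn, ← Finset.mul_sum]
    ring
  rw [Finset.mul_sum, Finset.mul_sum, Finset.sum_congr rfl fun lam _ => lhs lam,
    Finset.sum_congr rfl fun lam _ => rhs lam, Finset.sum_add_distrib, Finset.sum_add_distrib, h2,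
    ← Finset.mul_sum, ← Finset.mul_sum, Finset.sum_comm, Finset.sum_congr rfl fun k _ => h1 k,
    Finset.sum_comm (s := Finset.univ)]

theorem act_fix {f : MvPolynomial (Fin n) ℤ} (h : ∀ i : Fin n, act (s i) f = f) (w : W n) :
    act w f = f := by
  rw [← wprod_reducedWord w]
  generalize reducedWord w = l
  induction l with
  | nil => rw [wprod_nil, act_one]
  | cons i l ih =>
    rw [show i :: l = [i] ++ l from rfl, wprod_append, wprod_singleton, act_mul, ih, h]

theorem act_Qpair_self (w : W n) (b : ℕ) : act w (Qpair n b b) = Qpair n b b :=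
  act_fix (fun i => by rw [← sg_fin]; exact sg_Qpair_self _ _) w

theorem act_es_one (w : W n) : act w (es n 1) = ∑ j, ((w.left j : ℤ) : MvPolynomial (Fin n) ℤ) * X j := by
  rw [es, esymm_one, map_sum]
  exact Fintype.sum_equiv w.right _ _ fun j => act_X w j

theorem act_es_one_ne {w : W n} (hw : w.left ≠ 1) : act w (es n 1) ≠ es n 1 := by
  intro h
  refine hw (funext fun i => ?_)
  rw [act_es_one, es, esymm_one] at h
  have h1 := congrArg (coeff (Finsupp.single i 1)) h
  rw [coeff_sum, coeff_sum, Finset.sum_eq_single i, Finset.sum_eq_single i] at h1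
  · rw [← map_intCast (C : ℤ →+* MvPolynomial (Fin n) ℤ), coeff_C_mul, coeff_X] at h1
    exact Units.ext (by simpa using h1)
  · intro j _ hj
    rw [coeff_X, if_neg]
    simpa [Finsupp.single_left_inj] using hj
  · simp
  · intro j _ hj
    rw [← map_intCast (C : ℤ →+* MvPolynomial (Fin n) ℤ), coeff_C_mul, coeff_X, if_neg, mul_zero]
    simpa [Finsupp.single_left_inj] using hj
  · simp

/-- The difference e_1(wX) - e_1(X) annihilates the sum, and it is nonzero as soon as w has a bar.
-/
theorem sum_act_Qtilde {w : W n} (hw : w.left ≠ 1) :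
    ∑ lam : StrictPart n, act w (Qtilde lam) * Qtilde lamᶜ = 0 := by
  have hn : 0 < n := by
    rcases Nat.eq_zero_or_pos n with rfl | h
    · exact absurd (Subsingleton.elim _ _) hw
    · exact h
  have h1 := es_one_mul_sum hn (act w).toRingHom (act_Qpair_self w)
  have h2 := sub_eq_zero.2 h1
  rw [← sub_mul] at h2
  exact (mul_eq_zero.1 h2).resolve_left (sub_ne_zero.2 (act_es_one_ne hw))

end Kernel

end SympSchubert

end

noncomputable section

namespace SympSchubert

open MvPolynomial

/-! ### Divided differences as combinations of group elements -/

section Expansion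

variable {n : ℕ}

instance : Fintype (W n) := Fintype.ofEquiv _ SemidirectProduct.equivProd.symm

theorem card_W : Fintype.card (W n) = Fintype.card (Equiv.Perm (Fin n) × StrictPart n) := by
  rw [Fintype.card_congr SemidirectProduct.equivProd, Fintype.card_prod, Fintype.card_prod,
    mul_comm]
  congr 1
  simp

theorem act_ne_zero (w : W n) {f : MvPolynomial (Fin n) ℤ} (hf : f ≠ 0) : act w f ≠ 0 := by
  intro h
  refine hf ?_
  rw [← act_one f, ← inv_mul_cancel w, act_mul, h, map_zero]

/-- A composite of divided differences is a combination of group elements with rational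
coefficients. -/
theorem exists_ddL_eq_sum (K : Type*) [Field K] [Algebra (MvPolynomial (Fin n) ℤ) K]
    (hK : Function.Injective (algebraMap (MvPolynomial (Fin n) ℤ) K)) (l : List (Fin n)) :
    ∃ r : W n → K, ∀ f : MvPolynomial (Fin n) ℤ,
      algebraMap _ K (l.foldr dd' f) = ∑ v, r v * algebraMap _ K (act v f) := by
  induction l using List.reverseRecOn with
  | nil =>
    refine ⟨fun v => if v = 1 then 1 else 0, fun f => ?_⟩
    rw [Finset.sum_eq_single 1]
    · simp only [if_true, one_mul, act_one, List.foldr_nil]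
    · intro v _ hv
      simp only [if_neg hv, zero_mul]
    · simp
  | append_singleton l i ih =>
    obtain ⟨r, hr⟩ := ih
    have hne : ∀ v : W n, algebraMap _ K (act v (root' ℤ i)) ≠ 0 := fun v h =>
      act_ne_zero v (root'_ne_zero i) (hK (by rw [h, map_zero]))
    -- The new coefficients are the old ones divided by the transformed root; the two terms of each
    -- divided difference are then collected by reindexing v ↦ v s_i.
    set q : W n → K := fun v => r v / algebraMap _ K (act v (root' ℤ i)) with hq
    refine ⟨fun v => q v - q (v * s i), fun f => ?_⟩
    have h1 : ∀ v : W n, r v * algebraMap _ K (act v (dd' i f)) =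
        q v * algebraMap _ K (act v f) - q v * algebraMap _ K (act (v * s i) f) := by
      intro v
      have h2 := congrArg (fun g => algebraMap _ K (act v g)) (root'_mul_dd' i f)
      simp only [map_mul, map_sub] at h2
      rw [← act_mul] at h2
      rw [← mul_sub, ← h2, hq]
      field_simp [hne v]
    have h3 : ∑ v, q v * algebraMap _ K (act (v * s i) f) =
        ∑ v, q (v * s i) * algebraMap _ K (act v f) :=
      Fintype.sum_equiv (Equiv.mulRight (s i)) _ _ fun v => by
        rw [Equiv.coe_mulRight, mul_s_mul_s]
    rw [List.foldr_append, List.foldr_cons, List.foldr_nil, hr, Finset.sum_congr rfl fun v _ => h1 v,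
      Finset.sum_sub_distrib, h3, ← Finset.sum_sub_distrib]
    exact Finset.sum_congr rfl fun v _ => by ring

theorem desc_w0_inv (i : Fin n) : Desc (w0 n)⁻¹ i := by
  rw [inv_eq_of_mul_eq_one_left w0_mul_w0, ← mul_one (w0 n), desc_w0_mul i.2]
  intro h
  have h1 := ne_zero_of_desc (u := 1) rfl h
  obtain ⟨k, hk⟩ : ∃ k, i.val = k + 1 := ⟨i.val - 1, by omega⟩
  have := i.2
  rw [hk, desc_succ, oneLine_one (by omega), oneLine_one (by omega)] at h
  omega

theorem act_ddW'_w0 (w : W n) (f : MvPolynomial (Fin n) ℤ) :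
    act w (ddW' (w0 n) f) = ddW' (w0 n) f := by
  refine act_fix (fun i => ?_) w
  rw [← sg_fin, ← DD_eq_zero_iff, DD_fin]
  exact dd'_ddW'_of_desc (desc_w0_inv i) f

theorem ddW'_mul_of_inv (w : W n) {a : MvPolynomial (Fin n) ℤ} (ha : ∀ w : W n, act w a = a)
    (f : MvPolynomial (Fin n) ℤ) : ddW' w (a * f) = a * ddW' w f := by
  rw [ddW'_eq_DL, ddW'_eq_DL, DL_mul_of_inv]
  intro k hk
  obtain ⟨i, -, rfl⟩ := List.mem_map.1 hk
  rw [sg_fin, ha]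

theorem ddW'_sum (w : W n) {ι : Type*} (t : Finset ι) (f : ι → MvPolynomial (Fin n) ℤ) :
    ddW' w (∑ i ∈ t, f i) = ∑ i ∈ t, ddW' w (f i) := by
  simp only [ddW'_eq_DL, DL_sum]

theorem ddW'_sub (w : W n) (f g : MvPolynomial (Fin n) ℤ) :
    ddW' w (f - g) = ddW' w f - ddW' w g := by
  simp only [ddW'_eq_DL, DL_sub]

theorem dd_eq (i : Fin n) (f : MvPolynomial (Fin n) ℤ) :
    dd i f = ((Equiv.Perm.sign (s i).right : ℤ) : MvPolynomial (Fin n) ℤ) * dd' i f := by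
  unfold dd'
  split_ifs with h
  · simp [s, h]
  · have : (s i).right = Equiv.swap (pre i) i := by simp [s, h]
    rw [this, Equiv.Perm.sign_swap (pre_ne h)]
    simp

theorem foldr_dd_eq (l : List (Fin n)) (f : MvPolynomial (Fin n) ℤ) : l.foldr dd f =
    ((Equiv.Perm.sign (wprod l).right : ℤ) : MvPolynomial (Fin n) ℤ) * l.foldr dd' f := by
  induction l with
  | nil => simp [wprod_nil]
  | cons i l ih =>
    have h1 := DD_mul_of_inv (n := n) (A := ℤ) (k := i)
      (f := ((Equiv.Perm.sign (wprod l).right : ℤ) : MvPolynomial (Fin n) ℤ)) (map_intCast _ _)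
      (l.foldr dd' f)
    rw [DD_fin, DD_fin] at h1
    rw [List.foldr_cons, List.foldr_cons, ih, dd_eq, h1,
      show i :: l = [i] ++ l from rfl, wprod_append, wprod_singleton, SemidirectProduct.mul_right,
      map_mul, Units.val_mul, Int.cast_mul, mul_assoc]

/-- The unsigned and signed operators differ by the sign of the underlying permutation, which is
trivial for w_0. -/
theorem ddW_w0 (f : MvPolynomial (Fin n) ℤ) : ddW (w0 n) f = ddW' (w0 n) f := by
  rw [ddW, foldr_dd_eq, wprod_reducedWord, w0, SemidirectProduct.right_inl]
  simp
  rfl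

end Expansion

/-! ### Adjoint families -/

section Families

variable {n : ℕ}

/-- The family adjoint to the products of single Schubert polynomials. -/
def dualProd (i : Equiv.Perm (Fin n) × StrictPart n) : MvPolynomial (Fin n) ℤ :=
  negRevVars (CPerm (i.1 * revPerm n)) * CPart i.2ᶜ

theorem revHom_revHom (f : MvPolynomial (Fin n) ℤ) : revHom n (revHom n f) = f := by
  have : (revHom n).comp (revHom n) = AlgHom.id ℤ _ := by
    ext i : 1
    simp [revHom, revPerm]
  exact congrArg (fun φ => φ f) this

theorem exists_lt_apply {σ : Equiv.Perm (Fin n)} (hσ : σ ≠ 1) : ∃ i, i < σ i := by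
  by_contra! h
  have h1 : ∀ k, ∀ i : Fin n, i.val = k → σ i = i := by
    intro k
    induction k using Nat.strong_induction_on with
    | _ k ih =>
      intro i hi
      by_contra hne
      have h2 : σ i < i := lt_of_le_of_ne (h i) hne
      exact hne (σ.injective (ih _ (hi ▸ h2) _ rfl))
  exact hσ (Equiv.ext fun i => h1 _ i rfl)

variable (n) in
/-- The substitution of `w X` for `X` and of `ϖ_0 X` for `Y`. -/
def evalHom (w : W n) : DoublePoly n →+* MvPolynomial (Fin n) ℤ :=
  eval₂Hom (revHom n).toRingHom fun j => act w (X j)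

theorem evalHom_inX (w : W n) (f : MvPolynomial (Fin n) ℤ) : evalHom n w (inX f) = act w f := by
  rw [evalHom, inX, coe_eval₂Hom, eval₂_map]
  have : eval₂Hom ((revHom n).toRingHom.comp C) (fun j => act w (X j)) = (act w).toRingHom := by
    ext i <;> simp
  exact congrArg (fun φ => φ f) this

theorem evalHom_inY (w : W n) (f : MvPolynomial (Fin n) ℤ) : evalHom n w (inY f) = revHom n f := by
  rw [evalHom, inY, coe_eval₂Hom, eval₂_C]
  rfl

/-- Some i has i < σ(i), and then the pair of i with the reversal of σ(i) lies under the staircase;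
its factor becomes x_{σ(i)} - x_{σ(i)} = 0. -/
theorem evalHom_Delta {σ : Equiv.Perm (Fin n)} (hσ : σ ≠ 1) : evalHom n (ofPerm σ) (Delta n) = 0 := by
  obtain ⟨i, hi⟩ := exists_lt_apply hσ
  rw [Delta, map_prod]
  refine Finset.prod_eq_zero (i := (i, revPerm n (σ i))) ?_ ?_
  · rw [Finset.mem_filter]
    refine ⟨Finset.mem_univ _, ?_⟩
    rw [revPerm, Fin.revPerm_apply, Fin.val_rev]
    have := Fin.lt_def.1 hi
    simp only
    omega
  · rw [map_sub, evalHom_inX, evalHom_inY, act_X, revHom, aeval_X]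
    simp [ofPerm, revPerm]

/-- The sum factors into a permutation part, which is ±Δ(wX, ϖ_0 X) when w is unbarred, and a Q̃
part. The first vanishes for unbarred w ≠ 1, the second for barred w. -/
theorem sum_act_dualProd {w : W n} (hw : w ≠ 1) : ∑ i, act w (dualProd i) * CProd i = 0 := by
  have h1 : ∑ i, act w (dualProd i) * CProd i =
      (∑ p : Equiv.Perm (Fin n), act w (negRevVars (CPerm (p * revPerm n))) * CPerm p) *
        ∑ lam : StrictPart n, act w (Qtilde lamᶜ) * Qtilde lam := by
    rw [Finset.sum_mul_sum, Fintype.sum_prod_type]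
    refine Finset.sum_congr rfl fun p _ => Finset.sum_congr rfl fun lam _ => ?_
    rw [dualProd, CProd, CPart_eq_Qtilde, CPart_eq_Qtilde, map_mul]
    ring
  rw [h1]
  by_cases hl : w.left = 1
  · obtain ⟨σ, rfl⟩ : ∃ σ, w = ofPerm σ := ⟨_, eq_ofPerm_of_left hl⟩
    have hσ : σ ≠ 1 := fun h => hw (by rw [h, ofPerm_one])
    have h2 := congrArg (evalHom n (ofPerm σ)) (sum_CPerm (n := n))
    rw [map_mul, evalHom_Delta hσ, mul_zero, map_sum] at h2
    simp only [map_mul, evalHom_inX, evalHom_inY, revVars_eq, revHom_revHom] at h2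
    rw [h2, zero_mul]
  · rw [mul_eq_zero_of_right _ ((Fintype.sum_equiv (compl_involutive.toPerm _) _ _
      fun lam => ?_).trans (sum_act_Qtilde hl))]
    rw [Function.Involutive.coe_toPerm, compl_compl]

theorem ddW'_zA_typeA (p : Equiv.Perm (Fin n)) :
    ddW' (zA n) (typeA p) = if p = 1 then (-1) ^ (n * (n - 1) / 2) else 0 := by
  split_ifs with h
  · rw [h, typeA, ofPerm_one, ddW'_one, ddW'_zA_xdelta]
  · obtain ⟨i, hi⟩ := exists_desc_inv (v := ofPerm p)
      fun h' => h (congrArg SemidirectProduct.right h')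
    have h0 := ne_zero_of_desc (left_inv_of_left rfl) hi
    have h1 := dd'_ddW'_of_not_desc (not_desc_inv_s_mul hi) (xdelta n)
    rw [← mul_assoc, s_mul_s, one_mul] at h1
    rw [typeA, ← h1]
    refine ddW'_dd'_of_desc ?_ _
    rw [← mul_one (zA n), desc_zA_mul rfl h0]
    have := desc_w0_inv i
    rwa [inv_eq_of_mul_eq_one_left w0_mul_w0, ← mul_one (w0 n), desc_w0_mul i.2] at this

theorem ddW'_w0_dualProd (i : Equiv.Perm (Fin n) × StrictPart n) :
    ddW' (w0 n) (dualProd i) = if i = (1, ∅) then 1 else 0 := by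
  obtain ⟨p, lam⟩ := i
  rw [dualProd, negRevVars_CPerm, CPart_eq_Qtilde, mul_assoc, ddW'_neg_one_pow_mul, ddW'_w0_eq,
    show zA n = ofPerm (revPerm n) from rfl, ddW'_mul_of_left rfl _ fun k _ _ => sg_Qtilde (by omega) _,
    show ofPerm (revPerm n) = zA n from rfl, ddW'_zA_typeA]
  simp only [inv_eq_one, Prod.mk.injEq]
  by_cases hp : p = 1
  · rw [if_pos hp, ddW'_neg_one_pow_mul, ddW'_w1_Qtilde, ← mul_assoc, neg_one_pow_mul_self, one_mul]
    simp [hp]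
  · rw [if_neg hp, zero_mul, if_neg (fun h => hp h.1), ddW'_eq_DL, DL_zero, mul_zero]

theorem CProd_one : CProd (1, (∅ : StrictPart n)) = 1 := by
  rw [CProd, CPart_eq_Qtilde, Qtilde_eq_QT, hi_empty, QT_nil, mul_one, CPerm_eq, inv_one, mul_one,
    typeA, show ofPerm (revPerm n) = zA n from rfl, ddW'_zA_xdelta, negRevVars_eq, map_pow, map_neg,
    map_one, neg_one_pow_mul_self]

/-- The reproducing property of the two families. -/
theorem sum_ddW'_w0_dualProd (f : MvPolynomial (Fin n) ℤ) :
    ∑ i, ddW' (w0 n) (f * dualProd i) * CProd i = f ∧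
      ∑ i, dualProd (n := n) i * CProd i ≠ 0 := by
  set K := FractionRing (MvPolynomial (Fin n) ℤ)
  have hK := IsFractionRing.injective (MvPolynomial (Fin n) ℤ) K
  obtain ⟨r, hr⟩ := exists_ddL_eq_sum K hK (reducedWord (w0 n))
  have h1 : ∀ f : MvPolynomial (Fin n) ℤ, algebraMap (MvPolynomial (Fin n) ℤ) K (∑ i, ddW' (w0 n) (f * dualProd i) * CProd i) =
      r 1 * algebraMap (MvPolynomial (Fin n) ℤ) K (∑ i, dualProd (n := n) i * CProd i) * algebraMap (MvPolynomial (Fin n) ℤ) K f := by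
    intro f
    have h2 : ∀ i : Equiv.Perm (Fin n) × StrictPart n, algebraMap (MvPolynomial (Fin n) ℤ) K (ddW' (w0 n) (f * dualProd i) * CProd i) =
        ∑ v, r v * algebraMap (MvPolynomial (Fin n) ℤ) K (act v f) * algebraMap (MvPolynomial (Fin n) ℤ) K (act v (dualProd i) * CProd i) := by
      intro i
      rw [map_mul, ddW', hr, Finset.sum_mul]
      refine Finset.sum_congr rfl fun v _ => ?_
      simp only [map_mul]
      ring
    -- Writing ∂_{w_0} as Σ r_v v, every v ≠ 1 drops out of the sum over i by `sum_act_dualProd`.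
    rw [map_sum, Finset.sum_congr rfl fun i _ => h2 i, Finset.sum_comm,
      Finset.sum_eq_single 1]
    · rw [← Finset.mul_sum, ← map_sum]
      simp only [act_one]
      ring
    · intro v _ hv
      rw [← Finset.mul_sum, ← map_sum, sum_act_dualProd hv, map_zero, mul_zero]
    · simp
  -- For f = 1 the only nonzero term is the one at (1, ∅), equal to 1, so the multiplier in `h1` is
  -- 1; in particular the diagonal value of the kernel is nonzero.
  have h3 := h1 1
  rw [Finset.sum_eq_single (1, ∅)] at h3
  · rw [one_mul, ddW'_w0_dualProd, if_pos rfl, CProd_one, one_mul, map_one, mul_one] at h3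
    refine ⟨hK ?_, fun h4 => ?_⟩
    · rw [h1, ← h3, one_mul]
    · rw [h4, map_zero, mul_zero] at h3
      exact one_ne_zero h3
  · intro i _ hi
    rw [one_mul, ddW'_w0_dualProd, if_neg hi, zero_mul]
  · simp

theorem act_inv_mul_ne {u v : W n} (h : u ≠ v) : u⁻¹ * v ≠ 1 := fun h' =>
  h (inv_mul_eq_one.1 h')

/-- The products of single Schubert polynomials are independent over the invariants. -/
theorem eq_zero_of_sum_mul_CProd {a : Equiv.Perm (Fin n) × StrictPart n → MvPolynomial (Fin n) ℤ}
    (ha : ∀ i (w : W n), act w (a i) = a i) (h : ∑ i, a i * CProd i = 0) : a = 0 := by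
  -- The index set of the products has as many elements as W_n, so the matrices of conjugates are
  -- square. The vanishing of the kernel makes M Nᵀ diagonal with nonzero entries, and N is
  -- nonsingular.
  let e := Fintype.equivOfCardEq (card_W (n := n))
  let M : Matrix (W n) (W n) (MvPolynomial (Fin n) ℤ) := fun v j => act v (dualProd (e j))
  let N : Matrix (W n) (W n) (MvPolynomial (Fin n) ℤ) := fun v j => act v (CProd (e j))
  have h1 : M * N.transpose =
      Matrix.diagonal fun v => act v (∑ i, dualProd i * CProd i) := by
    ext v u : 1
    rw [Matrix.mul_apply, Matrix.diagonal_apply]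
    have h2 : ∑ j, M v j * N.transpose j u =
        act u (∑ i, act (u⁻¹ * v) (dualProd i) * CProd i) := by
      rw [map_sum]
      refine Fintype.sum_equiv e _ _ fun j => ?_
      rw [map_mul, ← act_mul, mul_inv_cancel_left]
      rfl
    rw [h2]
    split_ifs with huv
    · subst huv
      simp only [inv_mul_cancel, act_one]
    · rw [sum_act_dualProd (act_inv_mul_ne (Ne.symm huv)), map_zero]
  have h3 : N.det ≠ 0 := by
    intro h4
    have h5 := congrArg Matrix.det h1
    rw [Matrix.det_mul, Matrix.det_transpose, h4, mul_zero, Matrix.det_diagonal] at h5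
    exact Finset.prod_ne_zero_iff.2
      (fun v _ => act_ne_zero v (sum_ddW'_w0_dualProd (n := n) 0).2) h5.symm
  have h6 : Matrix.mulVec N (fun j => a (e j)) = 0 := by
    funext v
    have h7 := congrArg (act v) h
    rw [map_sum, map_zero] at h7
    refine (Fintype.sum_equiv e _ _ fun j => ?_).trans h7
    rw [map_mul, ha, mul_comm]
  have h8 := Matrix.eq_zero_of_mulVec_eq_zero h3 h6
  funext i
  have h9 := congrFun h8 (e.symm i)
  simpa using h9

end Families

end SympSchubert

end

noncomputable section

namespace SympSchubert

open MvPolynomial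

/-! ### The adjoint bases -/

section Bases

variable {n : ℕ}

theorem scalarProduct_eq (f g : MvPolynomial (Fin n) ℤ) :
    scalarProduct f g = ddW' (w0 n) (f * g) := ddW_w0 _

theorem scalarProduct_comm (f g : MvPolynomial (Fin n) ℤ) :
    scalarProduct f g = scalarProduct g f := by rw [scalarProduct, mul_comm, ← scalarProduct]

theorem scalarProduct_mem (f g : MvPolynomial (Fin n) ℤ) : scalarProduct f g ∈ invariants n :=
  fun w => by rw [scalarProduct_eq]; exact act_ddW'_w0 w _

theorem scalarProduct_sum_smul {ι : Type*} [Fintype ι] (f : MvPolynomial (Fin n) ℤ)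
    (a : ι → invariants n) (g : ι → MvPolynomial (Fin n) ℤ) :
    scalarProduct f (∑ i, a i • g i) = ∑ i, (a i : MvPolynomial (Fin n) ℤ) * scalarProduct f (g i) := by
  rw [scalarProduct_eq, Finset.mul_sum, ddW'_sum]
  refine Finset.sum_congr rfl fun i _ => ?_
  rw [scalarProduct_eq, ← ddW'_mul_of_inv _ (a i).2, Subalgebra.smul_def, smul_eq_mul,
    mul_left_comm]

theorem scalarProduct_sub (f g h : MvPolynomial (Fin n) ℤ) :
    scalarProduct f (g - h) = scalarProduct f g - scalarProduct f h := by
  simp only [scalarProduct_eq, mul_sub, ddW'_sub]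

/-- The scalar product as an invariant. -/
def scalarInv (f g : MvPolynomial (Fin n) ℤ) : invariants n :=
  ⟨scalarProduct f g, scalarProduct_mem f g⟩

theorem sum_scalarInv_smul_CProd (f : MvPolynomial (Fin n) ℤ) :
    ∑ i, scalarInv f (dualProd i) • (CProd i : MvPolynomial (Fin n) ℤ) = f := by
  refine Eq.trans (Finset.sum_congr rfl fun i _ => ?_) (sum_ddW'_w0_dualProd f).1
  rw [← scalarProduct_eq]
  rfl

theorem linearIndependent_CProd : LinearIndependent (invariants n) (CProd (n := n)) := by
  rw [Fintype.linearIndependent_iff]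
  intro a ha i
  have h1 := eq_zero_of_sum_mul_CProd (a := fun i => (a i : MvPolynomial (Fin n) ℤ))
    (fun i => (a i).2) ha
  exact Subtype.ext (congrFun h1 i)

/-- Expanding a product polynomial by the reproducing formula must return it as itself, and
independence identifies the coefficients with delta functions. -/
theorem scalarProduct_CProd_dualProd (i j : Equiv.Perm (Fin n) × StrictPart n) :
    scalarProduct (CProd i) (dualProd j) = if i = j then 1 else 0 := by
  have h1 := sum_scalarInv_smul_CProd (CProd i)
  have h2 : ∑ k, (scalarInv (CProd i) (dualProd k) - if i = k then 1 else 0) • CProd k = 0 := by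
    simp only [sub_smul, Finset.sum_sub_distrib, h1, ite_smul, one_smul, zero_smul,
      Finset.sum_ite_eq, Finset.mem_univ, if_true, sub_self]
  have h3 := congrArg (fun a : invariants n => (a : MvPolynomial (Fin n) ℤ))
    (sub_eq_zero.1 (Fintype.linearIndependent_iff.1 linearIndependent_CProd _ h2 j))
  simp only [scalarInv] at h3
  rw [h3]
  split_ifs <;> rfl

/-- The scalar product is nondegenerate. -/
theorem eq_zero_of_scalarProduct_CProd {g : MvPolynomial (Fin n) ℤ}
    (h : ∀ i, scalarProduct (CProd i) g = 0) : g = 0 := by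
  have h1 : ∀ f, scalarProduct f g = 0 := by
    intro f
    rw [scalarProduct_comm, ← sum_scalarInv_smul_CProd f, scalarProduct_sum_smul]
    refine Finset.sum_eq_zero fun i _ => ?_
    rw [scalarProduct_comm, h, mul_zero]
  rw [← sum_scalarInv_smul_CProd g]
  refine Finset.sum_eq_zero fun i _ => ?_
  rw [show scalarInv g (dualProd i) = 0 from Subtype.ext
    ((scalarProduct_comm _ _).trans (h1 _)), zero_smul]

/-- Both sides have the same scalar product with every ℭ_{ϖ,λ}, and the form is nondegenerate. -/
theorem sum_scalarInv_smul_dualProd (f : MvPolynomial (Fin n) ℤ) :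
    ∑ i, scalarInv (CProd i) f • (dualProd i : MvPolynomial (Fin n) ℤ) = f := by
  refine (sub_eq_zero.1 (eq_zero_of_scalarProduct_CProd fun i => ?_)).symm
  rw [scalarProduct_sub, scalarProduct_sum_smul, Finset.sum_eq_single i]
  · rw [scalarProduct_CProd_dualProd, if_pos rfl, mul_one]
    exact sub_self _
  · intro j _ hj
    rw [scalarProduct_CProd_dualProd, if_neg hj.symm, mul_zero]
  · simp

theorem linearIndependent_dualProd : LinearIndependent (invariants n) (dualProd (n := n)) := by
  rw [Fintype.linearIndependent_iff]
  intro a ha i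
  have h1 := scalarProduct_sum_smul (CProd i) a dualProd
  rw [ha, Finset.sum_eq_single i, scalarProduct_CProd_dualProd, if_pos rfl, mul_one,
    scalarProduct_eq, mul_zero, ddW'_eq_DL, DL_zero] at h1
  · exact Subtype.ext h1.symm
  · intro j _ hj
    rw [scalarProduct_CProd_dualProd, if_neg hj.symm, mul_zero]
  · simp

variable (n) in
/-- The basis of products of single Schubert polynomials. -/
def basisCProd : Module.Basis (Equiv.Perm (Fin n) × StrictPart n) (invariants n)
    (MvPolynomial (Fin n) ℤ) :=
  Module.Basis.mk linearIndependent_CProd fun f _ => by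
    rw [← sum_scalarInv_smul_CProd f]
    exact Submodule.sum_mem _ fun i _ =>
      Submodule.smul_mem _ _ (Submodule.subset_span (Set.mem_range_self i))

variable (n) in
/-- The basis adjoint to the products of single Schubert polynomials. -/
def basisDualProd : Module.Basis (Equiv.Perm (Fin n) × StrictPart n) (invariants n)
    (MvPolynomial (Fin n) ℤ) :=
  Module.Basis.mk linearIndependent_dualProd fun f _ => by
    rw [← sum_scalarInv_smul_dualProd f]
    exact Submodule.sum_mem _ fun i _ =>
      Submodule.smul_mem _ _ (Submodule.subset_span (Set.mem_range_self i))

/-- Q̃_λ is built from elementary symmetric polynomials, so reversing the variables does not affect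
it. This reconciles the argument ϖ_0 Y in the second formula with the plain Y in the first. -/
theorem revVars_CPart (lam : StrictPart n) : revVars (CPart lam) = CPart lam := by
  rw [CPart_eq_Qtilde, Qtilde_eq_QT]
  refine map_QT_of_fix (φ := (revHom n).toRingHom) (fun a => ?_) _
  have : revHom n = rename (revPerm n) := by
    ext i : 1
    rw [revHom, aeval_X, rename_X]
  change revHom n (esymm _ _ _) = _
  rw [this, rename_esymm]

end Bases

end SympSchubert

end

/-! ### The Cauchy formula and the adjoint basis. -/

theorem corollary1p5 (n : ℕ) :
    -- the expansion of the top polynomial in products of single polynomials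
    (SympSchubert.CC (SympSchubert.w0 n) =
      ∑ p : Equiv.Perm (Fin n), ∑ lam : SympSchubert.StrictPart n,
        SympSchubert.inX
            (SympSchubert.negRevVars (SympSchubert.CPerm (p * SympSchubert.revPerm n))) *
          SympSchubert.inX (SympSchubert.CPart lamᶜ) *
          SympSchubert.inY (SympSchubert.revVars (SympSchubert.CPerm p)) *
          SympSchubert.inY (SympSchubert.CPart lam)) ∧
    -- the product basis has a unique adjoint basis, and the expansion through the two bases
    (∃ b : Module.Basis (Equiv.Perm (Fin n) × SympSchubert.StrictPart n)
        (SympSchubert.invariants n) (MvPolynomial (Fin n) ℤ),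
      (∀ i, b i = SympSchubert.CProd i) ∧
      ∃ c : Module.Basis (Equiv.Perm (Fin n) × SympSchubert.StrictPart n)
          (SympSchubert.invariants n) (MvPolynomial (Fin n) ℤ),
        SympSchubert.IsAdjoint b c ∧
        (∀ c', SympSchubert.IsAdjoint b c' → c' = c) ∧
        SympSchubert.CC (SympSchubert.w0 n) =
          ∑ p : Equiv.Perm (Fin n), ∑ lam : SympSchubert.StrictPart n,
            SympSchubert.inX (c (p, lam)) *
              SympSchubert.inY (SympSchubert.revVars (SympSchubert.CProd (p, lam)))) := by
  have hb : ∀ i, SympSchubert.basisCProd n i = SympSchubert.CProd i := fun i =>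
    Module.Basis.mk_apply _ _ i
  have hc : ∀ i, SympSchubert.basisDualProd n i = SympSchubert.dualProd i := fun i =>
    Module.Basis.mk_apply _ _ i
  refine ⟨SympSchubert.cauchy_formula, SympSchubert.basisCProd n, hb,
    SympSchubert.basisDualProd n, fun i j => ?_, fun c' h' => ?_, ?_⟩
  · rw [hb, hc, SympSchubert.scalarProduct_CProd_dualProd]
  -- Two adjoint families differ by elements orthogonal to all ℭ_{ϖ,λ}, which must vanish.
  · refine Module.Basis.eq_of_apply_eq fun j => sub_eq_zero.1 ?_
    refine SympSchubert.eq_zero_of_scalarProduct_CProd fun i => ?_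
    have h1 := h' i j
    rw [hb] at h1
    rw [SympSchubert.scalarProduct_sub, h1, hc, SympSchubert.scalarProduct_CProd_dualProd, sub_self]
  · rw [SympSchubert.cauchy_formula]
    refine Finset.sum_congr rfl fun p _ => Finset.sum_congr rfl fun lam _ => ?_
    have h1 : SympSchubert.revVars (SympSchubert.CProd (p, lam)) =
        SympSchubert.revVars (SympSchubert.CPerm p) * SympSchubert.CPart lam := by
      conv_rhs => rw [← SympSchubert.revVars_CPart]
      exact map_mul (SympSchubert.revHom n) _ _
    rw [hc, h1, SympSchubert.dualProd]
    simp only [SympSchubert.inX, SympSchubert.inY, map_mul]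
    ring
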